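/- **Conventions.** Let $k$ be a field; schemes over $k$ below are separated of finite type. *Modulus pairs.* A modulus pair is $M=(\overline M,M^\infty)$ with $\overline M$ a separated $k$-scheme of finite type and $M^\infty$ an effective Cartier divisor on $\overline M$ such that the interior $M^\circ=\overline M\setminus|M^\infty|$ is smooth over $k$; it is proper if $\overline M$ is proper over $k$. A morphism $f\colon M\to N$ is a $k$-morphism $f^\circ\colon M^\circ\to N^\circ$ such that, for $\Gamma\subset\overline M\times_k\overline N$ the closure of the graph of $f^\circ$ and $\Gamma^N$ its normalization, $\Gamma\to\overline M$ is proper and $M^\infty|_{\Gamma^N}\ge N^\infty|_{\Gamma^N}$. This gives the category $\underline{\mathbf M}\mathbf{Sm}$ of modulus pairs; $\mathbf{MSm}$ is its full subcategory of proper modulus pairs. A morphism $f$ is ambient if $f^\circ$ extends to a morphism $\overline f\colon\overline M\to\overline N$, and minimal if moreover $M^\infty=\overline f^{\,*}N^\infty$. *Squares.* A square $T$ in a category consists of objects $T(ij)$, $i,j\in\{0,1\}$, and morphisms $v_T\colon T(00)\to T(01)$, $q_T\colon T(00)\to T(10)$, $p_T\colon T(01)\to T(11)$, $u_T\colon T(10)\to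 T(11)$ with $p_Tv_T=u_Tq_T$. A cartesian square of schemes with these names is elementary Nisnevich if $u$ is an open immersion, $p$ is étale, and $p$ induces an isomorphism from the reduced complement of the image of $v$ to the reduced complement of the image of $u$. An $\underline{\mathrm{MV}}$-square is a square in $\underline{\mathbf M}\mathbf{Sm}$ that is isomorphic, as a square in $\underline{\mathbf M}\mathbf{Sm}$, to one all of whose morphisms are (ambient and) minimal and whose square of ambient spaces is elementary Nisnevich. *Off-diagonal.* For $f\colon M\to N$ with $f^\circ$ étale, $\mathrm{OD}(f)$ is the modulus pair, unique up to unique isomorphism over $M\times_NM$, with a morphism to $M\times_NM$ that together with the diagonal gives an isomorphism $M\sqcup\mathrm{OD}(f)\cong M\times_NM$. *MV-squares.* A square $T$ in $\mathbf{MSm}$ is an MV-square if 1. $T$ is a pull-back square in $\mathbf{MSm}$; 2. there are an $\underline{\mathrm{MV}}$-square $S$ with $S(11)\in\mathbf{MSm}$ and a morphism of squares $S\to T$ in $\underline{\mathbf M}\mathbf{Sm}$ such that $S^\circ\to T^\circ$ is an isomorphism of squares of smooth schemes and $S(11)\to T(11)$ is an isomorphism in $\mathbf{MSm}$; 3. the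 morphism $\mathrm{OD}(q_T)\to\mathrm{OD}(p_T)$ induced by $v_T\times v_T\colon T(00)\times_{T(10)}T(00)\to T(01)\times_{T(11)}T(01)$ is an isomorphism in $\mathbf{MSm}$. *cd-structures.* A cd-structure $P$ on a category is a class of squares closed under isomorphism. Its topology is the smallest Grothendieck topology for which, for each $T\in P$, the sieve generated by $u_T$ and $p_T$ covers $T(11)$, and the empty sieve covers each initial object. The simple coverings form the smallest class of families of morphisms with common target that contains $\{f\}$ for each isomorphism $f$, and that contains $\{u_T\circ a_i\}\cup\{p_T\circ b_j\}$ whenever $T\in P$ and $\{a_i\}$, $\{b_j\}$ are simple coverings of $T(10)$ and $T(01)$. $P$ is complete if every covering sieve of every non-initial object $X$ contains the sieve generated by a simple covering of $X$. **Theorem.** For every field $k$, the MV-squares form a cd-structure $P_{\mathrm{MV}}$ on $\mathbf{MSm}$ (they are closed under isomorphism of squares), and $P_{\mathrm{MV}}$ is complete. -/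

import Mathlib

open CategoryTheory Limits AlgebraicGeometry

universe w v u

namespace MPair

theorem ideal_comap_top {X Y : Scheme.{u}} [IsAffine X] [IsAffine Y] (f : X ⟶ Y)
    (J : Y.IdealSheafData) :
    (J.comap f).ideal ⟨⊤, isAffineOpen_top X⟩ =
      (J.ideal ⟨⊤, isAffineOpen_top Y⟩).map f.appTop.hom := by
  let K : X.IdealSheafData :=
    .ofIdealTop ((J.ideal ⟨⊤, isAffineOpen_top Y⟩).map f.appTop.hom)
  have hK : K.ideal ⟨⊤, isAffineOpen_top X⟩ =
      (J.ideal ⟨⊤, isAffineOpen_top Y⟩).map f.appTop.hom := by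
    simp [K]
  have key : ∀ K' : X.IdealSheafData, (K'.map f).ideal ⟨⊤, isAffineOpen_top Y⟩ =
      (K'.ideal ⟨⊤, isAffineOpen_top X⟩).comap f.appTop.hom := fun K' =>
    Scheme.IdealSheafData.ideal_map_of_isAffineHom K' f ⟨⊤, isAffineOpen_top Y⟩
  apply le_antisymm
  · rw [← hK]
    refine Scheme.IdealSheafData.le_map_iff_comap_le.mp
      (Scheme.IdealSheafData.le_of_isAffine ?_) _
    rw [key, hK]
    exact Ideal.le_comap_map
  · rw [Ideal.map_le_iff_le_comap, ← key]
    exact Scheme.IdealSheafData.le_map_comap J f _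

theorem le_preimage_top {X : Scheme.{u}} (V : X.Opens) : (⊤ : V.toScheme.Opens) ≤ V.ι ⁻¹ᵁ V := by
  simp

theorem ideal_comap_opens {X : Scheme.{u}} (I : X.IdealSheafData) (V : X.Opens)
    (hV : IsAffineOpen V) (h' : IsAffineOpen (⊤ : V.toScheme.Opens)) :
    (I.comap V.ι).ideal ⟨⊤, h'⟩ =
      (I.ideal ⟨V, hV⟩).map (V.ι.appLE V ⊤ (le_preimage_top V)).hom := by
  rw [Scheme.IdealSheafData.ideal_comap_of_isOpenImmersion]
  have hle : V.ι ''ᵁ ⊤ ≤ V := by simp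
  have e1 : I.ideal ⟨V.ι ''ᵁ ⊤, h'.image_of_isOpenImmersion V.ι⟩ =
      (I.ideal ⟨V, hV⟩).map (X.presheaf.map (homOfLE hle).op).hom :=
    (I.map_ideal (U := ⟨V.ι ''ᵁ ⊤, h'.image_of_isOpenImmersion V.ι⟩) (V := ⟨V, hV⟩) hle).symm
  have e2 : V.ι.appLE V ⊤ (le_preimage_top V) =
      X.presheaf.map (homOfLE hle).op ≫ (V.ι.appIso ⊤).hom := by
    rw [Scheme.Hom.appIso_hom', Scheme.Hom.map_appLE]
  rw [e1, e2, CommRingCat.hom_comp, ← Ideal.map_map]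
  exact (Ideal.map_comap_of_equiv (V.ι.appIso ⊤).commRingCatIsoToRingEquiv).symm

theorem ideal_comap_eq_map {X Y : Scheme.{u}} (f : X ⟶ Y) (J : Y.IdealSheafData)
    (U : Y.affineOpens) (V : X.affineOpens) (h : V.1 ≤ f ⁻¹ᵁ U.1) :
    (J.comap f).ideal V = (J.ideal U).map (f.appLE U.1 V.1 h).hom := by
  have : IsAffine V.1 := V.2
  have : IsAffine U.1 := U.2
  have hiso : IsIso (V.1.ι.appLE V.1 ⊤ (le_preimage_top V.1)) := by
    have hle : V.1.ι ''ᵁ ⊤ = V.1 := by simp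
    have e2 : V.1.ι.appLE V.1 ⊤ (le_preimage_top V.1) =
        X.presheaf.map (eqToHom hle).op ≫ (V.1.ι.appIso ⊤).hom := by
      rw [Scheme.Hom.appIso_hom', Scheme.Hom.map_appLE]
    rw [e2]; infer_instance
  have hg : f.resLE U.1 V.1 h ≫ U.1.ι = V.1.ι ≫ f := by simp
  have key := ideal_comap_top (f.resLE U.1 V.1 h) (J.comap U.1.ι)
  rw [← Scheme.IdealSheafData.comap_comp, hg, Scheme.IdealSheafData.comap_comp,
    ideal_comap_opens _ V.1 V.2, ideal_comap_opens _ U.1 U.2, Ideal.map_map,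
    ← CommRingCat.hom_comp] at key
  have e3 : U.1.ι.appLE U.1 ⊤ (le_preimage_top U.1) ≫ (f.resLE U.1 V.1 h).appTop =
      f.appLE U.1 V.1 h ≫ V.1.ι.appLE V.1 ⊤ (le_preimage_top V.1) := by
    have hp : (⊤ : V.1.toScheme.Opens) ≤ f.resLE U.1 V.1 h ⁻¹ᵁ ⊤ := fun _ _ => trivial
    have e4 : (f.resLE U.1 V.1 h).appTop = (f.resLE U.1 V.1 h).appLE ⊤ ⊤ hp :=
      Scheme.Hom.app_eq_appLE _
    rw [e4, Scheme.Hom.appLE_comp_appLE, Scheme.Hom.appLE_comp_appLE]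
    simp only [hg]
  rw [e3, CommRingCat.hom_comp, ← Ideal.map_map] at key
  have hbij : Function.Bijective (V.1.ι.appLE V.1 ⊤ (le_preimage_top V.1)).hom :=
    ConcreteCategory.bijective_of_isIso (V.1.ι.appLE V.1 ⊤ (le_preimage_top V.1))
  have := congrArg (Ideal.comap (V.1.ι.appLE V.1 ⊤ (le_preimage_top V.1)).hom) key
  rwa [Ideal.comap_map_of_bijective _ hbij, Ideal.comap_map_of_bijective _ hbij] at this

theorem isIntegral_app_of_universallyClosed {X Y : Scheme.{u}} (f : X ⟶ Y)
    [UniversallyClosed f] {U : Y.Opens} (hU : IsAffineOpen U) : (f.app U).hom.IsIntegral := by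
  have : IsAffine U := hU
  have h1 := isIntegral_appTop_of_universallyClosed (f ∣_ U)
  rw [morphismRestrict_appTop] at h1
  have hle : U.ι ''ᵁ ⊤ = U := by simp
  have key : ∀ U' : Y.Opens, U' = U → (f.app U').hom.IsIntegral → (f.app U).hom.IsIntegral := by
    rintro _ rfl h
    exact h
  refine key _ hle (RingHom.IsIntegral.tower_bot _ (X.presheaf.map (eqToHom
    (image_morphismRestrict_preimage f U ⊤)).op).hom (ConcreteCategory.bijective_of_isIso _).1 ?_)
  rwa [← CommRingCat.hom_comp]

theorem exists_mul_eq {X Z' G : Scheme.{u}} (j' : X ⟶ Z')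
    (hinj : ∀ O : Z'.Opens, Function.Injective (j'.app O)) (ψ : Z' ⟶ G)
    (I J : G.IdealSheafData) (U : G.affineOpens) (a b : Γ(G, U.1))
    (hI : I.ideal U = Ideal.span {a}) (hJ : J.ideal U = Ideal.span {b})
    (hb : IsUnit ((j' ≫ ψ).app U.1 b)) (h : I.comap ψ ≤ J.comap ψ) :
    ∃ c : Γ(Z', ψ ⁻¹ᵁ U.1), ψ.app U.1 b * c = ψ.app U.1 a := by
  have hcancel : ∀ (O : Z'.Opens) (hO : O ≤ ψ ⁻¹ᵁ U.1) (c d : Γ(Z', O)),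
      ψ.appLE U.1 O hO b * c = ψ.appLE U.1 O hO b * d → c = d := by
    intro O hO c d hcd
    apply hinj O
    have hu : IsUnit (j'.app O (ψ.appLE U.1 O hO b)) := by
      have : ψ.appLE U.1 O hO ≫ j'.app O =
          (j' ≫ ψ).app U.1 ≫ X.presheaf.map (homOfLE (j'.preimage_mono hO)).op := by
        rw [Scheme.Hom.app_eq_appLE j', Scheme.Hom.appLE_comp_appLE]
        rfl
      have h2 := congr($this b)
      simp only [CommRingCat.comp_apply] at h2
      rw [h2]
      exact hb.map _
    apply hu.mul_left_cancel
    rw [← map_mul, ← map_mul, hcd]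
  have hloc : ∀ O : Z'.affineOpens, ∀ hO : O.1 ≤ ψ ⁻¹ᵁ U.1,
      ∃ c : Γ(Z', O.1), ψ.appLE U.1 O.1 hO b * c = ψ.appLE U.1 O.1 hO a := by
    intro O hO
    have h1 := h O
    rw [ideal_comap_eq_map _ _ U _ hO, ideal_comap_eq_map _ _ U _ hO, hI, hJ,
      Ideal.map_span, Ideal.map_span, Set.image_singleton, Set.image_singleton,
      Ideal.span_singleton_le_span_singleton] at h1
    obtain ⟨c, hc⟩ := h1
    exact ⟨c, hc.symm⟩
  choose c hc using hloc
  let ι := {O : Z'.affineOpens // O.1 ≤ ψ ⁻¹ᵁ U.1}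
  let UU : ι → Z'.Opens := fun i => i.1.1
  have hcov : ψ ⁻¹ᵁ U.1 ≤ iSup UU := by
    intro x hx
    obtain ⟨_, ⟨V, hV, rfl⟩, hxV, hVU⟩ :=
      Z'.isBasis_affineOpens.exists_subset_of_mem_open hx (ψ ⁻¹ᵁ U.1).2
    exact TopologicalSpace.Opens.mem_iSup.mpr ⟨⟨⟨V, hV⟩, hVU⟩, hxV⟩
  have hres : ∀ (O O' : Z'.Opens) (hO : O ≤ ψ ⁻¹ᵁ U.1) (i : O' ≤ O) (t : Γ(G, U.1)),
      Z'.presheaf.map (homOfLE i).op (ψ.appLE U.1 O hO t) = ψ.appLE U.1 O' (i.trans hO) t := by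
    intro O O' hO i t
    rw [← CommRingCat.comp_apply, Scheme.Hom.appLE_map]
  obtain ⟨s, hs, -⟩ := Z'.sheaf.existsUnique_gluing' UU (ψ ⁻¹ᵁ U.1) (fun i => homOfLE i.2) hcov
    (fun i => c i.1 i.2) (by
      intro i i'
      apply hcancel (UU i ⊓ UU i') (inf_le_left.trans i.2)
      have e1 := congrArg (Z'.presheaf.map (homOfLE (inf_le_left : UU i ⊓ UU i' ≤ UU i)).op)
        (hc i.1 i.2)
      have e2 := congrArg (Z'.presheaf.map (homOfLE (inf_le_right : UU i ⊓ UU i' ≤ UU i')).op)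
        (hc i'.1 i'.2)
      rw [map_mul, hres, hres] at e1 e2
      exact e1.trans e2.symm)
  refine ⟨s, ?_⟩
  refine Z'.sheaf.eq_of_locally_eq' UU (ψ ⁻¹ᵁ U.1) (fun i => homOfLE i.2) hcov _ _ ?_
  intro i
  have e1 := hs i
  have e2 := hc i.1 i.2
  rw [← e1] at e2
  rw [Scheme.Hom.app_eq_appLE]
  refine (map_mul (Z'.presheaf.map (homOfLE i.2).op).hom _ _).trans ?_
  refine Eq.trans ?_ (e2.trans ?_)
  · congr 1
    exact hres _ _ le_rfl i.2 b
  · exact (hres _ _ le_rfl i.2 a).symm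

theorem dvd_of_descent {X G Z' : Scheme.{u}} (j : X ⟶ G) [QuasiCompact j] [QuasiSeparated j]
    (φ : Z' ⟶ j.normalization) [UniversallyClosed φ] (j' : X ⟶ Z')
    (hj' : j' ≫ φ = j.toNormalization)
    (hinj : ∀ O : Z'.Opens, Function.Injective (j'.app O))
    (I J : G.IdealSheafData) (U : G.affineOpens) (a b : Γ(G, U.1))
    (hI : I.ideal U = Ideal.span {a}) (hJ : J.ideal U = Ideal.span {b})
    (hb : IsUnit (j.app U.1 b))
    (h : I.comap (φ ≫ j.fromNormalization) ≤ J.comap (φ ≫ j.fromNormalization)) :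
    j.fromNormalization.app U.1 b ∣ j.fromNormalization.app U.1 a := by
  have hj : j' ≫ φ ≫ j.fromNormalization = j := by
    rw [← Category.assoc, hj', Scheme.Hom.toNormalization_fromNormalization]
  obtain ⟨c, hc⟩ := exists_mul_eq j' hinj (φ ≫ j.fromNormalization) I J U a b hI hJ
    (by
      rw [Scheme.Hom.congr_app hj U.1]
      exact hb.map (X.presheaf.map _).hom) h
  have hle : j ⁻¹ᵁ U.1 ≤ j' ⁻¹ᵁ (φ ≫ j.fromNormalization) ⁻¹ᵁ U.1 := by
    conv_lhs => rw [← hj]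
    exact le_rfl
  let e : Γ(X, j ⁻¹ᵁ U.1) := j'.appLE _ _ hle c
  have hint1 : (j.fromNormalization.app U.1).hom.IsIntegral :=
    IsIntegralHom.isIntegral_app _ _ U.2
  have hint2 : (φ.app (j.fromNormalization ⁻¹ᵁ U.1)).hom.IsIntegral :=
    isIntegral_app_of_universallyClosed φ (U.2.preimage _)
  have hint3 : ((φ ≫ j.fromNormalization).app U.1).hom.IsIntegralElem c := by
    rw [Scheme.Hom.comp_app]
    exact hint1.trans _ _ hint2 c
  let := (j.app U.1).hom.toAlgebra
  have hcomp : (φ ≫ j.fromNormalization).app U.1 ≫ j'.appLE _ _ hle = j.app U.1 := by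
    rw [Scheme.Hom.app_eq_appLE, Scheme.Hom.appLE_comp_appLE]
    simp only [hj, Scheme.Hom.app_eq_appLE]
  have he : IsIntegral Γ(G, U.1) e := by
    change (j.app U.1).hom.IsIntegralElem e
    rw [← hcomp, CommRingCat.hom_comp]
    exact hint3.map (j'.appLE _ _ hle).hom
  let z : Γ(j.normalization, j.fromNormalization ⁻¹ᵁ U.1) :=
    (j.normalizationObjIso U.2).inv ⟨e, he⟩
  have hnle : j ⁻¹ᵁ U.1 ≤ j.toNormalization ⁻¹ᵁ j.fromNormalization ⁻¹ᵁ U.1 := by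
    simp [← Scheme.Hom.comp_preimage]
  have hval : ∀ t, j.toNormalization.appLE _ _ hnle t = ((j.normalizationObjIso U.2).hom t).1 := by
    intro t
    rw [← j.normalizationObjIso_hom_val U.2]
    rfl
  have hninj : Function.Injective (j.toNormalization.appLE _ _ hnle) := by
    intro s t hst
    rw [hval, hval] at hst
    have := Subtype.ext hst
    have := congrArg (j.normalizationObjIso U.2).inv this
    simpa using this
  have hncomp : ∀ t, j.toNormalization.appLE _ _ hnle (j.fromNormalization.app U.1 t) =
      j.app U.1 t := by
    intro t
    rw [← CommRingCat.comp_apply, Scheme.Hom.app_eq_appLE, Scheme.Hom.appLE_comp_appLE]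
    simp only [Scheme.Hom.toNormalization_fromNormalization, Scheme.Hom.app_eq_appLE]
  refine ⟨z, hninj ?_⟩
  rw [map_mul, hncomp, hncomp, hval]
  have hz : ((j.normalizationObjIso U.2).hom z).1 = e := by simp [z]
  rw [hz, ← hcomp, CommRingCat.comp_apply, CommRingCat.comp_apply, ← map_mul, hc]

theorem descent {X G Z' : Scheme.{u}} (j : X ⟶ G) [QuasiCompact j] [QuasiSeparated j]
    (φ : Z' ⟶ j.normalization) [UniversallyClosed φ] (j' : X ⟶ Z')
    (hj' : j' ≫ φ = j.toNormalization)
    (hinj : ∀ O : Z'.Opens, Function.Injective (j'.app O))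
    (I J : G.IdealSheafData)
    (hIJ : ∀ x : G, ∃ U : G.affineOpens, x ∈ U.1 ∧ ∃ a b : Γ(G, U.1),
      I.ideal U = Ideal.span {a} ∧ J.ideal U = Ideal.span {b} ∧ IsUnit (j.app U.1 b))
    (h : I.comap (φ ≫ j.fromNormalization) ≤ J.comap (φ ≫ j.fromNormalization)) :
    I.comap j.fromNormalization ≤ J.comap j.fromNormalization := by
  choose U hxU a b hI hJ hb using hIJ
  refine Scheme.IdealSheafData.le_of_iSup_eq_top
    (fun x : G => ⟨j.fromNormalization ⁻¹ᵁ (U x).1, (U x).2.preimage _⟩) ?_ ?_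
  · rw [eq_top_iff]
    intro z _
    exact TopologicalSpace.Opens.mem_iSup.mpr ⟨j.fromNormalization z, hxU _⟩
  intro x
  dsimp only
  rw [ideal_comap_eq_map _ _ (U x) _ le_rfl, ideal_comap_eq_map _ _ (U x) _ le_rfl, hI, hJ,
    Ideal.map_span, Ideal.map_span, Set.image_singleton, Set.image_singleton,
    Ideal.span_singleton_le_span_singleton, ← Scheme.Hom.app_eq_appLE]
  exact dvd_of_descent j φ j' hj' hinj I J (U x) (a x) (b x) (hI x) (hJ x) (hb x) h

/-- An ideal sheaf defines an effective Cartier divisor if, locally, it is generated by a single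
nonzerodivisor. -/
def IsEffectiveCartier {X : Scheme.{u}} (I : X.IdealSheafData) : Prop :=
  ∀ x : X, ∃ U : X.affineOpens, x ∈ U.1 ∧
    ∃ t ∈ nonZeroDivisors Γ(X, U.1), I.ideal U = Ideal.span {t}

/-- The open complement of the support of a closed subscheme. -/
def complOpens {X : Scheme.{u}} (I : X.IdealSheafData) : X.Opens := I.support.compl

variable (k : Type u) [Field k]

/-- A modulus pair over `k`: a separated `k`-scheme `M̄` of finite type with an effective Cartier
divisor `M^∞` (given by its ideal sheaf) such that `M̄ ∖ |M^∞|` is smooth over `k`. -/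
structure ModulusPair where
  /-- the ambient space `M̄` -/
  ambient : Over (Spec (CommRingCat.of k))
  isSeparated : IsSeparated ambient.hom
  locallyOfFiniteType : LocallyOfFiniteType ambient.hom
  quasiCompact : QuasiCompact ambient.hom
  /-- the ideal sheaf of the modulus divisor `M^∞` -/
  divisor : ambient.left.IdealSheafData
  cartier : IsEffectiveCartier divisor
  smooth : Smooth ((complOpens divisor).ι ≫ ambient.hom)

namespace ModulusPair

attribute [instance] isSeparated locallyOfFiniteType quasiCompact smooth

variable {k}

/-- The interior `M° = M̄ ∖ |M^∞|`, as a `k`-scheme. -/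
noncomputable def interior (M : ModulusPair k) : Over (Spec (CommRingCat.of k)) :=
  Over.mk ((complOpens M.divisor).ι ≫ M.ambient.hom)

/-- The open immersion `M° ⟶ M̄` over `k`. -/
noncomputable def incl (M : ModulusPair k) : M.interior ⟶ M.ambient :=
  Over.homMk (complOpens M.divisor).ι rfl

instance (M : ModulusPair k) : IsOpenImmersion M.incl.left :=
  inferInstanceAs (IsOpenImmersion (complOpens M.divisor).ι)

instance (M : ModulusPair k) : IsLocallyNoetherian M.ambient.left :=
  LocallyOfFiniteType.isLocallyNoetherian M.ambient.hom

instance (M : ModulusPair k) : CompactSpace M.ambient.left :=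
  QuasiCompact.compactSpace_of_compactSpace M.ambient.hom

instance (M : ModulusPair k) : IsNoetherian M.ambient.left where

instance (M : ModulusPair k) : IsNoetherian M.interior.left := by
  change IsNoetherian (complOpens M.divisor).toScheme
  have : CompactSpace (complOpens M.divisor).toScheme :=
    isCompact_iff_compactSpace.mp
      (TopologicalSpace.NoetherianSpace.isCompact ((complOpens M.divisor : Set M.ambient.left)))
  exact { toIsLocallyNoetherian := inferInstance }

instance (M : ModulusPair k) : IsSeparated M.interior.hom :=
  inferInstanceAs (IsSeparated ((complOpens M.divisor).ι ≫ M.ambient.hom))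

/-- The morphism `(id, f) : M° ⟶ M̄ ×ₖ N̄` of a morphism `f : M° ⟶ N°`. -/
noncomputable def graphMap {M N : ModulusPair k} (f : M.interior ⟶ N.interior) :
    M.interior.left ⟶ pullback M.ambient.hom N.ambient.hom :=
  pullback.lift M.incl.left (f.left ≫ N.incl.left) (by simp)

theorem graphMap_fst {M N : ModulusPair k} (f : M.interior ⟶ N.interior) :
    graphMap f ≫ pullback.fst _ _ = M.incl.left :=
  pullback.lift_fst _ _ _

theorem graphMap_snd {M N : ModulusPair k} (f : M.interior ⟶ N.interior) :
    graphMap f ≫ pullback.snd _ _ = f.left ≫ N.incl.left :=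
  pullback.lift_snd _ _ _

instance {M N : ModulusPair k} (f : M.interior ⟶ N.interior) : QuasiCompact (graphMap f) :=
  inferInstance

instance {M N : ModulusPair k} (f : M.interior ⟶ N.interior) : IsSeparated (graphMap f) := by
  have : IsSeparated (graphMap f ≫ pullback.fst _ _) := by
    rw [graphMap, pullback.lift_fst]; infer_instance
  exact .of_comp _ (pullback.fst _ _)

/-- The graph `Γ` of the rational map `M̄ ⇢ N̄` induced by `f`: the scheme-theoretic image of `M°`
in `M̄ ×ₖ N̄`, i.e. (`M°` being reduced) the closure of the graph of `f` with its reduced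
structure. -/
noncomputable abbrev graph {M N : ModulusPair k} (f : M.interior ⟶ N.interior) : Scheme.{u} :=
  (graphMap f).image

/-- The canonical dominant morphism (an open immersion) `M° ⟶ Γ`. -/
noncomputable abbrev toGraph {M N : ModulusPair k} (f : M.interior ⟶ N.interior) :
    M.interior.left ⟶ graph f :=
  (graphMap f).toImage

/-- The projection `Γ ⟶ M̄`. -/
noncomputable abbrev graphFst {M N : ModulusPair k} (f : M.interior ⟶ N.interior) :
    graph f ⟶ M.ambient.left :=
  (graphMap f).imageι ≫ pullback.fst _ _

/-- The projection `Γ ⟶ N̄`. -/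
noncomputable abbrev graphSnd {M N : ModulusPair k} (f : M.interior ⟶ N.interior) :
    graph f ⟶ N.ambient.left :=
  (graphMap f).imageι ≫ pullback.snd _ _

theorem quasiSeparated_toImage {X Y : Scheme.{u}} (f : X ⟶ Y) [QuasiSeparated f] :
    QuasiSeparated f.toImage := by
  have : QuasiSeparated (f.toImage ≫ f.imageι) := by
    rw [Scheme.Hom.toImage_imageι]; infer_instance
  exact .of_comp _ f.imageι

instance {M N : ModulusPair k} (f : M.interior ⟶ N.interior) : QuasiSeparated (toGraph f) :=
  quasiSeparated_toImage _

/-- The normalization `Γ^N` of the graph. It is the integral closure of `Γ` in its dense open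
subscheme `M°`; as `M°` is smooth over a field, hence normal, this is the integral closure of `Γ`
in its total ring of fractions. -/
noncomputable abbrev graphNormalization {M N : ModulusPair k} (f : M.interior ⟶ N.interior) :
    Scheme.{u} :=
  (toGraph f).normalization

/-- The morphism `Γ^N ⟶ M̄`. -/
noncomputable abbrev normFst {M N : ModulusPair k} (f : M.interior ⟶ N.interior) :
    graphNormalization f ⟶ M.ambient.left :=
  (toGraph f).fromNormalization ≫ graphFst f

/-- The morphism `Γ^N ⟶ N̄`. -/
noncomputable abbrev normSnd {M N : ModulusPair k} (f : M.interior ⟶ N.interior) :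
    graphNormalization f ⟶ N.ambient.left :=
  (toGraph f).fromNormalization ≫ graphSnd f

/-- Admissibility of `f : M° ⟶ N°`: the graph is proper over `M̄`, and the pull-backs of the two
divisors to `Γ^N` satisfy `M^∞|_{Γ^N} ≥ N^∞|_{Γ^N}`, i.e. the ideal sheaf of the first is contained
in the ideal sheaf of the second. -/
structure IsAdmissible {M N : ModulusPair k} (f : M.interior ⟶ N.interior) : Prop where
  /-- the properness condition -/
  proper : IsProper (graphFst f)
  /-- the modulus condition -/
  modulus : M.divisor.comap (normFst f) ≤ N.divisor.comap (normSnd f)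

theorem isAdmissible_id (M : ModulusPair k) : IsAdmissible (𝟙 M.interior) := by
  have hker : (pullback.diagonal M.ambient.hom).ker ≤ (graphMap (𝟙 M.interior)).imageι.ker := by
    rw [Scheme.IdealSheafData.ker_subschemeι]
    have : graphMap (𝟙 M.interior) = M.incl.left ≫ pullback.diagonal M.ambient.hom := by
      apply pullback.hom_ext <;> simp [graphMap, pullback.lift_fst, pullback.lift_snd]
    rw [this]
    exact Scheme.Hom.le_ker_comp _ _
  let r := IsClosedImmersion.lift (pullback.diagonal M.ambient.hom)
    (graphMap (𝟙 M.interior)).imageι hker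
  have hr : r ≫ pullback.diagonal M.ambient.hom = (graphMap (𝟙 M.interior)).imageι :=
    IsClosedImmersion.lift_fac _ _ _
  have h1 : graphFst (𝟙 M.interior) = r := by
    rw [graphFst, ← hr]; simp
  have h2 : graphSnd (𝟙 M.interior) = r := by
    rw [graphSnd, ← hr]; simp
  constructor
  · have : IsClosedImmersion (r ≫ pullback.diagonal M.ambient.hom) := by
      rw [hr]; infer_instance
    have : IsClosedImmersion r := .of_comp_isClosedImmersion r (pullback.diagonal M.ambient.hom)
    rw [h1]; infer_instance
  · rw [normFst, normSnd, h1, h2]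

theorem exists_imageMap {X X' Y Y' : Scheme.{u}} (t : X ⟶ Y) (t' : X' ⟶ Y') (a : X ⟶ X')
    (e : Y ⟶ Y') (h : t ≫ e = a ≫ t') :
    ∃ m : t.image ⟶ t'.image, m ≫ t'.imageι = t.imageι ≫ e ∧ t.toImage ≫ m = a ≫ t'.toImage := by
  have hker : t'.imageι.ker ≤ (t.imageι ≫ e).ker := by
    rw [Scheme.Hom.ker_comp, Scheme.IdealSheafData.ker_subschemeι,
      Scheme.IdealSheafData.ker_subschemeι, ← Scheme.Hom.ker_comp, h]
    exact Scheme.Hom.le_ker_comp _ _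
  refine ⟨IsClosedImmersion.lift t'.imageι (t.imageι ≫ e) hker,
    IsClosedImmersion.lift_fac _ _ _, ?_⟩
  rw [← cancel_mono t'.imageι, Category.assoc, Category.assoc, IsClosedImmersion.lift_fac,
    Scheme.Hom.toImage_imageι, Scheme.Hom.toImage_imageι_assoc, h]

theorem exists_normalizationMap {X X' G G' : Scheme.{u}} (j : X ⟶ G) (j' : X' ⟶ G')
    [QuasiCompact j] [QuasiSeparated j] [QuasiCompact j'] [QuasiSeparated j'] (a : X ⟶ X')
    (e : G ⟶ G') (h : j ≫ e = a ≫ j') :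
    ∃ m : j.normalization ⟶ j'.normalization,
      m ≫ j'.fromNormalization = j.fromNormalization ≫ e ∧
      j.toNormalization ≫ m = a ≫ j'.toNormalization := by
  let f₁ : X ⟶ pullback e j'.fromNormalization :=
    pullback.lift j (a ≫ j'.toNormalization) (by simp [h])
  have H : j = f₁ ≫ pullback.fst _ _ := (pullback.lift_fst _ _ _).symm
  refine ⟨j.normalizationDesc f₁ (pullback.fst _ _) H ≫ pullback.snd _ _, ?_, ?_⟩
  · rw [Category.assoc, ← pullback.condition, Scheme.Hom.normalizationDesc_comp_assoc]
  · rw [Scheme.Hom.toNormalization_normalizationDesc_assoc]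
    exact pullback.lift_snd _ _ _

theorem app_injective_of_ker_eq_bot {X Y : Scheme.{u}} (f : X ⟶ Y) [QuasiCompact f]
    (h : f.ker = ⊥) (U : Y.Opens) : Function.Injective (f.app U) :=
  have : IsSchemeTheoreticallyDominant f := ⟨h⟩
  f.app_injective U

theorem isUnit_incl_app (L : ModulusPair k) (U : L.ambient.left.affineOpens)
    (b : Γ(L.ambient.left, U.1)) (hb : L.divisor.ideal U = Ideal.span {b}) :
    IsUnit (L.incl.left.app U.1 b) := by
  have h1 : L.incl.left ⁻¹ᵁ U.1 ≤ L.interior.left.basicOpen (L.incl.left.app U.1 b) := by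
    rw [← Scheme.preimage_basicOpen]
    intro x hx
    have hxU : L.incl.left x ∈ U.1 := hx
    have hxs : L.incl.left x ∉ L.divisor.support := x.2
    by_contra hxb
    apply hxs
    rw [Scheme.IdealSheafData.mem_support_iff_of_mem hxU, hb, Scheme.zeroLocus_span,
      Scheme.mem_zeroLocus_iff]
    rintro _ rfl
    exact hxb
  have h2 : L.interior.left.basicOpen (L.incl.left.app U.1 b) = L.incl.left ⁻¹ᵁ U.1 :=
    le_antisymm (Scheme.basicOpen_le _ _) h1
  exact L.interior.left.toRingedSpace.isUnit_of_isUnit_germ _ _ fun x hx =>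
    (Scheme.mem_basicOpen _ _ x hx).mp (h1 hx)

theorem exists_local_generators {M L : ModulusPair k} (h : M.interior ⟶ L.interior)
    (x : graph h) : ∃ U : (graph h).affineOpens, x ∈ U.1 ∧ ∃ a b : Γ(graph h, U.1),
      (M.divisor.comap (graphFst h)).ideal U = Ideal.span {a} ∧
      (L.divisor.comap (graphSnd h)).ideal U = Ideal.span {b} ∧
      IsUnit ((toGraph h).app U.1 b) := by
  obtain ⟨UM, hxM, a, -, ha⟩ := M.cartier (graphFst h x)
  obtain ⟨UL, hxL, b, -, hb⟩ := L.cartier (graphSnd h x)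
  obtain ⟨_, ⟨U, hU, rfl⟩, hxU, hle⟩ :=
    (graph h).isBasis_affineOpens.exists_subset_of_mem_open
      (show x ∈ graphFst h ⁻¹ᵁ UM.1 ⊓ graphSnd h ⁻¹ᵁ UL.1 from ⟨hxM, hxL⟩)
      (graphFst h ⁻¹ᵁ UM.1 ⊓ graphSnd h ⁻¹ᵁ UL.1).2
  have hM : U ≤ graphFst h ⁻¹ᵁ UM.1 := fun y hy => (hle hy).1
  have hL : U ≤ graphSnd h ⁻¹ᵁ UL.1 := fun y hy => (hle hy).2
  refine ⟨⟨U, hU⟩, hxU, (graphFst h).appLE UM.1 U hM a, (graphSnd h).appLE UL.1 U hL b, ?_, ?_, ?_⟩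
  · rw [ideal_comap_eq_map _ _ UM ⟨U, hU⟩ hM, ha, Ideal.map_span, Set.image_singleton]
  · rw [ideal_comap_eq_map _ _ UL ⟨U, hU⟩ hL, hb, Ideal.map_span, Set.image_singleton]
  · have hcomp : toGraph h ≫ graphSnd h = h.left ≫ L.incl.left := by
      rw [graphSnd, Scheme.Hom.toImage_imageι_assoc, graphMap_snd]
    have key : ∀ (c : M.interior.left ⟶ L.ambient.left), c = h.left ≫ L.incl.left →
        ∀ (V : M.interior.left.Opens) (hV : V ≤ c ⁻¹ᵁ UL.1), IsUnit (c.appLE UL.1 V hV b) := by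
      rintro _ rfl V hV
      have e : (h.left ≫ L.incl.left).appLE UL.1 V hV =
          L.incl.left.app UL.1 ≫ h.left.appLE (L.incl.left ⁻¹ᵁ UL.1) V hV := by
        rw [Scheme.Hom.comp_appLE]
      rw [e, CommRingCat.comp_apply]
      exact (isUnit_incl_app L UL b hb).map (h.left.appLE (L.incl.left ⁻¹ᵁ UL.1) V hV).hom
    have := key _ hcomp ((toGraph h) ⁻¹ᵁ U) ((toGraph h).preimage_mono hL)
    rwa [← Scheme.Hom.appLE_comp_appLE _ _ _ U _ hL le_rfl, CommRingCat.comp_apply,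
      ← Scheme.Hom.app_eq_appLE] at this

theorem isAdmissible_comp {M N L : ModulusPair k} {f : M.interior ⟶ N.interior}
    {g : N.interior ⟶ L.interior} (hf : IsAdmissible f) (hg : IsAdmissible g) :
    IsAdmissible (f ≫ g) := by
  obtain ⟨W, wf, wg, hW⟩ : ∃ (W : Scheme.{u}) (wf : W ⟶ pullback M.ambient.hom N.ambient.hom)
      (wg : W ⟶ pullback N.ambient.hom L.ambient.hom),
      IsPullback wf wg (pullback.snd _ _) (pullback.fst _ _) :=
    ⟨_, _, _, IsPullback.of_hasPullback _ _⟩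
  have hw := hW.w
  obtain ⟨wh, hwh1, hwh2⟩ : ∃ wh : W ⟶ pullback M.ambient.hom L.ambient.hom,
      wh ≫ pullback.fst _ _ = wf ≫ pullback.fst _ _ ∧
      wh ≫ pullback.snd _ _ = wg ≫ pullback.snd _ _ :=
    ⟨pullback.lift (wf ≫ pullback.fst _ _) (wg ≫ pullback.snd _ _) (by
      rw [Category.assoc, Category.assoc,
        pullback.condition (f := M.ambient.hom) (g := N.ambient.hom),
        ← pullback.condition (f := N.ambient.hom) (g := L.ambient.hom), reassoc_of% hw]), pullback.lift_fst _ _ _, pullback.lift_snd _ _ _⟩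
  obtain ⟨t, htf, htg⟩ : ∃ t : M.interior.left ⟶ W,
      t ≫ wf = 𝟙 _ ≫ graphMap f ∧ t ≫ wg = f.left ≫ graphMap g :=
    ⟨hW.lift (graphMap f) (f.left ≫ graphMap g)
      (by rw [graphMap_snd, Category.assoc, graphMap_fst]),
      (hW.lift_fst _ _ _).trans (Category.id_comp _).symm, hW.lift_snd _ _ _⟩
  have hth : t ≫ wh = 𝟙 _ ≫ graphMap (f ≫ g) := by
    rw [Category.id_comp] at htf ⊢
    apply pullback.hom_ext
    · rw [Category.assoc, hwh1, reassoc_of% htf, graphMap_fst, graphMap_fst]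
    · rw [Category.assoc, hwh2, reassoc_of% htg, graphMap_snd, graphMap_snd, Over.comp_left,
        Category.assoc]
  have : QuasiSeparated t := by
    have : QuasiSeparated (t ≫ wf) := by rw [htf]; infer_instance
    exact .of_comp t wf
  have : QuasiSeparated t.toImage := quasiSeparated_toImage t
  obtain ⟨mf, hmf, hmf'⟩ := exists_imageMap _ _ _ _ htf
  obtain ⟨mg, hmg, hmg'⟩ := exists_imageMap _ _ _ _ htg
  obtain ⟨mh, hmh, hmh'⟩ := exists_imageMap _ _ _ _ hth
  obtain ⟨nf, hnf, -⟩ := exists_normalizationMap _ (toGraph f) _ _ hmf'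
  obtain ⟨ng, hng, -⟩ := exists_normalizationMap _ (toGraph g) _ _ hmg'
  obtain ⟨nh, hnh, hnh'⟩ := exists_normalizationMap _ (toGraph (f ≫ g)) _ _ hmh'
  have e1 : mf ≫ graphFst f = mh ≫ graphFst (f ≫ g) := by
    rw [graphFst, graphFst, reassoc_of% hmf, reassoc_of% hmh, hwh1]
  have e2 : mf ≫ graphSnd f = mg ≫ graphFst g := by
    rw [graphFst, graphSnd, reassoc_of% hmf, reassoc_of% hmg, hw]
  have e3 : mg ≫ graphSnd g = mh ≫ graphSnd (f ≫ g) := by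
    rw [graphSnd, graphSnd, reassoc_of% hmg, reassoc_of% hmh, hwh2]
  have := hf.proper
  have := hg.proper
  have hproper : IsProper (mf ≫ graphFst f) := by
    obtain ⟨Q, qf, qg, hQ⟩ : ∃ (Q : Scheme.{u}) (qf : Q ⟶ graph f) (qg : Q ⟶ graph g),
      IsPullback qf qg (graphSnd f) (graphFst g) := ⟨_, _, _, IsPullback.of_hasPullback _ _⟩
    have hqf : IsProper qf := MorphismProperty.of_isPullback hQ.flip inferInstance
    obtain ⟨c, hcf, hcg⟩ : ∃ c : t.image ⟶ Q, c ≫ qf = mf ∧ c ≫ qg = mg :=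
      ⟨hQ.lift mf mg e2, hQ.lift_fst _ _ _, hQ.lift_snd _ _ _⟩
    obtain ⟨d, hdf, hdg⟩ : ∃ d : Q ⟶ W, d ≫ wf = qf ≫ (graphMap f).imageι ∧
        d ≫ wg = qg ≫ (graphMap g).imageι :=
      ⟨hW.lift (qf ≫ (graphMap f).imageι) (qg ≫ (graphMap g).imageι)
        (by simpa using hQ.w), hW.lift_fst _ _ _, hW.lift_snd _ _ _⟩
    have hcd : c ≫ d = t.imageι := by
      apply hW.hom_ext
      · rw [Category.assoc, hdf, reassoc_of% hcf, hmf]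
      · rw [Category.assoc, hdg, reassoc_of% hcg, hmg]
    have : IsSeparated (d ≫ wf ≫ pullback.fst _ _) := by
      rw [reassoc_of% hdf]; infer_instance
    have : IsSeparated d := .of_comp d (wf ≫ pullback.fst _ _)
    have : IsProper (c ≫ d) := by rw [hcd]; infer_instance
    have : IsProper c := .of_comp c d
    rw [← hcf, Category.assoc]
    infer_instance
  constructor
  · have hdom : IsDominant mh := by
      have : IsDominant (t.toImage ≫ mh) := by
        rw [hmh', Category.id_comp]; infer_instance
      exact .of_comp t.toImage mh
    have huc : UniversallyClosed (mh ≫ graphFst (f ≫ g)) := by rw [← e1]; infer_instance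
    have : UniversallyClosed mh := .of_comp_of_isSeparated mh (graphFst (f ≫ g))
    have : UniversallyClosed (graphFst (f ≫ g)) := .of_comp_surjective mh _
    exact { }
  · have hφ : UniversallyClosed nh := by
      have : UniversallyClosed (nh ≫ normFst (f ≫ g)) := by
        have e4 : nh ≫ normFst (f ≫ g) = t.toImage.fromNormalization ≫ mf ≫ graphFst f := by
          rw [normFst, reassoc_of% hnh, e1]
        rw [e4]; infer_instance
      exact .of_comp_of_isSeparated nh (normFst (f ≫ g))
    have d1 : nf ≫ normFst f = (nh ≫ (toGraph (f ≫ g)).fromNormalization) ≫ graphFst (f ≫ g) := by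
      rw [normFst, reassoc_of% hnf, e1, hnh, Category.assoc]
    have d2 : nf ≫ normSnd f = ng ≫ normFst g := by
      rw [normFst, normSnd, reassoc_of% hnf, reassoc_of% hng, e2]
    have d3 : ng ≫ normSnd g = (nh ≫ (toGraph (f ≫ g)).fromNormalization) ≫ graphSnd (f ≫ g) := by
      rw [normSnd, reassoc_of% hng, e3, hnh, Category.assoc]
    have key := descent (toGraph (f ≫ g)) nh t.toImage.toNormalization
      (hnh'.trans (Category.id_comp _))
      (app_injective_of_ker_eq_bot _ (Scheme.Hom.ker_toNormalization _))
      (M.divisor.comap (graphFst (f ≫ g))) (L.divisor.comap (graphSnd (f ≫ g)))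
      (exists_local_generators (f ≫ g))
    have k1 : M.divisor.comap (normFst (f ≫ g)) = (M.divisor.comap (graphFst (f ≫ g))).comap
        (toGraph (f ≫ g)).fromNormalization := Scheme.IdealSheafData.comap_comp _ _ _
    have k2 : L.divisor.comap (normSnd (f ≫ g)) = (L.divisor.comap (graphSnd (f ≫ g))).comap
        (toGraph (f ≫ g)).fromNormalization := Scheme.IdealSheafData.comap_comp _ _ _
    rw [k1, k2]
    refine key ?_
    rw [← Scheme.IdealSheafData.comap_comp, ← Scheme.IdealSheafData.comap_comp, ← d1, ← d3]
    have h1 := Scheme.IdealSheafData.comap_mono nf hf.modulus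
    have h2 := Scheme.IdealSheafData.comap_mono ng hg.modulus
    dsimp only at h1 h2
    rw [← Scheme.IdealSheafData.comap_comp, ← Scheme.IdealSheafData.comap_comp] at h1 h2
    rw [d2] at h1
    exact h1.trans h2

/-- The morphisms of modulus pairs: the admissible morphisms. -/
structure Hom (M N : ModulusPair k) where
  /-- the morphism `f° : M° ⟶ N°` of `k`-schemes -/
  interior : M.interior ⟶ N.interior
  admissible : IsAdmissible interior

/-- The category of modulus pairs and admissible morphisms. -/
noncomputable instance : Category.{u} (ModulusPair k) where
  Hom M N := Hom M N
  id M := ⟨𝟙 _, isAdmissible_id M⟩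
  comp f g := ⟨f.interior ≫ g.interior, isAdmissible_comp f.admissible g.admissible⟩
  id_comp f := by cases f; simp
  comp_id f := by cases f; simp
  assoc f g h := by simp

/-- The functor `M ↦ M°` (its values are smooth `k`-schemes). -/
noncomputable def interiorFunctor (k : Type u) [Field k] :
    ModulusPair k ⥤ Over (Spec (CommRingCat.of k)) where
  obj M := M.interior
  map f := Hom.interior f
  map_id _ := rfl
  map_comp _ _ := rfl

/-- The proper modulus pairs: those with proper ambient space. -/
def isProperPair (k : Type u) [Field k] : ObjectProperty (ModulusPair k) :=
  fun M => IsProper M.ambient.hom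

/-- `f̄ : M̄ ⟶ N̄` extends `f° : M° ⟶ N°` (so that `f` is ambient), and `M^∞ = f̄^* N^∞`. -/
structure IsMinimalExtension {M N : ModulusPair k} (f : M ⟶ N) (F : M.ambient ⟶ N.ambient) :
    Prop where
  extends_interior : M.incl ≫ F = Hom.interior f ≫ N.incl
  minimal : M.divisor = N.divisor.comap F.left

end ModulusPair

/-- The reduced closed subscheme on the complement of (the image of) an open immersion. -/
noncomputable def complement {U X : Scheme.{u}} (j : U ⟶ X) [IsOpenImmersion j] :
    X.IdealSheafData :=
  .vanishingIdeal j.opensRange.compl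

/-- Elementary Nisnevich squares of schemes: cartesian squares formed by the horizontal morphisms
`v : W ⟶ V` (top), `u : U ⟶ X` (bottom) and the vertical morphisms `q : W ⟶ U`, `p : V ⟶ X`, with `u` an open immersion and `p` étale (hence `v` an open immersion and `q` étale) such that `p`
induces an isomorphism `(V ∖ W)_red ≅ (X ∖ U)_red`. -/
structure IsElementaryNisnevich {W V U X : Scheme.{u}} (v : W ⟶ V) (q : W ⟶ U) (p : V ⟶ X)
    (u : U ⟶ X) : Prop where
  isPullback : IsPullback v q p u
  openImmersion_u : IsOpenImmersion u
  openImmersion_v : IsOpenImmersion v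
  etale_p : Etale p
  etale_q : Etale q
  complement_iso : ∃ φ : (complement v).subscheme ⟶ (complement u).subscheme,
    φ ≫ (complement u).subschemeι = (complement v).subschemeι ≫ p ∧ IsIso φ

open ModulusPair

variable {k}

/-- Squares of modulus pairs all of whose morphisms are ambient and minimal and whose square of
ambient spaces is an elementary Nisnevich square. -/
def IsMVFinSquare (S : Square (ModulusPair k)) : Prop :=
  ∃ (v : S.X₁.ambient ⟶ S.X₂.ambient) (q : S.X₁.ambient ⟶ S.X₃.ambient)
    (p : S.X₂.ambient ⟶ S.X₄.ambient) (u : S.X₃.ambient ⟶ S.X₄.ambient),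
    IsMinimalExtension S.f₁₂ v ∧ IsMinimalExtension S.f₁₃ q ∧
    IsMinimalExtension S.f₂₄ p ∧ IsMinimalExtension S.f₃₄ u ∧
    IsElementaryNisnevich v.left q.left p.left u.left

/-- Squares of modulus pairs which are isomorphic, in the category of squares of modulus pairs and
admissible morphisms, to a square as in `IsMVFinSquare`. -/
def IsMVBarSquare (S : Square (ModulusPair k)) : Prop :=
  ∃ S' : Square (ModulusPair k), IsMVFinSquare S' ∧ Nonempty (S' ≅ S)

variable (k) in
/-- The category of proper modulus pairs, a full subcategory of that of modulus pairs. -/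
abbrev MSm : Type (u + 1) := (isProperPair k).FullSubcategory

/-- `i : X ⟶ P` exhibits `X` as the off-diagonal of `f : M ⟶ N`: `P`, with the projections `p₁` and
`p₂`, is the fibre product `M ×_N M`, and the diagonal and `i` exhibit `P` as the disjoint union
(which is the coproduct) of `M` and `X`. -/
structure IsOffDiagonal {C : Type v} [Category.{w} C] {M N P X : C} (f : M ⟶ N) (p₁ p₂ : P ⟶ M)
    (i : X ⟶ P) : Prop where
  isPullback : IsPullback p₁ p₂ f f
  isCoproduct : Nonempty (IsColimit (BinaryCofan.mk (isPullback.lift (𝟙 M) (𝟙 M) rfl) i))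

/-- For a square `T` with corners `T.X₁ = T₀₀`, `T.X₂ = T₀₁`, `T.X₃ = T₁₀`, `T.X₄ = T₁₁` and sides
`v = T.f₁₂ : T₀₀ ⟶ T₀₁`, `q = T.f₁₃ : T₀₀ ⟶ T₁₀`, `p = T.f₂₄ : T₀₁ ⟶ T₁₁`, `u = T.f₃₄ : T₁₀ ⟶ T₁₁`:
the vertical morphisms have off-diagonals `OD(q)` and `OD(p)`, and the morphism `OD(q) ⟶ OD(p)`
induced by `v × v : T₀₀ ×_{T₁₀} T₀₀ ⟶ T₀₁ ×_{T₁₁} T₀₁` is an isomorphism. -/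
def OffDiagonalIso {C : Type v} [Category.{w} C] (T : Square C) : Prop :=
  ∃ (P X P' X' : C) (p₁ p₂ : P ⟶ T.X₁) (i : X ⟶ P) (p₁' p₂' : P' ⟶ T.X₂) (i' : X' ⟶ P')
    (φ : X ≅ X'), IsOffDiagonal T.f₁₃ p₁ p₂ i ∧ IsOffDiagonal T.f₂₄ p₁' p₂' i' ∧
      φ.hom ≫ i' ≫ p₁' = i ≫ p₁ ≫ T.f₁₂ ∧ φ.hom ≫ i' ≫ p₂' = i ≫ p₂ ≫ T.f₁₂

/-- The MV-squares in the category of proper modulus pairs: pull-back squares `T` which receive a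
morphism `S ⟶ T` of squares of modulus pairs, from an `S` as in `IsMVBarSquare` with `S₁₁` proper,
that induces isomorphisms `S° ≅ T°` and `S₁₁ ≅ T₁₁`, and for which `OD(q) ⟶ OD(p)` is an
isomorphism. -/
structure IsMVSquare (T : Square (MSm k)) : Prop where
  isPullback : T.IsPullback
  dominated : ∃ (S : Square (ModulusPair k)) (α : S ⟶ T.map (isProperPair k).ι),
    IsMVBarSquare S ∧ isProperPair k S.X₄ ∧
      IsIso ((interiorFunctor k).mapSquare.map α) ∧ IsIso α.τ₄
  offDiagonalIso : OffDiagonalIso T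

end MPair

/-- A cd-structure on a category: a class of commutative squares, closed under isomorphisms. -/
structure CDStructure (C : Type v) [Category.{w} C] where
  /-- the distinguished squares -/
  squares : ObjectProperty (Square C)
  isClosedUnderIsomorphisms : squares.IsClosedUnderIsomorphisms

namespace CDStructure

variable {C : Type v} [Category.{w} C] (P : CDStructure C)

/-- The two morphisms `T₁₀ ⟶ T₁₁` and `T₀₁ ⟶ T₁₁` of a square `T`, composed with the morphisms of
the families `R₂` on `T₀₁` and `R₃` on `T₁₀`. -/
def composite (T : Square C) (R₂ : Presieve T.X₂) (R₃ : Presieve T.X₃) : Presieve T.X₄ :=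
  fun Y h => (∃ g : Y ⟶ T.X₂, R₂ g ∧ g ≫ T.f₂₄ = h) ∨ (∃ g : Y ⟶ T.X₃, R₃ g ∧ g ≫ T.f₃₄ = h)

/-- The topology associated with a cd-structure: the smallest Grothendieck topology in which, for
each distinguished square `T`, the sieve generated by `T₁₀ ⟶ T₁₁` and `T₀₁ ⟶ T₁₁` is covering, and
in which the empty sieve covers the initial object. -/
def topology : GrothendieckTopology C :=
  sInf {J | (∀ T : Square C, P.squares T →
      Sieve.generate (composite T (Presieve.singleton (𝟙 _)) (Presieve.singleton (𝟙 _))) ∈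
        J T.X₄) ∧
    ∀ X : C, Nonempty (IsInitial X) → (⊥ : Sieve X) ∈ J X}

/-- The simple coverings: the smallest class of families of morphisms with a common target which
contains `{f}` for each isomorphism `f`, and which is closed under composing the two families on
`T₀₁` and `T₁₀` with `T₀₁ ⟶ T₁₁` and `T₁₀ ⟶ T₁₁`, for each distinguished square `T`. -/
inductive IsSimpleCovering : ∀ {X : C}, Presieve X → Prop
  | iso {X Y : C} (f : Y ⟶ X) (hf : IsIso f) : IsSimpleCovering (Presieve.singleton f)
  | square (T : Square C) (hT : P.squares T) (R₂ : Presieve T.X₂) (R₃ : Presieve T.X₃)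
      (h₂ : IsSimpleCovering R₂) (h₃ : IsSimpleCovering R₃) :
      IsSimpleCovering (composite T R₂ R₃)

/-- A cd-structure is complete if each covering sieve of an object which is not initial contains
the sieve generated by a simple covering. -/
def IsComplete : Prop :=
  ∀ X : C, IsEmpty (IsInitial X) → ∀ S ∈ P.topology X,
    ∃ R : Presieve X, P.IsSimpleCovering R ∧ Sieve.generate R ≤ S

end CDStructure

namespace MPair

theorem IsOffDiagonal.of_iso {C : Type v} [Category.{w} C] {M N P X M' N' : C} {f : M ⟶ N}
    {p₁ p₂ : P ⟶ M} {i : X ⟶ P} (h : IsOffDiagonal f p₁ p₂ i) {f' : M' ⟶ N'} (a : M ≅ M')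
    (b : N ≅ N') (w : f ≫ b.hom = a.hom ≫ f') :
    IsOffDiagonal f' (p₁ ≫ a.hom) (p₂ ≫ a.hom) i := by
  have h' : IsPullback (p₁ ≫ a.hom) (p₂ ≫ a.hom) f' f' :=
    h.isPullback.of_iso (Iso.refl _) a a b (by simp) (by simp) w w
  refine ⟨h', ?_⟩
  obtain ⟨hc⟩ := h.isCoproduct
  have e : h'.lift (𝟙 M') (𝟙 M') rfl = a.inv ≫ h.isPullback.lift (𝟙 M) (𝟙 M) rfl := by
    apply h'.hom_ext <;> simp
  rw [e]
  refine ⟨BinaryCofan.IsColimit.mk _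
    (fun {Z} s t => hc.desc (BinaryCofan.mk (a.hom ≫ s) t)) ?_ ?_ ?_⟩
  · intro Z s t
    have := hc.fac (BinaryCofan.mk (a.hom ≫ s) t) ⟨WalkingPair.left⟩
    exact (Category.assoc a.inv _ _).trans
      ((congrArg (a.inv ≫ ·) this).trans (Iso.inv_hom_id_assoc a s))
  · intro Z s t
    exact hc.fac (BinaryCofan.mk (a.hom ≫ s) t) ⟨WalkingPair.right⟩
  · intro Z s t m h1 h2
    apply BinaryCofan.IsColimit.hom_ext hc
    · refine Eq.trans ?_ (hc.fac (BinaryCofan.mk (a.hom ≫ s) t) ⟨WalkingPair.left⟩).symm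
      exact (Iso.hom_inv_id_assoc a _).symm.trans
        (congrArg (a.hom ≫ ·) ((Category.assoc a.inv _ _).symm.trans h1))
    · exact h2.trans (hc.fac (BinaryCofan.mk (a.hom ≫ s) t) ⟨WalkingPair.right⟩).symm

theorem OffDiagonalIso.of_iso {C : Type v} [Category.{w} C] {T T' : Square C} (e : T ≅ T')
    (h : OffDiagonalIso T) : OffDiagonalIso T' := by
  obtain ⟨P, X, P', X', p₁, p₂, i, p₁', p₂', i', φ, h1, h2, h3, h4⟩ := h
  let e₁ : T.X₁ ≅ T'.X₁ := Square.evaluation₁.mapIso e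
  let e₂ : T.X₂ ≅ T'.X₂ := Square.evaluation₂.mapIso e
  let e₃ : T.X₃ ≅ T'.X₃ := Square.evaluation₃.mapIso e
  let e₄ : T.X₄ ≅ T'.X₄ := Square.evaluation₄.mapIso e
  have c : e₁.hom ≫ T'.f₁₂ = T.f₁₂ ≫ e₂.hom := e.hom.comm₁₂.symm
  refine ⟨P, X, P', X', p₁ ≫ e₁.hom, p₂ ≫ e₁.hom, i, p₁' ≫ e₂.hom, p₂' ≫ e₂.hom, i', φ,
    h1.of_iso e₁ e₃ e.hom.comm₁₃, h2.of_iso e₂ e₄ e.hom.comm₂₄, ?_, ?_⟩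
  · rw [Category.assoc, c, reassoc_of% h3]
  · rw [Category.assoc, c, reassoc_of% h4]

theorem IsMVSquare.of_iso {k : Type u} [Field k] {T T' : Square (MSm k)} (e : T ≅ T') (h : IsMVSquare T) :
    IsMVSquare T' := by
  obtain ⟨S, α, hS, hS', h1, h2⟩ := h.dominated
  let e' : T.map (ModulusPair.isProperPair k).ι ≅ T'.map (ModulusPair.isProperPair k).ι :=
    (ModulusPair.isProperPair k).ι.mapSquare.mapIso e
  refine ⟨h.isPullback.of_iso e, ⟨S, α ≫ e'.hom, hS, hS', ?_, ?_⟩, h.offDiagonalIso.of_iso e⟩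
  · rw [Functor.map_comp]
    infer_instance
  · have : IsIso e'.hom.τ₄ := (Square.evaluation₄.mapIso e').isIso_hom
    change IsIso (α.τ₄ ≫ e'.hom.τ₄)
    infer_instance

/-- The cd-structure on the category of proper modulus pairs formed by the MV-squares. -/
def cdStructureMV (k : Type u) [Field k] : CDStructure (MSm k) where
  squares := fun T => IsMVSquare T
  isClosedUnderIsomorphisms := ⟨fun e h => h.of_iso e⟩

end MPair

/-!
Completeness of the MV cd-structure on proper modulus pairs.

A cd-structure is complete as soon as initial objects are strict, the distinguished squares are
stable under base change, and a distinguished square with an initial corner `T₀₁` or `T₁₀` has an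
isomorphism as its opposite side (`CDStructure.isComplete_of_exists_baseChange`). Indeed, the sieves
all of whose restrictions to non-initial objects contain a simple covering then form a Grothendieck
topology: the base change gives the generators, and transitivity is an induction on simple
coverings, in which an initial corner can be dropped because the other side is an isomorphism. It
remains to verify the hypotheses for the MV-squares.

*Morphisms.* The modulus condition, which is stated on the normalization of the closure of a graph,
is equivalent to an inequality of divisors along all points with values in valuation rings
(`IsAdmissible.valuativeLE`, `isAdmissible_of_valuativeLE`), since a ratio of local equations is
integral if it has values in all valuation rings concerned. Between proper pairs the points
themselves always extend, so that morphisms of proper modulus pairs become a matter of morphisms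
of interiors together with inequalities along valuations.

*Fibre products.* The pull-back of proper modulus pairs along a morphism `f` with `f°` étale has the
fibre product of the interiors as its interior, and the maximum of the two pulled back moduli as its
modulus. The closure of this interior in the product of the ambient spaces carries the two
divisors, but their maximum need not be Cartier; it is so on the blow-up in the ideal generated by
their two ideals, on which it is the intersection of the two ideals (`exists_blowUp`). The blow-up
is glued from charts whose coordinate rings are subrings of the rings of functions on the interior,
generated by the ratios of the local equations (`BlowUp.total`), and it is proper by the valuative
criterion: one of the two mutually inverse ratios lies in the valuation ring.

*Base change of MV-squares.* The pull-back of a square `T` along `Y ⟶ T₁₁` is again a pull-back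
square for formal reasons. Coproducts in the category of proper modulus pairs are disjoint unions,
which are stable under base change, so the condition on the off-diagonals is preserved
(`OffDiagonalIso.baseChange`). For the dominating square `S`, the ambient space of `Y` is replaced by
the closure of the graph of `Y ⟶ S₁₁`, along which the ambient square of `S` is pulled back
(`IsMVSquare.exists_dominated_baseChange`); elementary Nisnevich squares are stable under base
change.

*Initial corners.* The initial objects are the pairs with empty interior, and then the ambient space
is empty too, because the modulus is Cartier. If the ambient space of `S₀₁` is empty, then `S₁₀` is
all of `S₁₁`; if that of `S₁₀` is empty, then the étale morphism `S₀₁ ⟶ S₁₁` is an isomorphism on the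
reductions, hence an isomorphism. The corresponding side of `T` is then an isomorphism as well
(`IsMVSquare.isIso_of_isInitial_left`, `IsMVSquare.isIso_of_isInitial_right`).
-/

/-! ### The valuative criterion for admissible morphisms -/

/-- If `e` is a polynomial in its inverse `i` over `A`, then multiplying by a power of `e` gives an
integral equation for `e`. -/
theorem isIntegral_of_mem_adjoin_inv {A C : Type*} [CommRing A] [CommRing C] [Algebra A C]
    {e i : C} (hi : e * i = 1) (h : e ∈ Algebra.adjoin A {i}) : IsIntegral A e := by
  rw [Algebra.adjoin_singleton_eq_range_aeval] at h
  obtain ⟨p, hp⟩ := h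
  -- `e ^ (n + 1) = e ^ n * p (i)` is a polynomial of degree at most `n` in `e`
  refine ⟨Polynomial.X ^ (p.natDegree + 1) - p.reverse, Polynomial.monic_X_pow_sub ?_, ?_⟩
  · exact (Polynomial.degree_le_of_natDegree_le (Polynomial.reverse_natDegree_le p)).trans_lt
      (by exact_mod_cast Nat.lt_succ_self _)
  · let : Invertible i := ⟨e, hi, by rw [mul_comm, hi]⟩
    have h1 := Polynomial.eval₂_reverse_mul_pow (algebraMap A C) i p
    change Polynomial.eval₂ (algebraMap A C) e p.reverse * _ = _ at h1
    have h2 : Polynomial.eval₂ (algebraMap A C) i p = e := hp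
    have h3 : e ^ p.natDegree * i ^ p.natDegree = 1 := by rw [← mul_pow, hi, one_pow]
    rw [Polynomial.eval₂_sub, Polynomial.eval₂_pow, Polynomial.eval₂_X, sub_eq_zero]
    rw [h2] at h1
    calc e ^ (p.natDegree + 1) = e ^ p.natDegree * e := pow_succ _ _
      _ = e ^ p.natDegree * (Polynomial.eval₂ (algebraMap A C) e p.reverse * i ^ p.natDegree) := by
        rw [h1]
      _ = Polynomial.eval₂ (algebraMap A C) e p.reverse * (e ^ p.natDegree * i ^ p.natDegree) := by
        ring
      _ = _ := by rw [h3, mul_one]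

theorem isIntegral_of_isIntegral_localizationAway {A C : Type*} [CommRing A] [CommRing C]
    [Algebra A C] {e : C} (h : IsIntegral A (algebraMap C (Localization.Away e) e)) :
    IsIntegral A e := by
  obtain ⟨p, hp, h0⟩ := h
  have h1 : algebraMap C (Localization.Away e) (Polynomial.eval₂ (algebraMap A C) e p) = 0 := by
    rw [Polynomial.hom_eval₂, ← IsScalarTower.algebraMap_eq]
    exact h0
  obtain ⟨⟨_, m, rfl⟩, hm⟩ := (IsLocalization.map_eq_zero_iff (Submonoid.powers e) _ _).mp h1
  refine ⟨Polynomial.X ^ m * p, (Polynomial.monic_X_pow m).mul hp, ?_⟩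
  rw [Polynomial.eval₂_mul, Polynomial.eval₂_pow, Polynomial.eval₂_X]
  exact hm

/-- The valuative criterion for integrality. If `e` is not integral over `A`, then it does not become
a unit in the subring generated by `e⁻¹`; a valuation ring which dominates the localization of that
subring at a maximal ideal containing `e⁻¹` does not contain the image of `e`. -/
theorem isIntegral_of_valuationRing {A C : Type u} [CommRing A] [CommRing C] [Algebra A C] (e : C)
    (h : ∀ (R K : Type u) [CommRing R] [IsDomain R] [ValuationRing R] [Field K] [Algebra R K]
      [IsFractionRing R K] (g : C →+* K) (l : A →+* R),
      (algebraMap R K).comp l = g.comp (algebraMap A C) → g e ∈ (algebraMap R K).range) :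
    IsIntegral A e := by
  apply isIntegral_of_isIntegral_localizationAway
  by_contra hint
  let i : Localization.Away e := IsLocalization.Away.invSelf e
  have hi : algebraMap C (Localization.Away e) e * i = 1 := IsLocalization.Away.mul_invSelf e
  let B := Algebra.adjoin A {i}
  let b : B := ⟨i, Algebra.subset_adjoin rfl⟩
  have hb : ¬ IsUnit b := by
    rintro hu
    obtain ⟨c, hc⟩ := hu.exists_right_inv
    apply hint
    refine isIntegral_of_mem_adjoin_inv hi ?_
    have h1 : i * c.1 = 1 := congrArg Subtype.val hc
    have : algebraMap C (Localization.Away e) e = c.1 := by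
      rw [← mul_one (algebraMap C _ e), ← h1, ← mul_assoc, hi, one_mul]
    rw [this]
    exact c.2
  obtain ⟨m, hm, hbm⟩ := exists_max_ideal_of_mem_nonunits hb
  have := hm.isPrime
  -- a field-valued point of the localization of `C` which specializes to `m`
  obtain ⟨q, hq, hqm⟩ := Ideal.exists_minimalPrimes_le (bot_le : ⊥ ≤ m)
  obtain ⟨Q, hQ, hQq⟩ := Ideal.exists_comap_eq_of_mem_minimalPrimes_of_injective
    (f := B.val.toRingHom) Subtype.val_injective q hq
  let f : Localization.Away e →+* Q.ResidueField := algebraMap _ _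
  let f₁ : B →+* Q.ResidueField := f.comp B.val.toRingHom
  have hf₁ : ∀ y : m.primeCompl, IsUnit (f₁ y) := by
    rintro ⟨y, hy⟩
    rw [isUnit_iff_ne_zero]
    intro h0
    apply hy
    apply hqm
    rw [← hQq]
    exact (Ideal.algebraMap_residueField_eq_zero (I := Q)).mp h0
  obtain ⟨F, hF⟩ : ∃ F : Localization.AtPrime m →+* Q.ResidueField,
      ∀ y, F (algebraMap B _ y) = f₁ y :=
    ⟨IsLocalization.lift (M := m.primeCompl) hf₁, IsLocalization.lift_eq _⟩
  obtain ⟨V, hV, hloc⟩ := IsLocalRing.exists_factor_valuationRing (R := Localization.AtPrime m) F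
  have hV' : ∀ y : B, f₁ y ∈ V := fun y => by
    have := hV (algebraMap _ _ y)
    rwa [hF] at this
  obtain ⟨v, hv⟩ := h V Q.ResidueField (f.comp (algebraMap C _))
    ((f₁.comp (algebraMap A B)).codRestrict V.toSubring fun x => hV' _) rfl
  have hu : IsUnit (F.codRestrict V.toSubring hV (algebraMap _ _ b)) := by
    refine IsUnit.of_mul_eq_one v (Subtype.ext ?_)
    have h2 : (v : Q.ResidueField) = f (algebraMap C _ e) := hv
    change F (algebraMap _ _ b) * (v : Q.ResidueField) = 1
    rw [hF, h2]
    change f i * _ = 1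
    rw [← map_mul, mul_comm, hi, map_one]
  exact (IsLocalization.AtPrime.isUnit_to_map_iff (Localization.AtPrime m) m b).mp
    (isUnit_of_map_unit _ _ hu) hbm

namespace MPair

/-- The inclusion of the generic point of the spectrum of a valuation ring `R` with fraction
field `K`. -/
noncomputable abbrev genericPt (R K : Type u) [CommRing R] [Field K] [Algebra R K] :
    Spec (.of K) ⟶ Spec (.of R) :=
  Spec.map (CommRingCat.ofHom (algebraMap R K))

instance isDominant_genericPt (R K : Type u) [CommRing R] [Field K] [Algebra R K]
    [FaithfulSMul R K] : IsDominant (genericPt R K) := by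
  apply isDominant_of_of_appTop_injective
  have h := Scheme.ΓSpecIso_naturality (CommRingCat.ofHom (algebraMap R K))
  rw [← Iso.eq_comp_inv] at h
  have h1 : Function.Bijective (Scheme.ΓSpecIso (.of R)).hom :=
    ConcreteCategory.bijective_of_isIso _
  have h2 : Function.Bijective (Scheme.ΓSpecIso (.of K)).inv :=
    ConcreteCategory.bijective_of_isIso _
  intro a b hab
  have e := fun c => congr($h c)
  simp only [CommRingCat.comp_apply] at e
  apply h1.1
  apply FaithfulSMul.algebraMap_injective R K
  apply h2.1
  exact (e a).symm.trans (hab.trans (e b))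

theorem ker_genericPt (R K : Type u) [CommRing R] [IsDomain R] [Field K] [Algebra R K]
    [FaithfulSMul R K] : (genericPt R K).ker = ⊥ :=
  (IsSchemeTheoreticallyDominant.of_isDominant (genericPt R K)).ker_eq_bot

namespace ModulusPair
variable {k : Type u} [Field k]

/-- The valuative form of the modulus condition for `f : M° ⟶ N°`: on the spectrum of every
valuation ring which maps to both ambient spaces, compatibly with `f` at the generic point, the
pull-back of `M^∞` is at least that of `N^∞`. -/
def ValuativeLE {M N : ModulusPair k} (f : M.interior ⟶ N.interior) : Prop :=
  ∀ (R K : Type u) [CommRing R] [IsDomain R] [ValuationRing R] [Field K] [Algebra R K]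
    [IsFractionRing R K] (x : Spec (.of K) ⟶ M.interior.left) (y : Spec (.of R) ⟶ M.ambient.left)
    (z : Spec (.of R) ⟶ N.ambient.left), genericPt R K ≫ y = x ≫ M.incl.left →
    genericPt R K ≫ z = x ≫ f.left ≫ N.incl.left → M.divisor.comap y ≤ N.divisor.comap z

/-- A point of `Y` over a domain `R` lifts to the scheme-theoretic image of `X ⟶ Y` if its generic
point comes from `X`. -/
theorem exists_lift_image {X Y : Scheme.{u}} (f : X ⟶ Y) (R K : Type u) [CommRing R] [IsDomain R]
    [Field K] [Algebra R K] [FaithfulSMul R K] (x : Spec (.of K) ⟶ X) (s : Spec (.of R) ⟶ Y)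
    (h : genericPt R K ≫ s = x ≫ f) :
    ∃ t : Spec (.of R) ⟶ f.image, t ≫ f.imageι = s ∧ genericPt R K ≫ t = x ≫ f.toImage := by
  have hker : f.imageι.ker ≤ s.ker := by
    rw [Scheme.IdealSheafData.ker_subschemeι]
    have h1 : s.ker = (genericPt R K ≫ s).ker := by
      rw [Scheme.Hom.ker_comp, ker_genericPt, Scheme.IdealSheafData.map_bot]
    rw [h1, h]
    exact Scheme.Hom.le_ker_comp _ _
  refine ⟨IsClosedImmersion.lift f.imageι s hker, IsClosedImmersion.lift_fac _ _ _, ?_⟩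
  rw [← cancel_mono f.imageι, Category.assoc, IsClosedImmersion.lift_fac, Category.assoc,
    Scheme.Hom.toImage_imageι, h]

theorem comp_hom_eq_of_genericPt {S : Scheme.{u}} [S.IsSeparated] (R K : Type u) [CommRing R]
    [IsDomain R] [Field K] [Algebra R K] [FaithfulSMul R K] {a b : Spec (.of R) ⟶ S}
    (h : genericPt R K ≫ a = genericPt R K ≫ b) : a = b :=
  ext_of_isDominant (genericPt R K) h

/-- An `R`-point of both ambient spaces, compatible with `f` at the generic point, lifts to the
closure of the graph, and to its normalization, which is integral over it; there the modulus
condition holds. -/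
theorem IsAdmissible.valuativeLE {M N : ModulusPair k} {f : M.interior ⟶ N.interior}
    (hf : IsAdmissible f) : ValuativeLE f := by
  intro R K _ _ _ _ _ _ x y z hy hz
  have hyz : y ≫ M.ambient.hom = z ≫ N.ambient.hom := by
    apply comp_hom_eq_of_genericPt R K
    rw [reassoc_of% hy, reassoc_of% hz, Over.w, Over.w, Over.w]
  obtain ⟨s, hs1, hs2⟩ : ∃ s : Spec (.of R) ⟶ pullback M.ambient.hom N.ambient.hom,
      s ≫ pullback.fst _ _ = y ∧ s ≫ pullback.snd _ _ = z :=
    ⟨pullback.lift y z hyz, pullback.lift_fst _ _ _, pullback.lift_snd _ _ _⟩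
  obtain ⟨t, ht, ht'⟩ := exists_lift_image (graphMap f) R K x s (by
    apply pullback.hom_ext
    · rw [Category.assoc, Category.assoc, hs1, hy, graphMap_fst]
    · rw [Category.assoc, Category.assoc, hs2, hz, graphMap_snd])
  let sq : ValuativeCommSq (toGraph f).fromNormalization :=
    { R := R, K := K, i₁ := x ≫ (toGraph f).toNormalization, i₂ := t
      commSq := ⟨by
        rw [Category.assoc, Scheme.Hom.toNormalization_fromNormalization]
        exact ht'.symm⟩ }
  have huc : ValuativeCriterion.Existence (toGraph f).fromNormalization := by
    have := (inferInstance : UniversallyClosed (toGraph f).fromNormalization)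
    rw [UniversallyClosed.eq_valuativeCriterion] at this
    exact this.1
  obtain ⟨⟨l⟩⟩ := huc sq
  have h1 : l.l ≫ (toGraph f).fromNormalization = t := l.fac_right
  have h2 := Scheme.IdealSheafData.comap_mono l.l hf.modulus
  dsimp only at h2
  rw [← Scheme.IdealSheafData.comap_comp, ← Scheme.IdealSheafData.comap_comp, reassoc_of% h1,
    reassoc_of% h1, graphFst, graphSnd, reassoc_of% ht, reassoc_of% ht, hs1, hs2] at h2
  exact h2

instance isAffineHom_incl (M : ModulusPair k) : IsAffineHom M.incl.left := by
  refine isAffineHom_of_forall_exists_isAffineOpen _ fun x => ?_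
  obtain ⟨U, hx, t, -, ht⟩ := M.cartier x
  refine ⟨U.1, hx, U.2, ?_⟩
  have h : M.incl.left ⁻¹ᵁ U.1 = M.incl.left ⁻¹ᵁ M.ambient.left.basicOpen t := by
    rw [Scheme.preimage_basicOpen, Scheme.basicOpen_of_isUnit _ (isUnit_incl_app M U t ht)]
  rw [h]
  have hle : M.ambient.left.basicOpen t ≤ M.incl.left.opensRange := by
    intro z hz
    have hzU := M.ambient.left.basicOpen_le t hz
    change z ∈ Set.range (complOpens M.divisor).ι
    rw [Scheme.Opens.range_ι]
    change z ∉ M.divisor.support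
    rw [Scheme.IdealSheafData.mem_support_iff_of_mem hzU, ht, Scheme.zeroLocus_span,
      Scheme.mem_zeroLocus_iff]
    exact fun h => h t rfl hz
  exact (U.2.basicOpen t).preimage_of_isOpenImmersion M.incl.left hle

theorem comap_fromSpec_ideal {G : Scheme.{u}} {I : G.IdealSheafData} {U : G.Opens}
    (hU : IsAffineOpen U)
    {a : Γ(G, U)} (hI : I.ideal ⟨U, hU⟩ = Ideal.span {a}) {R : Type u} [CommRing R]
    (l : Γ(G, U) →+* R) :
    (I.comap (Spec.map (CommRingCat.ofHom l) ≫ hU.fromSpec)).ideal ⟨⊤, isAffineOpen_top _⟩ =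
      Ideal.span {(Scheme.ΓSpecIso (.of R)).inv (l a)} := by
  have hle : (⊤ : (Spec (.of R)).Opens) ≤
      (Spec.map (CommRingCat.ofHom l) ≫ hU.fromSpec) ⁻¹ᵁ U := by
    rw [Scheme.Hom.comp_preimage, IsAffineOpen.fromSpec_preimage_self]
    exact le_rfl
  rw [ideal_comap_eq_map _ _ ⟨U, hU⟩ _ hle, hI, Ideal.map_span, Set.image_singleton]
  congr 2
  have : (Spec.map (CommRingCat.ofHom l) ≫ hU.fromSpec).appLE U ⊤ hle =
      CommRingCat.ofHom l ≫ (Scheme.ΓSpecIso (.of R)).inv := by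
    have hle' : (⊤ : (Spec (.of R)).Opens) ≤
        Spec.map (CommRingCat.ofHom l) ⁻¹ᵁ (hU.fromSpec ⁻¹ᵁ U) := hle
    have e1 : (Spec.map (CommRingCat.ofHom l) ≫ hU.fromSpec).appLE U ⊤ hle =
        hU.fromSpec.app U ≫ (Spec.map (CommRingCat.ofHom l)).appLE (hU.fromSpec ⁻¹ᵁ U) ⊤ hle' :=
      Scheme.Hom.comp_appLE _ _ _ _ _
    rw [e1, IsAffineOpen.fromSpec_app_self, Category.assoc, Scheme.Hom.map_appLE]
    exact (congrArg (_ ≫ ·) (Scheme.Hom.appLE_eq_app _)).trans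
      (Scheme.ΓSpecIso_inv_naturality _).symm
  exact congr($this a)

/-- For ideals that are principal on an affine open subset `U`, containment after pull-back along a
morphism `Spec R ⟶ U` is divisibility of the generators in `R`. -/
theorem comap_fromSpec_le_iff {G : Scheme.{u}} {I J : G.IdealSheafData} {U : G.Opens}
    (hU : IsAffineOpen U)
    {a b : Γ(G, U)} (hI : I.ideal ⟨U, hU⟩ = Ideal.span {a}) (hJ : J.ideal ⟨U, hU⟩ = Ideal.span {b})
    {R : Type u} [CommRing R] (l : Γ(G, U) →+* R) :
    I.comap (Spec.map (CommRingCat.ofHom l) ≫ hU.fromSpec) ≤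
      J.comap (Spec.map (CommRingCat.ofHom l) ≫ hU.fromSpec) ↔ l b ∣ l a := by
  let e := (Scheme.ΓSpecIso (.of R)).symm.commRingCatIsoToRingEquiv
  have : I.comap (Spec.map (CommRingCat.ofHom l) ≫ hU.fromSpec) ≤
      J.comap (Spec.map (CommRingCat.ofHom l) ≫ hU.fromSpec) ↔ e (l b) ∣ e (l a) := by
    rw [← Ideal.span_singleton_le_span_singleton]
    change _ ↔ Ideal.span {(Scheme.ΓSpecIso (.of R)).inv (l a)} ≤
      Ideal.span {(Scheme.ΓSpecIso (.of R)).inv (l b)}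
    rw [← comap_fromSpec_ideal hU hI l, ← comap_fromSpec_ideal hU hJ l]
    exact ⟨fun h => h _, Scheme.IdealSheafData.le_of_isAffine⟩
  rw [this, map_dvd_iff]

/-- A section `b` which becomes invertible on `X` divides `a` on the normalization of `G` in `X` as
soon as `a / b` is integral over `G`. -/
theorem dvd_fromNormalization_app {X G : Scheme.{u}} (j : X ⟶ G) [QuasiCompact j]
    [QuasiSeparated j] (U : G.affineOpens) (a b : Γ(G, U.1)) (hb : IsUnit (j.app U.1 b))
    (he : (j.app U.1).hom.IsIntegralElem (j.app U.1 a * ↑(hb.unit⁻¹))) :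
    j.fromNormalization.app U.1 b ∣ j.fromNormalization.app U.1 a := by
  let := (j.app U.1).hom.toAlgebra
  let z : Γ(j.normalization, j.fromNormalization ⁻¹ᵁ U.1) :=
    (j.normalizationObjIso U.2).inv ⟨_, he⟩
  have hnle : j ⁻¹ᵁ U.1 ≤ j.toNormalization ⁻¹ᵁ j.fromNormalization ⁻¹ᵁ U.1 := by
    simp [← Scheme.Hom.comp_preimage]
  have hval : ∀ t, j.toNormalization.appLE _ _ hnle t = ((j.normalizationObjIso U.2).hom t).1 := by
    intro t
    rw [← j.normalizationObjIso_hom_val U.2]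
    rfl
  have hninj : Function.Injective (j.toNormalization.appLE _ _ hnle) := by
    intro s t hst
    rw [hval, hval] at hst
    have := Subtype.ext hst
    have := congrArg (j.normalizationObjIso U.2).inv this
    simpa using this
  have hncomp : ∀ t, j.toNormalization.appLE _ _ hnle (j.fromNormalization.app U.1 t) =
      j.app U.1 t := by
    intro t
    rw [← CommRingCat.comp_apply, Scheme.Hom.app_eq_appLE, Scheme.Hom.appLE_comp_appLE]
    simp only [Scheme.Hom.toNormalization_fromNormalization, Scheme.Hom.app_eq_appLE]
  refine ⟨z, hninj ?_⟩
  rw [map_mul, hncomp, hncomp, hval]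
  have hz : ((j.normalizationObjIso U.2).hom z).1 = j.app U.1 a * ↑(hb.unit⁻¹) := by simp [z]
  rw [hz, mul_left_comm]
  simp

/-- The ratio of the local generators of the two divisors on the closure of the graph is integral, by
the valuative criterion. -/
theorem isIntegral_of_valuativeLE {M N : ModulusPair k} {f : M.interior ⟶ N.interior}
    (hf : ValuativeLE f) [IsAffineHom (toGraph f)] (U : (graph f).affineOpens)
    (a b : Γ(graph f, U.1))
    (hI : (M.divisor.comap (graphFst f)).ideal U = Ideal.span {a})
    (hJ : (N.divisor.comap (graphSnd f)).ideal U = Ideal.span {b})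
    (hb : IsUnit ((toGraph f).app U.1 b)) :
    ((toGraph f).app U.1).hom.IsIntegralElem ((toGraph f).app U.1 a * ↑(hb.unit⁻¹)) := by
  let j := toGraph f
  have hj1 : j ≫ graphFst f = M.incl.left := by
    rw [graphFst, Scheme.Hom.toImage_imageι_assoc, graphMap_fst]
  have hj2 : j ≫ graphSnd f = f.left ≫ N.incl.left := by
    rw [graphSnd, Scheme.Hom.toImage_imageι_assoc, graphMap_snd]
  let := (j.app U.1).hom.toAlgebra
  refine isIntegral_of_valuationRing (A := Γ(graph f, U.1))
    (C := Γ(M.interior.left, j ⁻¹ᵁ U.1)) _ fun R K _ _ _ _ _ _ g l hgl => ?_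
  have hW : IsAffineOpen (j ⁻¹ᵁ U.1) := U.2.preimage j
  let x : Spec (.of K) ⟶ M.interior.left := Spec.map (CommRingCat.ofHom g) ≫ hW.fromSpec
  let s : Spec (.of R) ⟶ graph f := Spec.map (CommRingCat.ofHom l) ≫ U.2.fromSpec
  have hs : genericPt R K ≫ s = x ≫ j := by
    have h1 := IsAffineOpen.SpecMap_appLE_fromSpec j U.2 hW le_rfl
    simp only [x, s, Category.assoc]
    rw [← h1, ← Category.assoc, ← Category.assoc, ← Spec.map_comp, ← Spec.map_comp]
    congr 2
    rw [← CommRingCat.ofHom_comp, hgl, Scheme.Hom.appLE_eq_app]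
    rfl
  have h := hf R K x (s ≫ graphFst f) (s ≫ graphSnd f)
    (by rw [reassoc_of% hs, hj1]) (by rw [reassoc_of% hs, hj2])
  rw [Scheme.IdealSheafData.comap_comp _ s, Scheme.IdealSheafData.comap_comp _ s] at h
  obtain ⟨c, hc⟩ := (comap_fromSpec_le_iff U.2 hI hJ l).mp h
  refine ⟨c, ?_⟩
  have hg : ∀ t, g (j.app U.1 t) = algebraMap R K (l t) := fun t => (congr($hgl t)).symm
  have hgb : g (j.app U.1 b) ≠ 0 := ((hb.map g)).ne_zero
  apply mul_left_cancel₀ hgb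
  rw [map_mul, mul_left_comm, ← map_mul g _ (↑(hb.unit⁻¹))]
  have : j.app U.1 b * ↑(hb.unit⁻¹) = 1 := by
    simp [j]
  rw [this, map_one, mul_one]
  exact (congrArg (· * _) (hg b)).trans ((map_mul _ _ _).symm.trans
    ((congrArg _ hc.symm).trans (hg a).symm))

/-- The valuative form of the modulus condition implies the one on the normalization of the closure of
the graph. -/
theorem isAdmissible_of_valuativeLE {M N : ModulusPair k} {f : M.interior ⟶ N.interior}
    (hp : IsProper (graphFst f)) (hf : ValuativeLE f) : IsAdmissible f := by
  refine ⟨hp, ?_⟩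
  let j := toGraph f
  have hj1 : j ≫ graphFst f = M.incl.left := by
    rw [graphFst, Scheme.Hom.toImage_imageι_assoc, graphMap_fst]
  have hj2 : j ≫ graphSnd f = f.left ≫ N.incl.left := by
    rw [graphSnd, Scheme.Hom.toImage_imageι_assoc, graphMap_snd]
  have hjaff : IsAffineHom j := by
    have : IsAffineHom (j ≫ graphFst f) := by rw [hj1]; infer_instance
    exact .of_comp j (graphFst f)
  have key : (M.divisor.comap (graphFst f)).comap j.fromNormalization ≤
      (N.divisor.comap (graphSnd f)).comap j.fromNormalization := by
    choose U hxU a b hI hJ hb using exists_local_generators f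
    refine Scheme.IdealSheafData.le_of_iSup_eq_top
      (fun x => ⟨j.fromNormalization ⁻¹ᵁ (U x).1, (U x).2.preimage _⟩) ?_ ?_
    · rw [eq_top_iff]
      intro z _
      exact TopologicalSpace.Opens.mem_iSup.mpr ⟨j.fromNormalization z, hxU _⟩
    intro x
    dsimp only
    rw [ideal_comap_eq_map _ _ (U x) _ le_rfl, ideal_comap_eq_map _ _ (U x) _ le_rfl, hI, hJ,
      Ideal.map_span, Ideal.map_span, Set.image_singleton, Set.image_singleton,
      Ideal.span_singleton_le_span_singleton, ← Scheme.Hom.app_eq_appLE]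
    refine dvd_fromNormalization_app j (U x) (a x) (b x) (hb x)
      (isIntegral_of_valuativeLE hf (U x) (a x) (b x) (hI x) (hJ x) (hb x))
  rw [← Scheme.IdealSheafData.comap_comp, ← Scheme.IdealSheafData.comap_comp] at key
  exact key

end ModulusPair
end MPair

/-! ### Construction of morphisms of modulus pairs -/

namespace MPair
namespace ModulusPair
variable {k : Type u} [Field k]

theorem isProper_graphFst_of_isProper {M N : ModulusPair k} (f : M.interior ⟶ N.interior)
    (hN : IsProper N.ambient.hom) : IsProper (graphFst f) :=
  inferInstance

/-- The closure of the graph of a morphism that extends to the ambient spaces is contained in the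
graph of the extension. -/
theorem isProper_graphFst_of_extends {M N : ModulusPair k} {f : M.interior ⟶ N.interior}
    (F : M.ambient ⟶ N.ambient) (hF : M.incl ≫ F = f ≫ N.incl) : IsProper (graphFst f) := by
  obtain ⟨γ, hγ1, hγ2⟩ : ∃ γ : M.ambient.left ⟶ pullback M.ambient.hom N.ambient.hom,
      γ ≫ pullback.fst _ _ = 𝟙 _ ∧ γ ≫ pullback.snd _ _ = F.left :=
    ⟨pullback.lift (𝟙 _) F.left (by simp), pullback.lift_fst _ _ _, pullback.lift_snd _ _ _⟩
  have hcl : IsClosedImmersion γ := by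
    have : IsClosedImmersion (γ ≫ pullback.fst _ _) := by rw [hγ1]; infer_instance
    exact .of_comp γ (pullback.fst _ _)
  have hγ : graphMap f = M.incl.left ≫ γ := by
    apply pullback.hom_ext
    · rw [graphMap_fst, Category.assoc, hγ1, Category.comp_id]
    · rw [graphMap_snd, Category.assoc, hγ2, ← Over.comp_left, ← Over.comp_left, hF]
  have hker : γ.ker ≤ (graphMap f).imageι.ker := by
    rw [Scheme.IdealSheafData.ker_subschemeι, hγ]
    exact Scheme.Hom.le_ker_comp _ _
  let r := IsClosedImmersion.lift γ (graphMap f).imageι hker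
  have hr : r ≫ γ = (graphMap f).imageι := IsClosedImmersion.lift_fac _ _ _
  have h1 : graphFst f = r := by
    rw [graphFst, ← hr, Category.assoc, hγ1, Category.comp_id]
  have : IsClosedImmersion (r ≫ γ) := by rw [hr]; infer_instance
  have : IsClosedImmersion r := .of_comp_isClosedImmersion r γ
  rw [h1]; infer_instance

theorem extension_unique {R K : Type u} [CommRing R] [IsDomain R] [Field K] [Algebra R K]
    [IsFractionRing R K] {N : ModulusPair k} {z z' : Spec (.of R) ⟶ N.ambient.left}
    (h : genericPt R K ≫ z = genericPt R K ≫ z') : z = z' := by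
  refine ext_of_isDominant_of_isSeparated N.ambient.hom ?_ (genericPt R K) h
  apply comp_hom_eq_of_genericPt R K
  rw [reassoc_of% h]

section
variable (R K : Type u) [CommRing R] [IsDomain R] [ValuationRing R] [Field K] [Algebra R K]
    [IsFractionRing R K]

/-- A `K`-point of the interior extends to an `R`-point of a proper ambient space. -/
theorem exists_extension {N : ModulusPair k} (hN : IsProper N.ambient.hom)
    (x : Spec (.of K) ⟶ N.interior.left) (b : Spec (.of R) ⟶ Spec (.of k))
    (h : genericPt R K ≫ b = x ≫ N.interior.hom) :
    ∃ z : Spec (.of R) ⟶ N.ambient.left, genericPt R K ≫ z = x ≫ N.incl.left := by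
  have hex : ValuativeCriterion.Existence N.ambient.hom := by
    have := (inferInstance : UniversallyClosed N.ambient.hom)
    rw [UniversallyClosed.eq_valuativeCriterion] at this
    exact this.1
  let sq : ValuativeCommSq N.ambient.hom :=
    { R := R, K := K, i₁ := x ≫ N.incl.left, i₂ := b
      commSq := ⟨by rw [Category.assoc, Over.w]; exact h.symm⟩ }
  obtain ⟨⟨l⟩⟩ := hex sq
  exact ⟨l.l, l.fac_left⟩

variable {R K}

/-- An `R`-point of the ambient space of `M` whose generic point lies in the interior, composed
with an admissible morphism to a proper modulus pair. -/
theorem exists_map {M N : ModulusPair k} (hN : IsProper N.ambient.hom)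
    (f : M.interior ⟶ N.interior) {x : Spec (.of K) ⟶ M.interior.left}
    {y : Spec (.of R) ⟶ M.ambient.left} (h : genericPt R K ≫ y = x ≫ M.incl.left) :
    ∃ z : Spec (.of R) ⟶ N.ambient.left,
      genericPt R K ≫ z = x ≫ f.left ≫ N.incl.left := by
  obtain ⟨z, hz⟩ := exists_extension R K hN (x ≫ f.left) (y ≫ M.ambient.hom) (by
    rw [reassoc_of% h, Over.w, Category.assoc, Over.w])
  exact ⟨z, hz.trans (Category.assoc _ _ _)⟩

end

@[ext]
theorem hom_ext {M N : ModulusPair k} {f g : M ⟶ N} (h : Hom.interior f = Hom.interior g) :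
    f = g := by
  obtain ⟨f, hf⟩ : Hom M N := f
  obtain ⟨g, hg⟩ : Hom M N := g
  obtain rfl : f = g := h
  rfl

@[simp]
theorem interior_comp {M N L : ModulusPair k} (f : M ⟶ N) (g : N ⟶ L) :
    Hom.interior (f ≫ g) = Hom.interior f ≫ Hom.interior g := rfl

@[simp]
theorem interior_id (M : ModulusPair k) : Hom.interior (𝟙 M) = 𝟙 M.interior := rfl

theorem valuativeLE_of_hom {M N : ModulusPair k} (f : M ⟶ N) : ValuativeLE (Hom.interior f) :=
  IsAdmissible.valuativeLE (Hom.admissible f)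

/-- The morphism to a proper modulus pair given by a morphism of interiors which satisfies the
valuative form of the modulus condition. -/
noncomputable def homOfProper {M N : ModulusPair k} (hN : IsProper N.ambient.hom)
    (f : M.interior ⟶ N.interior) (hf : ValuativeLE f) : M ⟶ N :=
  Hom.mk f (isAdmissible_of_valuativeLE (isProper_graphFst_of_isProper f hN) hf)

@[simp]
theorem interior_homOfProper {M N : ModulusPair k} (hN : IsProper N.ambient.hom)
    (f : M.interior ⟶ N.interior) (hf : ValuativeLE f) :
    Hom.interior (homOfProper hN f hf) = f := rfl

/-- An ambient morphism which satisfies the valuative form of the modulus condition. -/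
noncomputable def homOfExtends {M N : ModulusPair k} (F : M.ambient ⟶ N.ambient)
    (f : M.interior ⟶ N.interior) (hF : M.incl ≫ F = f ≫ N.incl) (hf : ValuativeLE f) : M ⟶ N :=
  Hom.mk f (isAdmissible_of_valuativeLE (isProper_graphFst_of_extends F hF) hf)

theorem isIso_of_interior {M N : ModulusPair k} (hM : IsProper M.ambient.hom) (f : M ⟶ N)
    [IsIso (Hom.interior f)] (h : ValuativeLE (inv (Hom.interior f))) : IsIso f :=
  ⟨homOfProper hM _ h, by ext1; simp, by ext1; simp⟩

instance {M N : ModulusPair k} (f : M ⟶ N) [IsIso f] : IsIso (Hom.interior f) :=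
  inferInstanceAs (IsIso ((interiorFunctor k).map f))

end ModulusPair
end MPair

/-! ### Rings generated by ratios -/

namespace MPair

/-- The subring generated by `T` is the localization of the subring `R` away from `w`, if `w` becomes
invertible in it and each element of the kernel of `ρ`, respectively of `T`, is annihilated by a
power of `w`, respectively has one as a denominator. -/
theorem isLocalization_away_subring {C C' : Type*} [CommRing C] [CommRing C'] (ρ : C →+* C')
    {R : Subring C} {T : Set C'} (hR : ∀ x ∈ R, ρ x ∈ Subring.closure T) (w : R)
    (hunit : ∃ v ∈ Subring.closure T, ρ w * v = 1)
    (hker : ∀ x ∈ R, ρ x = 0 → ∃ n : ℕ, (w : C) ^ n * x = 0)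
    (hT : ∀ t ∈ T, ∃ n : ℕ, ∃ x ∈ R, ρ x = ρ w ^ n * t) :
    letI := (ρ.restrict R (Subring.closure T) hR).toAlgebra
    IsLocalization.Away w (Subring.closure T) := by
  let := (ρ.restrict R (Subring.closure T) hR).toAlgebra
  have halg : ∀ x : R, ((algebraMap R (Subring.closure T) x : Subring.closure T) : C') = ρ x :=
    fun _ => rfl
  have hsurj : ∀ t ∈ Subring.closure T, ∃ n : ℕ, ∃ x ∈ R, ρ x = ρ w ^ n * t := by
    intro t ht
    induction ht using Subring.closure_induction with
    | mem t ht => exact hT t ht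
    | zero => exact ⟨0, 0, R.zero_mem, by simp⟩
    | one => exact ⟨0, 1, R.one_mem, by simp⟩
    | add a b _ _ ha hb =>
      obtain ⟨n, x, hx, hx'⟩ := ha
      obtain ⟨m, y, hy, hy'⟩ := hb
      refine ⟨n + m, w ^ m * x + w ^ n * y, R.add_mem (R.mul_mem (R.pow_mem w.2 _) hx)
        (R.mul_mem (R.pow_mem w.2 _) hy), ?_⟩
      simp only [map_add, map_mul, map_pow, hx', hy']
      ring
    | neg a _ ha =>
      obtain ⟨n, x, hx, hx'⟩ := ha
      exact ⟨n, -x, R.neg_mem hx, by rw [map_neg, hx', mul_neg]⟩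
    | mul a b _ _ ha hb =>
      obtain ⟨n, x, hx, hx'⟩ := ha
      obtain ⟨m, y, hy, hy'⟩ := hb
      refine ⟨n + m, x * y, R.mul_mem hx hy, ?_⟩
      simp only [map_mul, hx', hy']
      ring
  obtain ⟨v, hv, hwv⟩ := hunit
  refine IsLocalization.Away.mk _ (IsUnit.of_mul_eq_one ⟨v, hv⟩ (Subtype.ext hwv)) ?_ ?_
  · rintro ⟨t, ht⟩
    obtain ⟨n, x, hx, hx'⟩ := hsurj t ht
    exact ⟨n, ⟨x, hx⟩, Subtype.ext ((mul_comm _ _).trans hx'.symm)⟩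
  · intro a b hab
    have hab' : ρ a = ρ b := congrArg Subtype.val hab
    obtain ⟨n, hn⟩ := hker (a - b) (R.sub_mem a.2 b.2) (by rw [map_sub, hab', sub_self])
    refine ⟨n, Subtype.ext ?_⟩
    rw [mul_sub, sub_eq_zero] at hn
    exact hn

section RatioSubring

variable {ι A A' C C' : Type*} [CommRing A] [CommRing A'] [CommRing C] [CommRing C']

/-- The subring of `C` generated by the image of `A` and the ratios `a l / a i` with `i ∈ s`. -/
def ratioSubring (φ : A →+* C) (a : ι → A) (s : Finset ι) : Subring C :=
  Subring.closure (Set.range φ ∪ {t | ∃ i ∈ s, ∃ l, t * φ (a i) = φ (a l)})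

theorem map_mem_ratioSubring (φ : A →+* C) (a : ι → A) (s : Finset ι) (x : A) :
    φ x ∈ ratioSubring φ a s :=
  Subring.subset_closure (.inl ⟨x, rfl⟩)

theorem mem_ratioSubring {φ : A →+* C} {a : ι → A} {s : Finset ι} {i l : ι} (hi : i ∈ s) {t : C}
    (h : t * φ (a i) = φ (a l)) : t ∈ ratioSubring φ a s :=
  Subring.subset_closure (.inr ⟨i, hi, l, h⟩)

/-- The ratio `a l / a i`. -/
noncomputable def ratio (φ : A →+* C) (a : ι → A) (l i : ι) : C :=
  φ (a l) * Ring.inverse (φ (a i))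

theorem ratio_mul {φ : A →+* C} {a : ι → A} (ha : ∀ i, IsUnit (φ (a i))) (l i : ι) :
    ratio φ a l i * φ (a i) = φ (a l) := by
  rw [ratio, mul_assoc, Ring.inverse_mul_cancel _ (ha i), mul_one]

theorem eq_ratio {φ : A →+* C} {a : ι → A} (ha : ∀ i, IsUnit (φ (a i))) {l i : ι} {t : C}
    (h : t * φ (a i) = φ (a l)) : t = ratio φ a l i :=
  (ha i).mul_right_cancel (h.trans (ratio_mul ha l i).symm)

theorem ratio_mul_ratio {φ : A →+* C} {a : ι → A} (ha : ∀ i, IsUnit (φ (a i))) (l i m : ι) :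
    ratio φ a l i * ratio φ a i m = ratio φ a l m :=
  eq_ratio ha (by rw [mul_assoc, ratio_mul ha, ratio_mul ha])

theorem ratio_self {φ : A →+* C} {a : ι → A} (ha : ∀ i, IsUnit (φ (a i))) (i : ι) :
    ratio φ a i i = 1 :=
  (eq_ratio ha (one_mul _)).symm

theorem ratio_mem_ratioSubring {φ : A →+* C} {a : ι → A} (ha : ∀ i, IsUnit (φ (a i)))
    {s : Finset ι} {i : ι} (hi : i ∈ s) (l : ι) : ratio φ a l i ∈ ratioSubring φ a s :=
  mem_ratioSubring hi (ratio_mul ha l i)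

theorem ratioSubring_le {φ : A →+* C} {a : ι → A} (ha : ∀ i, IsUnit (φ (a i)))
    {s : Finset ι} {R : Subring C} (h : ∀ x, φ x ∈ R) (h' : ∀ i ∈ s, ∀ l, ratio φ a l i ∈ R) :
    ratioSubring φ a s ≤ R := by
  rw [ratioSubring, Subring.closure_le]
  rintro _ (⟨x, rfl⟩ | ⟨i, hi, l, ht⟩)
  · exact h x
  · rw [eq_ratio ha ht]; exact h' i hi l

theorem ratioSubring_le_of_span_eq {φ : A →+* C} {a a' : ι → A} (ha : ∀ i, IsUnit (φ (a i)))
    (ha' : ∀ i, IsUnit (φ (a' i))) (h : ∀ i, Ideal.span {a i} = Ideal.span {a' i})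
    (s : Finset ι) : ratioSubring φ a s ≤ ratioSubring φ a' s := by
  refine ratioSubring_le ha (map_mem_ratioSubring _ _ _) fun i hi l => ?_
  obtain ⟨x, hx⟩ := Ideal.mem_span_singleton.mp ((h l).le (Ideal.mem_span_singleton_self (a l)))
  obtain ⟨u, hu⟩ := Ideal.mem_span_singleton.mp ((h i).ge (Ideal.mem_span_singleton_self (a' i)))
  have : ratio φ a l i = φ x * ratio φ a' l i * φ u := by
    refine (eq_ratio ha ?_).symm
    calc φ x * ratio φ a' l i * φ u * φ (a i) = φ x * (ratio φ a' l i * φ (a' i)) := by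
          rw [hu, map_mul]; ring
      _ = φ (a l) := by rw [ratio_mul ha', hx, map_mul, mul_comm]
  rw [this]
  exact Subring.mul_mem _ (Subring.mul_mem _ (map_mem_ratioSubring _ _ _ _)
    (ratio_mem_ratioSubring ha' hi l)) (map_mem_ratioSubring _ _ _ _)

theorem ratioSubring_congr {φ : A →+* C} {a a' : ι → A} (ha : ∀ i, IsUnit (φ (a i)))
    (ha' : ∀ i, IsUnit (φ (a' i))) (h : ∀ i, Ideal.span {a i} = Ideal.span {a' i})
    (s : Finset ι) : ratioSubring φ a s = ratioSubring φ a' s :=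
  le_antisymm (ratioSubring_le_of_span_eq ha ha' h s)
    (ratioSubring_le_of_span_eq ha' ha (fun i => (h i).symm) s)

theorem map_ratio {φ : A →+* C} {φ' : A' →+* C'} {ρ : C →+* C'} {ρ' : A →+* A'}
    (hρ : ρ.comp φ = φ'.comp ρ') {a : ι → A} (ha : ∀ i, IsUnit (φ (a i))) (l i : ι) :
    ρ (ratio φ a l i) = ratio φ' (fun i => ρ' (a i)) l i := by
  have h : ∀ x, ρ (φ x) = φ' (ρ' x) := fun x => congr($hρ x)
  refine eq_ratio (fun i => h _ ▸ (ha i).map ρ) ?_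
  rw [← h, ← h, ← map_mul, ratio_mul ha]

theorem map_mem_ratioSubring_of_comm {φ : A →+* C} {φ' : A' →+* C'} {ρ : C →+* C'} {ρ' : A →+* A'}
    (hρ : ρ.comp φ = φ'.comp ρ') {a : ι → A} (ha : ∀ i, IsUnit (φ (a i))) {s s' : Finset ι}
    (hs : s ⊆ s') : ∀ x ∈ ratioSubring φ a s, ρ x ∈ ratioSubring φ' (fun i => ρ' (a i)) s' := by
  have h : ∀ x, ρ (φ x) = φ' (ρ' x) := fun x => congr($hρ x)
  have : ratioSubring φ a s ≤ (ratioSubring φ' (fun i => ρ' (a i)) s').comap ρ := by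
    refine ratioSubring_le ha (fun x => ?_) fun i hi l => ?_
    · rw [Subring.mem_comap, h]
      exact map_mem_ratioSubring _ _ _ _
    · rw [Subring.mem_comap, map_ratio hρ ha]
      exact ratio_mem_ratioSubring (fun i => h _ ▸ (ha i).map ρ) (hs hi) l
  exact this

/-- The element of `ratioSubring φ a s` which is inverted in the passage to the chart given by the
basic open subset `D(r)` and the index set `s'`, where `i₀ ∈ s`. -/
noncomputable def ratioDenom (φ : A →+* C) (a : ι → A) (i₀ : ι) (r : A) (s' : Finset ι) : C :=
  φ r * ∏ i ∈ s', ratio φ a i i₀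

theorem ratioDenom_mem {φ : A →+* C} {a : ι → A} (ha : ∀ i, IsUnit (φ (a i))) {s : Finset ι}
    {i₀ : ι} (hi₀ : i₀ ∈ s) (r : A) (s' : Finset ι) :
    ratioDenom φ a i₀ r s' ∈ ratioSubring φ a s :=
  Subring.mul_mem _ (map_mem_ratioSubring _ _ _ _)
    (Subring.prod_mem _ fun i _ => ratio_mem_ratioSubring ha hi₀ i)

/-- Shrinking the affine open subset to `D(r)` and enlarging the index set from `s` to `s'` is a
localization: it amounts to inverting `r` and the ratios `a i / a i₀` with `i ∈ s'`. -/
theorem isLocalization_ratioSubring {φ : A →+* C} {φ' : A' →+* C'} {ρ : C →+* C'} {ρ' : A →+* A'}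
    (hρ : ρ.comp φ = φ'.comp ρ') {a : ι → A} (ha : ∀ i, IsUnit (φ (a i))) {s s' : Finset ι}
    (hs : s ⊆ s') {i₀ : ι} (hi₀ : i₀ ∈ s) {r : A} (hr : IsUnit (ρ' r))
    (hsurj : ∀ y, ∃ (n : ℕ) (x : A), ρ' x = ρ' r ^ n * y)
    (hker : ∀ x, ρ x = 0 → ∃ n : ℕ, φ r ^ n * x = 0) :
    letI := (ρ.restrict (ratioSubring φ a s) (ratioSubring φ' (fun i => ρ' (a i)) s')
      (map_mem_ratioSubring_of_comm hρ ha hs)).toAlgebra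
    IsLocalization.Away (⟨ratioDenom φ a i₀ r s', ratioDenom_mem ha hi₀ r s'⟩ :
      ratioSubring φ a s) (ratioSubring φ' (fun i => ρ' (a i)) s') := by
  have h : ∀ x, ρ (φ x) = φ' (ρ' x) := fun x => congr($hρ x)
  have ha' : ∀ i, IsUnit (φ' (ρ' (a i))) := fun i => h _ ▸ (ha i).map ρ
  refine isLocalization_away_subring ρ _ _ ?_ ?_ ?_
  · obtain ⟨r', hr'⟩ := hr.exists_right_inv
    refine ⟨φ' r' * ∏ i ∈ s', ratio φ' (fun i => ρ' (a i)) i₀ i,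
      Subring.mul_mem _ (map_mem_ratioSubring _ _ _ _)
        (Subring.prod_mem _ fun i hi => ratio_mem_ratioSubring ha' hi i₀), ?_⟩
    dsimp only
    rw [ratioDenom, map_mul, map_prod, h, mul_mul_mul_comm, ← map_mul, hr', map_one, one_mul,
      ← Finset.prod_mul_distrib]
    refine Finset.prod_eq_one fun i _ => ?_
    rw [map_ratio hρ ha, ratio_mul_ratio ha', ratio_self ha']
  · intro x _ hx
    obtain ⟨n, hn⟩ := hker x hx
    refine ⟨n, ?_⟩
    dsimp only
    rw [ratioDenom, mul_pow, mul_right_comm, hn, zero_mul]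
  · rintro _ (⟨y, rfl⟩ | ⟨i, hi, l, ht⟩)
    · obtain ⟨n, x, hx⟩ := hsurj y
      refine ⟨n, φ x * (∏ i ∈ s', ratio φ a i i₀) ^ n, Subring.mul_mem _
        (map_mem_ratioSubring _ _ _ _) (Subring.pow_mem _
          (Subring.prod_mem _ fun i _ => ratio_mem_ratioSubring ha hi₀ i) _), ?_⟩
      dsimp only
      rw [ratioDenom, map_mul, map_mul, h, h, hx, map_mul, map_pow, mul_pow, map_pow]
      ring
    · classical
      refine ⟨1, φ r * (∏ m ∈ s'.erase i, ratio φ a m i₀) * ratio φ a l i₀,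
        Subring.mul_mem _ (Subring.mul_mem _ (map_mem_ratioSubring _ _ _ _) (Subring.prod_mem _
          fun i _ => ratio_mem_ratioSubring ha hi₀ i)) (ratio_mem_ratioSubring ha hi₀ l), ?_⟩
      rw [eq_ratio ha' ht, ← map_ratio hρ ha, pow_one, ← map_mul]
      refine congrArg ρ ?_
      dsimp only
      rw [ratioDenom, ← Finset.mul_prod_erase _ _ hi, ← ratio_mul_ratio ha l i i₀]
      ring

end RatioSubring
end MPair

/-! ### The blow-up in two locally principal ideals -/

namespace MPair

theorem isLocalization_of_eq_ratioSubring {ι A A' C C' : Type*} [CommRing A] [CommRing A']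
    [CommRing C] [CommRing C'] {φ : A →+* C} {φ' : A' →+* C'} {ρ : C →+* C'} {ρ' : A →+* A'}
    (hρ : ρ.comp φ = φ'.comp ρ') {a : ι → A} (ha : ∀ i, IsUnit (φ (a i))) {s s' : Finset ι}
    (hs : s ⊆ s') {i₀ : ι} (hi₀ : i₀ ∈ s) {r : A} (hr : IsUnit (ρ' r))
    (hsurj : ∀ y, ∃ (n : ℕ) (x : A), ρ' x = ρ' r ^ n * y)
    (hker : ∀ x, ρ x = 0 → ∃ n : ℕ, φ r ^ n * x = 0) {R' : Subring C'}
    (hR' : R' = ratioSubring φ' (fun i => ρ' (a i)) s')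
    (hm : ∀ x ∈ ratioSubring φ a s, ρ x ∈ R') :
    letI := (ρ.restrict (ratioSubring φ a s) R' hm).toAlgebra
    IsLocalization.Away (⟨ratioDenom φ a i₀ r s', ratioDenom_mem ha hi₀ r s'⟩ :
      ratioSubring φ a s) R' := by
  subst hR'
  exact isLocalization_ratioSubring hρ ha hs hi₀ hr hsurj hker

theorem finiteType_ratioSubring {ι A C : Type*} [CommRing A] [CommRing C] [Finite ι] {φ : A →+* C}
    {a : ι → A} (ha : ∀ i, IsUnit (φ (a i))) (s : Finset ι) :
    (φ.codRestrict (ratioSubring φ a s) (map_mem_ratioSubring φ a s)).FiniteType := by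
  let := φ.toAlgebra
  let T : Set C := (fun p : ι × ι => ratio φ a p.1 p.2) '' {p | p.2 ∈ s}
  have hT : T.Finite := Set.toFinite _
  have h : (Algebra.adjoin A T).toSubring = ratioSubring φ a s := by
    apply le_antisymm
    · rw [Algebra.adjoin_eq_ring_closure, Subring.closure_le]
      rintro _ (⟨x, rfl⟩ | ⟨p, hp, rfl⟩)
      · exact map_mem_ratioSubring _ _ _ _
      · exact ratio_mem_ratioSubring ha hp _
    · exact ratioSubring_le ha (fun x => (Algebra.adjoin A T).algebraMap_mem x)
        fun i hi l => Algebra.subset_adjoin ⟨(l, i), hi, rfl⟩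
  have hft : Algebra.FiniteType A (Algebra.adjoin A T) :=
    (Subalgebra.fg_iff_finiteType _).mp ⟨hT.toFinset, by rw [Set.Finite.coe_toFinset]⟩
  have key : ∀ (R : Subring C) (hR : ∀ x, φ x ∈ R), (Algebra.adjoin A T).toSubring = R →
      (φ.codRestrict R hR).FiniteType := by
    rintro _ hR rfl
    exact RingHom.finiteType_algebraMap.mpr hft
  exact key _ _ h

namespace BlowUp

variable {U X : Scheme.{u}} {j : U ⟶ X} {D : Bool → X.IdealSheafData}

/-- A local generator of an ideal whose support does not meet `U` is invertible on `U`. -/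
theorem isUnit_app {I : X.IdealSheafData} (hI : ∀ x, j x ∉ I.support) {V : X.Opens}
    (hV : IsAffineOpen V) {a : Γ(X, V)} (ha : I.ideal ⟨V, hV⟩ = Ideal.span {a}) :
    IsUnit (j.app V a) := by
  have h1 : j ⁻¹ᵁ V ≤ U.basicOpen (j.app V a) := by
    rw [← Scheme.preimage_basicOpen]
    intro x hx
    by_contra hxb
    apply hI x
    rw [Scheme.IdealSheafData.mem_support_iff_of_mem (U := ⟨V, hV⟩) hx, ha, Scheme.zeroLocus_span,
      Scheme.mem_zeroLocus_iff]
    rintro _ rfl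
    exact hxb
  exact U.toRingedSpace.isUnit_of_isUnit_germ _ _ fun x hx =>
    (Scheme.mem_basicOpen _ _ x hx).mp (h1 hx)

variable (j D) in
/-- The charts of the blow-up of `X` in the ideal generated by `D i`, `i : Bool`: an affine open
subset `V`, on which both ideals are principal, with generators which are invertible on `U`,
together with a non-empty set `s` of indices such that the pull-backs of `D i`, `i ∈ s`, coincide
on the chart and contain the other one. -/
structure Chart where
  /-- the open subset of `X` above which the chart lies -/
  V : X.Opens
  isAffineOpen : IsAffineOpen V
  principal : ∀ i, ∃ a, (D i).ideal ⟨V, isAffineOpen⟩ = Ideal.span {a} ∧ IsUnit (j.app V a)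
  /-- the set of those `i` for which `D i` generates the exceptional ideal on the chart -/
  s : Finset Bool
  nonempty : s.Nonempty

namespace Chart

/-- A chart is contained in another one if the affine open subset is a basic open subset of the
other one, and the set of indices is larger. -/
instance : Preorder (Chart j D) where
  le c c' := (∃ r : Γ(X, c'.V), X.basicOpen r = c.V) ∧ c'.s ⊆ c.s
  le_refl c := ⟨⟨1, Scheme.basicOpen_of_isUnit _ isUnit_one⟩, subset_rfl⟩
  le_trans := by
    rintro ⟨_, _, _, _⟩ ⟨_, _, _, _⟩ ⟨_, h, _, _⟩ ⟨⟨f, rfl⟩, hs⟩ ⟨⟨g, rfl⟩, hs'⟩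
    exact ⟨h.basicOpen_basicOpen_is_basicOpen g f, hs'.trans hs⟩

theorem V_mono {c c' : Chart j D} (h : c ≤ c') : c.V ≤ c'.V := by
  obtain ⟨r, hr⟩ := h.1
  exact hr ▸ X.basicOpen_le r

/-- Generators of the ideals `D i` on the affine open subset of a chart. -/
noncomputable def gen (c : Chart j D) (i : Bool) : Γ(X, c.V) := (c.principal i).choose

theorem ideal_eq (c : Chart j D) (i : Bool) :
    (D i).ideal ⟨c.V, c.isAffineOpen⟩ = Ideal.span {c.gen i} :=
  (c.principal i).choose_spec.1

theorem isUnit_gen (c : Chart j D) (i : Bool) : IsUnit ((j.app c.V).hom (c.gen i)) :=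
  (c.principal i).choose_spec.2

/-- The coordinate ring of a chart. -/
noncomputable def ring (c : Chart j D) : Subring Γ(U, j ⁻¹ᵁ c.V) :=
  ratioSubring (j.app c.V).hom c.gen c.s

/-- The structure morphism of the coordinate ring of a chart. -/
noncomputable def toRing (c : Chart j D) : Γ(X, c.V) →+* c.ring :=
  (j.app c.V).hom.codRestrict c.ring (map_mem_ratioSubring _ _ _)

/-- The restriction of functions on `X`. -/
noncomputable def resX {c c' : Chart j D} (h : c ≤ c') : Γ(X, c'.V) →+* Γ(X, c.V) :=
  (X.presheaf.map (homOfLE (V_mono h)).op).hom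

/-- The restriction of functions on `U`. -/
noncomputable def resU {c c' : Chart j D} (h : c ≤ c') :
    Γ(U, j ⁻¹ᵁ c'.V) →+* Γ(U, j ⁻¹ᵁ c.V) :=
  (U.presheaf.map (homOfLE (j.preimage_mono (V_mono h))).op).hom

theorem resU_comp {c c' : Chart j D} (h : c ≤ c') :
    (resU h).comp (j.app c'.V).hom = (j.app c.V).hom.comp (resX h) := by
  have := j.naturality (homOfLE (V_mono h)).op
  rw [resU, resX, ← CommRingCat.hom_comp, ← CommRingCat.hom_comp, this]
  rfl

theorem span_gen {c c' : Chart j D} (h : c ≤ c') (i : Bool) :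
    Ideal.span {c.gen i} = Ideal.span {resX h (c'.gen i)} := by
  rw [← ideal_eq, ← Set.image_singleton, ← Ideal.map_span, ← ideal_eq]
  exact ((D i).map_ideal (U := ⟨c.V, c.isAffineOpen⟩) (V := ⟨c'.V, c'.isAffineOpen⟩)
    (V_mono h)).symm

theorem ring_eq {c c' : Chart j D} (h : c ≤ c') :
    c.ring = ratioSubring (j.app c.V).hom (fun i => resX h (c'.gen i)) c.s :=
  ratioSubring_congr c.isUnit_gen (fun i => by
    have := congr($(resU_comp h) (c'.gen i))
    simp only [RingHom.comp_apply] at this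
    rw [← this]
    exact (c'.isUnit_gen i).map _) (span_gen h) _

theorem resU_mem {c c' : Chart j D} (h : c ≤ c') : ∀ x ∈ c'.ring, resU h x ∈ c.ring := by
  rw [ring_eq h]
  exact map_mem_ratioSubring_of_comm (resU_comp h) c'.isUnit_gen h.2

/-- The transition morphisms between the coordinate rings of charts. -/
noncomputable def ringMap {c c' : Chart j D} (h : c ≤ c') : c'.ring →+* c.ring :=
  (resU h).restrict _ _ (resU_mem h)

theorem ringMap_comp_toRing {c c' : Chart j D} (h : c ≤ c') :
    (ringMap h).comp c'.toRing = c.toRing.comp (resX h) := by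
  ext x
  exact congr($(resU_comp h) x)

/-- The transition morphisms between the charts are localizations away from one element. -/
theorem exists_isLocalization [IsNoetherian U] {c c' : Chart j D} (h : c ≤ c') {i₀ : Bool}
    (hi₀ : i₀ ∈ c'.s) :
    ∃ r, X.basicOpen r = c.V ∧
    letI := (ringMap h).toAlgebra
    IsLocalization.Away (⟨ratioDenom (j.app c'.V).hom c'.gen i₀ r c.s,
      ratioDenom_mem c'.isUnit_gen hi₀ r c.s⟩ : c'.ring) c.ring := by
  obtain ⟨r, hr⟩ := h.1
  refine ⟨r, hr, ?_⟩
  have key : ∀ (W : X.Opens) (hW : W ≤ c'.V), X.basicOpen r = W →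
      IsUnit (X.presheaf.map (homOfLE hW).op r) ∧
      (∀ y, ∃ (n : ℕ) (x : Γ(X, c'.V)), X.presheaf.map (homOfLE hW).op x =
        X.presheaf.map (homOfLE hW).op r ^ n * y) ∧
      (∀ x, U.presheaf.map (homOfLE (j.preimage_mono hW)).op x = 0 →
        ∃ n : ℕ, j.app c'.V r ^ n * x = 0) := by
    rintro _ hW rfl
    have hloc := c'.isAffineOpen.isLocalization_basicOpen r
    refine ⟨hloc.map_units _ ⟨r, 1, pow_one r⟩, fun y => ?_, fun x hx => ?_⟩
    · obtain ⟨⟨x, _, n, rfl⟩, hx⟩ := IsLocalization.surj (M := .powers r) y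
      refine ⟨n, x, ?_⟩
      rw [← map_pow, mul_comm]
      exact hx.symm
    · refine exists_pow_mul_eq_zero_of_res_basicOpen_eq_zero_of_isCompact U
        (TopologicalSpace.NoetherianSpace.isCompact _) x _ ?_
      have e : U.basicOpen (j.app c'.V r) = j ⁻¹ᵁ X.basicOpen r := (j.preimage_basicOpen r).symm
      have e' := congrArg (U.presheaf.map (homOfLE e.le).op) hx
      rw [map_zero, ← CommRingCat.comp_apply, ← Functor.map_comp] at e'
      exact e'
  obtain ⟨h1, h2, h3⟩ := key c.V (V_mono h) hr
  exact isLocalization_of_eq_ratioSubring (resU_comp h) c'.isUnit_gen h.2 hi₀ h1 h2 h3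
    (ring_eq h) _

end Chart

section

variable [IsNoetherian U]

/-- The transition morphisms between the charts. -/
noncomputable def Chart.map {c c' : Chart j D} (h : c ≤ c') :
    Spec (.of c.ring) ⟶ Spec (.of c'.ring) :=
  Spec.map (CommRingCat.ofHom (Chart.ringMap h))

variable (j D) in
/-- The diagram of the charts. -/
noncomputable def diagram : Chart j D ⥤ Scheme.{u} where
  obj c := Spec (.of c.ring)
  map h := Chart.map h.le
  map_id c := by
    rw [← Spec.map_id, Chart.map]
    congr 1
    ext x
    exact congr($(U.presheaf.map_id _) x.1)
  map_comp {c c' c''} f g := by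
    rw [Chart.map, Chart.map, Chart.map, ← Spec.map_comp, ← CommRingCat.ofHom_comp]
    congr 2
    ext x
    exact congr($(U.presheaf.map_comp (homOfLE (j.preimage_mono
      (Chart.V_mono g.le))).op (homOfLE (j.preimage_mono
      (Chart.V_mono f.le))).op) x.1)

instance {c c' : Chart j D} (h : c ≤ c') : IsOpenImmersion (Chart.map h) := by
  obtain ⟨i₀, hi₀⟩ := c'.nonempty
  obtain ⟨r, hr, hloc⟩ := Chart.exists_isLocalization h hi₀
  let := (Chart.ringMap h).toAlgebra
  have := hloc
  exact IsOpenImmersion.of_isLocalization (R := c'.ring)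
    (⟨ratioDenom (j.app c'.V).hom c'.gen i₀ r c.s,
      ratioDenom_mem c'.isUnit_gen hi₀ r c.s⟩ : c'.ring)

/-- A chart, as an open subset of a larger one, is the locus where `r` and the ratios `a i / a i₀` are
invertible. -/
theorem exists_range_map {c c' : Chart j D} (h : c ≤ c') {i₀ : Bool} (hi₀ : i₀ ∈ c'.s) :
    ∃ r, X.basicOpen r = c.V ∧ ∀ p : Spec (.of c'.ring), p ∈ Set.range (Chart.map h) ↔
      c'.toRing r ∉ p.asIdeal ∧ ∀ i ∈ c.s, (⟨ratio (j.app c'.V).hom c'.gen i i₀,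
        ratio_mem_ratioSubring c'.isUnit_gen hi₀ i⟩ : c'.ring) ∉ p.asIdeal := by
  obtain ⟨r, hr, hloc⟩ := Chart.exists_isLocalization h hi₀
  refine ⟨r, hr, fun p => ?_⟩
  let := (Chart.ringMap h).toAlgebra
  have := hloc
  have h₁ := PrimeSpectrum.localization_away_comap_range c.ring
    (⟨ratioDenom (j.app c'.V).hom c'.gen i₀ r c.s,
      ratioDenom_mem c'.isUnit_gen hi₀ r c.s⟩ : c'.ring)
  have h₂ : Set.range (Chart.map h) = _ := h₁
  rw [h₂]
  change _ ∉ p.asIdeal ↔ _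
  have : (⟨ratioDenom (j.app c'.V).hom c'.gen i₀ r c.s,
      ratioDenom_mem c'.isUnit_gen hi₀ r c.s⟩ : c'.ring) = c'.toRing r * ∏ i ∈ c.s,
        (⟨ratio (j.app c'.V).hom c'.gen i i₀,
          ratio_mem_ratioSubring c'.isUnit_gen hi₀ i⟩ : c'.ring) := by
    refine Subtype.ext ?_
    rw [Subring.coe_mul, ← Subring.subtype_apply (s := c'.ring) (∏ i ∈ c.s, _), map_prod]
    rfl
  rw [this, p.2.mul_mem_iff_mem_or_mem, p.2.prod_mem_iff]
  push Not
  rfl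

instance {c c' : Chart j D} (f : c ⟶ c') : IsOpenImmersion ((diagram j D).map f) :=
  inferInstanceAs (IsOpenImmersion (Chart.map f.le))

end
end BlowUp
end MPair

namespace MPair
namespace BlowUp
variable {U X : Scheme.{u}} {j : U ⟶ X} {D : Bool → X.IdealSheafData}

namespace Chart

/-- The structure morphism of a chart. -/
noncomputable def toX (c : Chart j D) : Spec (.of c.ring) ⟶ X :=
  Spec.map (CommRingCat.ofHom c.toRing) ≫ c.isAffineOpen.fromSpec

theorem toX_mem_basicOpen_iff (c : Chart j D) (r : Γ(X, c.V)) (p : Spec (.of c.ring)) :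
    c.toX p ∈ X.basicOpen r ↔ c.toRing r ∉ p.asIdeal := by
  have := c.isAffineOpen.fromSpec_preimage_basicOpen' r
  change Spec.map (CommRingCat.ofHom c.toRing) p ∈ c.isAffineOpen.fromSpec ⁻¹ᵁ X.basicOpen r ↔ _
  rw [c.isAffineOpen.fromSpec_preimage_basicOpen]
  rfl

theorem toX_mem (c : Chart j D) (p : Spec (.of c.ring)) : c.toX p ∈ c.V := by
  have := Set.mem_range_self (f := c.isAffineOpen.fromSpec)
    (Spec.map (CommRingCat.ofHom c.toRing) p)
  rwa [c.isAffineOpen.range_fromSpec] at this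

/-- The chart above a smaller affine open subset with a given set of indices. -/
def restrict (c : Chart j D) (W : X.Opens) (hW' : IsAffineOpen W) (hW : W ≤ c.V) (s : Finset Bool)
    (hs : s.Nonempty) : Chart j D where
  V := W
  isAffineOpen := hW'
  principal i := by
    refine ⟨X.presheaf.map (homOfLE hW).op (c.gen i), ?_, ?_⟩
    · have h := (D i).map_ideal (U := ⟨W, hW'⟩) (V := ⟨c.V, c.isAffineOpen⟩) hW
      rw [c.ideal_eq, Ideal.map_span, Set.image_singleton] at h
      exact h.symm
    · have h := congr($(j.naturality (homOfLE hW).op) (c.gen i))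
      simp only [CommRingCat.comp_apply] at h
      rw [h]
      exact (c.isUnit_gen i).map _
  s := s
  nonempty := hs

/-- The chart with the same affine open subset and another set of indices. -/
abbrev reindex (c : Chart j D) (s : Finset Bool) (hs : s.Nonempty) : Chart j D :=
  ⟨c.V, c.isAffineOpen, c.principal, s, hs⟩

theorem map_toX {c c' : Chart j D} (h : c ≤ c') : map h ≫ c'.toX = c.toX := by
  have e := IsAffineOpen.map_fromSpec c'.isAffineOpen c.isAffineOpen (homOfLE (V_mono h)).op
  rw [toX, toX, ← e, map, ← Category.assoc, ← Category.assoc, ← Spec.map_comp, ← Spec.map_comp,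
    ← CommRingCat.ofHom_comp, ringMap_comp_toRing]
  rfl

end Chart

variable [IsNoetherian U]

theorem mem_range_map {c c' : Chart j D} (h : c ≤ c') {i₀ : Bool} (hi₀ : i₀ ∈ c'.s)
    (p : Spec (.of c'.ring)) : p ∈ Set.range (Chart.map h) ↔
      c'.toX p ∈ c.V ∧ ∀ i ∈ c.s, (⟨ratio (j.app c'.V).hom c'.gen i i₀,
        ratio_mem_ratioSubring c'.isUnit_gen hi₀ i⟩ : c'.ring) ∉ p.asIdeal := by
  obtain ⟨r, hr, h⟩ := exists_range_map h hi₀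
  rw [h, ← hr, Chart.toX_mem_basicOpen_iff]

/-- The points of the intersection of two subcharts of a chart lie in a common subchart. -/
theorem exists_map_eq {c₁ c₂ c : Chart j D} (f₁ : c₁ ≤ c) (f₂ : c₂ ≤ c) {x₁ : Spec (.of c₁.ring)}
    {x₂ : Spec (.of c₂.ring)} (hx : Chart.map f₁ x₁ = Chart.map f₂ x₂) :
    ∃ (l : Chart j D) (h₁ : l ≤ c₁) (h₂ : l ≤ c₂) (x : Spec (.of l.ring)),
      Chart.map h₁ x = x₁ ∧ Chart.map h₂ x = x₂ := by
  obtain ⟨i₀, hi₀⟩ := c.nonempty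
  obtain ⟨r₁, hr₁⟩ := f₁.1
  obtain ⟨r₂, hr₂⟩ := f₂.1
  have hV : X.basicOpen (r₁ * r₂) = c₁.V ⊓ c₂.V := by
    rw [Scheme.basicOpen_mul, hr₁, hr₂]
  let l : Chart j D := c.restrict (X.basicOpen (r₁ * r₂)) (c.isAffineOpen.basicOpen _)
    (X.basicOpen_le _) (c₁.s ∪ c₂.s) (c₁.nonempty.mono Finset.subset_union_left)
  have h₁ : l ≤ c₁ := by
    refine ⟨⟨X.presheaf.map (homOfLE (Chart.V_mono f₁)).op r₂, ?_⟩, Finset.subset_union_left⟩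
    refine (Scheme.basicOpen_res _ _ _).trans ?_
    change _ = X.basicOpen (r₁ * r₂)
    rw [hV, hr₂]
  have h₂ : l ≤ c₂ := by
    refine ⟨⟨X.presheaf.map (homOfLE (Chart.V_mono f₂)).op r₁, ?_⟩, Finset.subset_union_right⟩
    refine (Scheme.basicOpen_res _ _ _).trans ?_
    change _ = X.basicOpen (r₁ * r₂)
    rw [hV, hr₁, inf_comm]
  have hp : Chart.map f₁ x₁ ∈ Set.range (Chart.map (h₁.trans f₁)) := by
    rw [mem_range_map _ hi₀]
    have a₁ := (mem_range_map f₁ hi₀ _).mp ⟨x₁, rfl⟩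
    have a₂ := (mem_range_map f₂ hi₀ _).mp ⟨x₂, rfl⟩
    rw [← hx] at a₂
    refine ⟨?_, fun i hi => ?_⟩
    · change _ ∈ X.basicOpen (r₁ * r₂)
      rw [hV]
      exact ⟨a₁.1, a₂.1⟩
    · rcases Finset.mem_union.mp hi with hi | hi
      · exact a₁.2 i hi
      · exact a₂.2 i hi
  obtain ⟨x, hx'⟩ := hp
  have hc : ∀ {c' : Chart j D} (h : l ≤ c') (h' : c' ≤ c),
      Chart.map h ≫ Chart.map h' = Chart.map (h₁.trans f₁) := fun h h' =>
    ((diagram j D).map_comp (homOfLE h) (homOfLE h')).symm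
  refine ⟨l, h₁, h₂, x, ?_, ?_⟩
  · apply (Chart.map f₁).isOpenEmbedding.injective
    rw [← hx', ← hc h₁ f₁, Scheme.Hom.comp_apply]
  · apply (Chart.map f₂).isOpenEmbedding.injective
    rw [← hx, ← hx', ← hc h₂ f₂, Scheme.Hom.comp_apply]

instance : (diagram j D ⋙ Scheme.forget).IsLocallyDirected where
  cond {c₁ c₂ c} f₁ f₂ x₁ x₂ hx := by
    obtain ⟨l, h₁, h₂, x, hx₁, hx₂⟩ := exists_map_eq f₁.le f₂.le hx
    exact ⟨l, homOfLE h₁, homOfLE h₂, x, hx₁, hx₂⟩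

variable (j D) in
/-- The blow-up of `X` in the ideal generated by the two ideals `D i`. -/
noncomputable def total : Scheme.{u} := colimit (diagram j D)

/-- The inclusion of a chart of the blow-up. -/
noncomputable def Chart.ι (c : Chart j D) : Spec (.of c.ring) ⟶ total j D :=
  colimit.ι (diagram j D) c

instance (c : Chart j D) : IsOpenImmersion c.ι :=
  inferInstanceAs (IsOpenImmersion (colimit.ι (diagram j D) c))

theorem Chart.map_ι {c c' : Chart j D} (h : c ≤ c') : Chart.map h ≫ c'.ι = c.ι :=
  colimit.w (diagram j D) (homOfLE h)

theorem range_ι_mono {c c' : Chart j D} (h : c ≤ c') : Set.range c.ι ⊆ Set.range c'.ι := by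
  rintro _ ⟨x, rfl⟩
  refine ⟨Chart.map h x, ?_⟩
  rw [← Scheme.Hom.comp_apply, Chart.map_ι]

theorem exists_ι (x : total j D) : ∃ (c : Chart j D) (y : Spec (.of c.ring)), c.ι y = x :=
  Scheme.IsLocallyDirected.ι_jointly_surjective (diagram j D) x

theorem ι_mem_range_iff {c c' : Chart j D} (x : Spec (.of c.ring)) :
    c.ι x ∈ Set.range c'.ι ↔ ∃ (l : Chart j D) (h : l ≤ c) (_ : l ≤ c'),
      x ∈ Set.range (Chart.map h) := by
  constructor
  · rintro ⟨x', hx'⟩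
    obtain ⟨l, f, f', y, hy, hy'⟩ :=
      (Scheme.IsLocallyDirected.ι_eq_ι_iff (diagram j D)).mp hx'
    exact ⟨l, f'.le, f.le, y, hy'⟩
  · rintro ⟨l, h, h', y, rfl⟩
    refine ⟨Chart.map h' y, ?_⟩
    rw [← Scheme.Hom.comp_apply, ← Scheme.Hom.comp_apply, Chart.map_ι, Chart.map_ι]

variable (j D) in
/-- The structure morphism of the blow-up. -/
noncomputable def toBase : total j D ⟶ X :=
  colimit.desc (diagram j D)
    { pt := X
      ι := { app := Chart.toX
             naturality := fun _ _ f => (Chart.map_toX f.le).trans (Category.comp_id _).symm } }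

@[simp]
theorem ι_toBase (c : Chart j D) : c.ι ≫ toBase j D = c.toX :=
  colimit.ι_desc _ _

/-- The points above the affine open subset of a chart lie in the charts with that affine open
subset and a single index. -/
theorem exists_mem_range_ι (c : Chart j D) (x : total j D) (hx : toBase j D x ∈ c.V) :
    ∃ i, x ∈ Set.range (c.reindex {i} (Finset.singleton_nonempty i)).ι := by
  obtain ⟨c', y, rfl⟩ := exists_ι x
  rw [← Scheme.Hom.comp_apply, ι_toBase] at hx
  obtain ⟨i, hi⟩ := c'.nonempty
  obtain ⟨f, g, hfg, hf⟩ :=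
    exists_basicOpen_le_affine_inter c.isAffineOpen c'.isAffineOpen _ ⟨hx, c'.toX_mem y⟩
  let l : Chart j D := c'.restrict (X.basicOpen g) (c'.isAffineOpen.basicOpen g)
    (X.basicOpen_le _) c'.s c'.nonempty
  have hl : l ≤ c' := ⟨⟨g, rfl⟩, subset_rfl⟩
  refine ⟨i, (ι_mem_range_iff y).mpr ⟨l, hl, ⟨⟨f, hfg⟩, Finset.singleton_subset_iff.mpr hi⟩, ?_⟩⟩
  rw [mem_range_map hl hi]
  refine ⟨show c'.toX y ∈ X.basicOpen g from hfg ▸ hf, fun m hm => ?_⟩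
  have h1 : (⟨ratio (j.app c'.V).hom c'.gen m i,
      ratio_mem_ratioSubring c'.isUnit_gen hi m⟩ : c'.ring) *
      ⟨ratio (j.app c'.V).hom c'.gen i m, ratio_mem_ratioSubring c'.isUnit_gen hm i⟩ = 1 :=
    Subtype.ext ((ratio_mul_ratio c'.isUnit_gen m i m).trans (ratio_self c'.isUnit_gen m))
  exact fun h => y.2.ne_top (Ideal.eq_top_of_isUnit_mem _ h (.of_mul_eq_one _ h1))

end BlowUp
end MPair

/-! ### The intersection of the two ideals on the blow-up -/

namespace MPair

theorem comap_inf_of_isOpenImmersion {X Y : Scheme.{u}} (f : X ⟶ Y) [IsOpenImmersion f]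
    (I J : Y.IdealSheafData) : (I ⊓ J).comap f = I.comap f ⊓ J.comap f := by
  ext V : 2
  simp only [Scheme.IdealSheafData.ideal_comap_of_isOpenImmersion,
    Scheme.IdealSheafData.ideal_inf, Pi.inf_apply, Ideal.comap_inf]

theorem isEffectiveCartier_of_cover {X : Scheme.{u}} {I : X.IdealSheafData}
    (h : ∀ x : X, ∃ (Y : Scheme.{u}) (_ : IsAffine Y) (f : Y ⟶ X) (_ : IsOpenImmersion f),
      x ∈ Set.range f ∧ ∃ t ∈ nonZeroDivisors Γ(Y, ⊤),
        (I.comap f).ideal ⟨⊤, isAffineOpen_top Y⟩ = Ideal.span {t}) : IsEffectiveCartier I := by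
  intro x
  obtain ⟨Y, _, f, _, hx, t, ht, hI⟩ := h x
  rw [Scheme.IdealSheafData.ideal_comap_of_isOpenImmersion] at hI
  let e := (f.appIso ⊤).commRingCatIsoToRingEquiv
  refine ⟨⟨f ''ᵁ ⊤, (isAffineOpen_top Y).image_of_isOpenImmersion f⟩, ?_, e.symm t, ?_, ?_⟩
  · simpa using hx
  · exact (MulEquivClass.map_nonZeroDivisors e.symm).le ⟨t, ht, rfl⟩
  · have h2 := congrArg (Ideal.map (f.appIso ⊤).inv.hom) hI
    rw [Ideal.map_comap_of_surjective _
      (ConcreteCategory.bijective_of_isIso (f.appIso ⊤).inv).2, Ideal.map_span,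
      Set.image_singleton] at h2
    exact h2

/-- The closed point of the spectrum of a local ring, as a point of a scheme. -/
def closedPt (T : Type u) [CommRing T] [IsLocalRing T] : Spec (.of T) :=
  IsLocalRing.closedPoint T

theorem specializes_closedPt {T : Type u} [CommRing T] [IsLocalRing T] (y : Spec (.of T)) :
    y ⤳ closedPt T :=
  IsLocalRing.specializes_closedPoint y

theorem mem_closedPt_asIdeal {T : Type u} [CommRing T] [IsLocalRing T] (t : T) :
    t ∈ (closedPt T).asIdeal ↔ ¬ IsUnit t :=
  IsLocalRing.mem_maximalIdeal _

/-- A morphism from the spectrum of a local ring factors through an open subscheme that contains the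
image of the closed point. -/
theorem exists_lift_of_closedPoint {T : Type u} [CommRing T] [IsLocalRing T] {Y Z : Scheme.{u}}
    (g : Spec (.of T) ⟶ Z) (f : Y ⟶ Z) [IsOpenImmersion f]
    (h : g (closedPt T) ∈ Set.range f) : ∃ g' : Spec (.of T) ⟶ Y, g' ≫ f = g := by
  refine ⟨IsOpenImmersion.lift f g ?_, IsOpenImmersion.lift_fac _ _ _⟩
  rintro _ ⟨y, rfl⟩
  exact ((specializes_closedPt y).map g.continuous).mem_open
    f.isOpenEmbedding.isOpen_range h

namespace BlowUp
variable {U X : Scheme.{u}} {j : U ⟶ X} {D : Bool → X.IdealSheafData}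

theorem exists_chart (hD : ∀ x : X, ∃ V : X.affineOpens, x ∈ V.1 ∧ ∀ i, ∃ a,
    (D i).ideal V = Ideal.span {a}) (hj : ∀ i x, j x ∉ (D i).support) (x : X) :
    ∃ c : Chart j D, x ∈ c.V := by
  obtain ⟨V, hx, h⟩ := hD x
  refine ⟨⟨V.1, V.2, fun i => ?_, {true}, Finset.singleton_nonempty _⟩, hx⟩
  obtain ⟨a, ha⟩ := h i
  exact ⟨a, ha, isUnit_app (hj i) V.2 ha⟩

theorem toRing_ratio (c : Chart j D) {i : Bool} (hi : i ∈ c.s) (l : Bool) :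
    (⟨ratio (j.app c.V).hom c.gen l i, ratio_mem_ratioSubring c.isUnit_gen hi l⟩ : c.ring) *
      c.toRing (c.gen i) = c.toRing (c.gen l) :=
  Subtype.ext (ratio_mul c.isUnit_gen l i)

theorem comap_toX_le (c : Chart j D) {i : Bool} (hi : i ∈ c.s) (l : Bool) :
    (D l).comap c.toX ≤ (D i).comap c.toX :=
  (ModulusPair.comap_fromSpec_le_iff c.isAffineOpen (c.ideal_eq l) (c.ideal_eq i) c.toRing).mpr
    (Dvd.intro_left _ (toRing_ratio c hi l))

theorem toRing_gen_mem_nonZeroDivisors (c : Chart j D) (i : Bool) :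
    c.toRing (c.gen i) ∈ nonZeroDivisors c.ring := by
  rw [mem_nonZeroDivisors_iff_right]
  intro x hx
  exact Subtype.ext ((c.isUnit_gen i).mul_left_eq_zero.mp (congrArg Subtype.val hx))

variable [IsNoetherian U]

theorem exists_singleton_chart (hD : ∀ x : X, ∃ V : X.affineOpens, x ∈ V.1 ∧ ∀ i, ∃ a,
    (D i).ideal V = Ideal.span {a}) (hj : ∀ i x, j x ∉ (D i).support) (x : total j D) :
    ∃ (c : Chart j D) (i : Bool), c.s = {i} ∧ x ∈ Set.range c.ι := by
  obtain ⟨c, hc⟩ := exists_chart hD hj (toBase j D x)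
  obtain ⟨i, hi⟩ := exists_mem_range_ι c x hc
  exact ⟨_, i, rfl, hi⟩

/-- The intersection of the pull-backs of the two ideals to the blow-up. -/
noncomputable def infIdeal (π : U ⟶ X) (D : Bool → X.IdealSheafData) : U.IdealSheafData :=
  (D true).comap π ⊓ (D false).comap π

/-- On the chart on which `D i` generates the exceptional ideal, the intersection is the pull-back of
the other ideal. -/
theorem infIdeal_comap_ι (c : Chart j D) {i : Bool} (hi : i ∈ c.s) :
    (infIdeal (toBase j D) D).comap c.ι = (D (!i)).comap c.toX := by
  rw [infIdeal, comap_inf_of_isOpenImmersion, ← Scheme.IdealSheafData.comap_comp,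
    ← Scheme.IdealSheafData.comap_comp, ι_toBase]
  cases i
  · exact inf_eq_left.mpr (comap_toX_le c hi true)
  · exact inf_eq_right.mpr (comap_toX_le c hi false)

theorem isEffectiveCartier_infIdeal (hD : ∀ x : X, ∃ V : X.affineOpens, x ∈ V.1 ∧ ∀ i, ∃ a,
    (D i).ideal V = Ideal.span {a}) (hj : ∀ i x, j x ∉ (D i).support) :
    IsEffectiveCartier (infIdeal (toBase j D) D) := by
  refine isEffectiveCartier_of_cover fun x => ?_
  obtain ⟨c, i, hi, hx⟩ := exists_singleton_chart hD hj x
  refine ⟨_, inferInstance, c.ι, inferInstance, hx,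
    (Scheme.ΓSpecIso (.of c.ring)).inv (c.toRing (c.gen !i)), ?_, ?_⟩
  · exact (MulEquivClass.map_nonZeroDivisors
      (Scheme.ΓSpecIso (.of c.ring)).symm.commRingCatIsoToRingEquiv).le
      ⟨_, toRing_gen_mem_nonZeroDivisors c _, rfl⟩
  · rw [infIdeal_comap_ι c (i := i) (by simp [hi])]
    exact ModulusPair.comap_fromSpec_ideal c.isAffineOpen (c.ideal_eq _) c.toRing

/-- On the spectrum of a local ring, one of the two ideals is contained in the other one. -/
theorem exists_comap_le_infIdeal_comap (hD : ∀ x : X, ∃ V : X.affineOpens, x ∈ V.1 ∧ ∀ i, ∃ a,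
    (D i).ideal V = Ideal.span {a}) (hj : ∀ i x, j x ∉ (D i).support) {T : Type u} [CommRing T]
    [IsLocalRing T] (g : Spec (.of T) ⟶ total j D) :
    ∃ i, (D i).comap (g ≫ toBase j D) ≤ (infIdeal (toBase j D) D).comap g := by
  obtain ⟨c, i, hi, hx⟩ := exists_singleton_chart hD hj (g (closedPt T))
  obtain ⟨g', rfl⟩ := exists_lift_of_closedPoint g c.ι hx
  refine ⟨!i, ?_⟩
  rw [Category.assoc, ι_toBase, Scheme.IdealSheafData.comap_comp, Scheme.IdealSheafData.comap_comp,
    infIdeal_comap_ι c (i := i) (by simp [hi])]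

end BlowUp
end MPair

/-! ### Properness of the blow-up -/

namespace MPair
namespace BlowUp
variable {U X : Scheme.{u}} {j : U ⟶ X} {D : Bool → X.IdealSheafData}

theorem ringMap_reindex (c : Chart j D) {s s' : Finset Bool} (hs : s.Nonempty) (hs' : s'.Nonempty)
    (h : c.reindex s' hs' ≤ c.reindex s hs) (x : (c.reindex s hs).ring) :
    (Chart.ringMap h x).1 = x.1 :=
  congr($(U.presheaf.map_id _) x.1)

/-- The ratio of the generators of `D l` and `D i`, as a function on a chart. -/
noncomputable def Chart.τ (c : Chart j D) {i : Bool} (hi : i ∈ c.s) (l : Bool) : c.ring :=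
  ⟨ratio (j.app c.V).hom c.gen l i, ratio_mem_ratioSubring c.isUnit_gen hi l⟩

/-- The chart with a single index. -/
abbrev Chart.single (c : Chart j D) (i : Bool) : Chart j D :=
  c.reindex {i} (Finset.singleton_nonempty i)

/-- The overlap of the charts with a single index. -/
abbrev Chart.both (c : Chart j D) : Chart j D :=
  c.reindex Finset.univ Finset.univ_nonempty

theorem Chart.both_le (c : Chart j D) (i : Bool) : c.both ≤ c.single i :=
  ⟨(le_refl c).1, Finset.subset_univ _⟩

/-- The ratio of the generators on the chart with a single index. -/
noncomputable abbrev Chart.τs (c : Chart j D) (i : Bool) : (c.single i).ring :=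
  (c.single i).τ (Finset.mem_singleton_self i) (!i)

/-- A homomorphism from the coordinate ring of a chart with a single index has values in a
subring as soon as it does so on the coordinate ring of the affine open subset and on the ratio. -/
theorem map_mem_of_single (c : Chart j D) (i : Bool) {B : Type*} [CommRing B]
    (γ : (c.single i).ring →+* B) (S : Subring B) (h₁ : ∀ x, γ ((c.single i).toRing x) ∈ S)
    (h₂ : γ (c.τs i) ∈ S) (x : (c.single i).ring) : γ x ∈ S := by
  let T : Subring Γ(U, j ⁻¹ᵁ c.V) := (S.comap γ).map (c.single i).ring.subtype
  have hT : (c.single i).ring ≤ T := by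
    refine ratioSubring_le (c.single i).isUnit_gen (fun x => ⟨_, h₁ x, rfl⟩) fun m hm l => ?_
    obtain rfl : m = i := Finset.mem_singleton.mp hm
    rcases Bool.eq_or_eq_not l m with rfl | rfl
    · rw [ratio_self (c.single l).isUnit_gen]
      exact T.one_mem
    · exact ⟨_, h₂, rfl⟩
  obtain ⟨y, hy, hyx⟩ := hT x.2
  obtain rfl : y = x := Subtype.ext hyx
  exact hy

theorem ringMap_τs_mul (c : Chart j D) (i : Bool) :
    Chart.ringMap (c.both_le i) (c.τs i) * Chart.ringMap (c.both_le !i) (c.τs !i) = 1 := by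
  refine Subtype.ext ?_
  have e₁ : (Chart.ringMap (c.both_le i) (c.τs i)).1 = ratio (j.app c.V).hom c.gen (!i) i :=
    ringMap_reindex c _ _ _ _
  have e₂ : (Chart.ringMap (c.both_le !i) (c.τs !i)).1 = ratio (j.app c.V).hom c.gen (!!i) (!i) :=
    ringMap_reindex c _ _ _ _
  rw [Subring.coe_mul]
  refine (congrArg₂ (· * ·) e₁ e₂).trans ?_
  rw [Bool.not_not, ratio_mul_ratio c.isUnit_gen, ratio_self c.isUnit_gen]
  rfl

section

variable [IsNoetherian U]

theorem locallyOfFiniteType_toBase : LocallyOfFiniteType (toBase j D) := by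
  have : IsZariskiLocalAtSource @LocallyOfFiniteType.{u} :=
    HasRingHomProperty.instIsZariskiLocalAtSource (Q := RingHom.FiniteType)
  refine (IsZariskiLocalAtSource.iff_of_openCover (P := @LocallyOfFiniteType.{u})
    (Scheme.IsLocallyDirected.openCover (diagram j D))).mpr ?_
  intro (c : Chart j D)
  change LocallyOfFiniteType (c.ι ≫ toBase j D)
  rw [ι_toBase, Chart.toX]
  have : LocallyOfFiniteType (Spec.map (CommRingCat.ofHom (Chart.toRing c))) := by
    rw [HasRingHomProperty.Spec_iff (P := @LocallyOfFiniteType.{u})]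
    exact finiteType_ratioSubring (Chart.isUnit_gen c) _
  have := c.isAffineOpen.isOpenImmersion_fromSpec
  infer_instance

theorem quasiCompact_toBase (hD : ∀ x : X, ∃ c : Chart j D, x ∈ c.V) :
    QuasiCompact (toBase j D) := by
  choose c hc using hD
  refine @HasAffineProperty.of_iSup_eq_top _ _
    instHasAffinePropertyQuasiCompactCompactSpaceCarrierCarrierCommRingCat.{u} _ _ _ _
    (fun x => ⟨(c x).V, (c x).isAffineOpen⟩) ?_ ?_
  · rw [eq_top_iff]
    exact fun x _ => TopologicalSpace.Opens.mem_iSup.mpr ⟨x, hc x⟩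
  · intro x
    change CompactSpace (toBase j D ⁻¹ᵁ (c x).V : Set (total j D))
    rw [← isCompact_iff_compactSpace]
    have : (toBase j D ⁻¹ᵁ (c x).V : Set (total j D)) =
        ⋃ i : Bool, Set.range ((c x).reindex {i} (Finset.singleton_nonempty i)).ι := by
      ext y
      rw [Set.mem_iUnion]
      refine ⟨fun hy => exists_mem_range_ι _ _ hy, ?_⟩
      rintro ⟨i, z, rfl⟩
      change toBase j D (Chart.ι _ z) ∈ (c x).V
      rw [← Scheme.Hom.comp_apply, ι_toBase]
      exact Chart.toX_mem _ z
    rw [this]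
    exact isCompact_iUnion fun i => isCompact_range (Scheme.Hom.continuous _)

variable {R K : Type u} [CommRing R] [Field K] [Algebra R K] [IsFractionRing R K]

theorem eq_of_closedPoint_mem [IsDomain R] [IsLocalRing R] (c : Chart j D)
    {l₁ l₂ : Spec (.of R) ⟶ total j D} (h₁ : l₁ (closedPt R) ∈ Set.range c.ι)
    (h₂ : l₂ (closedPt R) ∈ Set.range c.ι)
    (h : genericPt R K ≫ l₁ = genericPt R K ≫ l₂) : l₁ = l₂ := by
  obtain ⟨g₁, rfl⟩ := exists_lift_of_closedPoint l₁ c.ι h₁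
  obtain ⟨g₂, rfl⟩ := exists_lift_of_closedPoint l₂ c.ι h₂
  have : genericPt R K ≫ g₁ = genericPt R K ≫ g₂ := by
    rw [← cancel_mono c.ι, Category.assoc, Category.assoc, h]
  rw [ModulusPair.comp_hom_eq_of_genericPt R K this]

theorem mem_range_map_both (c : Chart j D) (i : Bool) (p : Spec (.of (c.single i).ring)) :
    p ∈ Set.range (Chart.map (c.both_le i)) ↔ c.τs i ∉ p.asIdeal := by
  rw [mem_range_map _ (Finset.mem_singleton_self i)]
  refine ⟨fun h => h.2 (!i) (Finset.mem_univ _), fun h => ⟨Chart.toX_mem _ p, fun m _ => ?_⟩⟩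
  rcases Bool.eq_or_eq_not m i with rfl | rfl
  · have : (⟨ratio (j.app (c.single m).V).hom (c.single m).gen m m, ratio_mem_ratioSubring
        (c.single m).isUnit_gen (Finset.mem_singleton_self m) m⟩ : (c.single m).ring) = 1 :=
      Subtype.ext (ratio_self (c.single m).isUnit_gen m)
    rw [this]
    exact fun h => p.2.ne_top ((Ideal.eq_top_iff_one _).mpr h)
  · exact h

theorem exists_lift_of_mem {Y Z : Scheme.{u}} {K : Type u} [Field K]
    (g : Spec (.of K) ⟶ Z) (f : Y ⟶ Z) [IsOpenImmersion f] {x : Spec (.of K)}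
    (h : g x ∈ Set.range f) : ∃ g' : Spec (.of K) ⟶ Y, g' ≫ f = g :=
  exists_lift_of_closedPoint g f (by rwa [Subsingleton.elim (closedPt K) x])

/-- A point of a chart with a single index with values in the fraction field of a local ring `R`
extends to `R` as soon as the ratio has values in `R` and the point below extends. -/
theorem exists_lift_of_ratio_mem [IsLocalRing R] (c : Chart j D) (i : Bool)
    {i₂ : Spec (.of R) ⟶ X} (hi₂ : i₂ (closedPt R) ∈ c.V)
    (γ : (c.single i).ring →+* K)
    (h : Spec.map (CommRingCat.ofHom γ) ≫ (c.single i).toX = genericPt R K ≫ i₂)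
    (hτ : γ (c.τs i) ∈ (algebraMap R K).range) :
    ∃ l : Spec (.of R) ⟶ total j D,
      genericPt R K ≫ l = Spec.map (CommRingCat.ofHom γ) ≫ (c.single i).ι ∧
      l ≫ toBase j D = i₂ := by
  have := c.isAffineOpen.isOpenImmersion_fromSpec
  obtain ⟨δ, hδ⟩ := exists_lift_of_closedPoint i₂ c.isAffineOpen.fromSpec
    (by rwa [c.isAffineOpen.range_fromSpec])
  obtain ⟨d, rfl⟩ := Spec.map_surjective δ
  have e₁ : CommRingCat.ofHom (c.single i).toRing ≫ CommRingCat.ofHom γ =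
      d ≫ CommRingCat.ofHom (algebraMap R K) := by
    apply Spec.map_injective
    rw [Spec.map_comp, Spec.map_comp, ← cancel_mono c.isAffineOpen.fromSpec, Category.assoc,
      Category.assoc, hδ, ← h]
    rfl
  have e₂ : ∀ x, γ ((c.single i).toRing x) = algebraMap R K (d.hom x) := fun x => congr($e₁ x)
  have hγ : ∀ x, γ x ∈ (algebraMap R K).range :=
    map_mem_of_single c i γ _ (fun x => ⟨d.hom x, (e₂ x).symm⟩) hτ
  choose γ' hγ' using hγ
  let γR : (c.single i).ring →+* R :=
    { toFun := γ'
      map_one' := IsFractionRing.injective R K (by rw [hγ', map_one, map_one])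
      map_mul' := fun a b => IsFractionRing.injective R K (by
        rw [hγ', map_mul, map_mul, hγ', hγ'])
      map_zero' := IsFractionRing.injective R K (by rw [hγ', map_zero, map_zero])
      map_add' := fun a b => IsFractionRing.injective R K (by
        rw [hγ', map_add, map_add, hγ', hγ']) }
  have e₃ : genericPt R K ≫ Spec.map (CommRingCat.ofHom γR) = Spec.map (CommRingCat.ofHom γ) := by
    rw [← Spec.map_comp, ← CommRingCat.ofHom_comp]
    congr 2
    ext x
    exact hγ' x
  refine ⟨Spec.map (CommRingCat.ofHom γR) ≫ (c.single i).ι, by rw [reassoc_of% e₃], ?_⟩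
  rw [Category.assoc, ι_toBase, ← hδ]
  change Spec.map _ ≫ Spec.map (CommRingCat.ofHom (c.single i).toRing) ≫ c.isAffineOpen.fromSpec = _
  rw [← Category.assoc, ← Spec.map_comp]
  congr 2
  ext x
  apply IsFractionRing.injective R K
  exact (hγ' _).trans (e₂ x)

/-- A `K`-point of the blow-up above an `R`-point of the base extends: of the two ratios of the
generators, which are inverse to each other, one lies in the valuation ring `R`. -/
theorem existence_toBase (hD : ∀ x : X, ∃ c : Chart j D, x ∈ c.V) :
    ValuativeCriterion.Existence (toBase j D) := by
  rintro ⟨R, K, i₁, i₂, ⟨hsq⟩⟩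
  obtain ⟨c, hc⟩ := hD (i₂ (closedPt R))
  let x₀ : Spec (.of K) := closedPt K
  have hx₀ : toBase j D (i₁ x₀) ∈ c.V := by
    rw [← Scheme.Hom.comp_apply, hsq, Scheme.Hom.comp_apply]
    exact ((specializes_closedPt _).map i₂.continuous).mem_open c.V.2 hc
  suffices ∃ l : Spec (.of R) ⟶ total j D, genericPt R K ≫ l = i₁ ∧ l ≫ toBase j D = i₂ by
    obtain ⟨l, h₁, h₂⟩ := this
    exact ⟨⟨⟨l, h₁, h₂⟩⟩⟩
  obtain ⟨i, hi⟩ := exists_mem_range_ι c _ hx₀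
  obtain ⟨g, rfl⟩ := exists_lift_of_mem i₁ (c.single i).ι hi
  obtain ⟨γ', rfl⟩ := Spec.map_surjective g
  obtain ⟨γ, rfl⟩ : ∃ γ : (c.single i).ring →+* K, γ' = CommRingCat.ofHom γ := ⟨γ'.hom, rfl⟩
  rw [Category.assoc, ι_toBase] at hsq
  by_cases hτ : γ (c.τs i) ∈ (algebraMap R K).range
  · exact exists_lift_of_ratio_mem c i hc γ hsq hτ
  -- otherwise the point lies on the overlap of the two charts, and it extends on the other one
  · have hne : γ (c.τs i) ≠ 0 := fun h => hτ ⟨0, by rw [h, map_zero]⟩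
    have hmem : Spec.map (CommRingCat.ofHom γ) x₀ ∈ Set.range (Chart.map (c.both_le i)) := by
      rw [mem_range_map_both]
      intro h
      apply hne
      by_contra hne
      exact (mem_closedPt_asIdeal _).mp (show γ (c.τs i) ∈ x₀.asIdeal from h) (.mk0 _ hne)
    obtain ⟨g, hg⟩ := exists_lift_of_mem _ _ hmem
    obtain ⟨γ', rfl⟩ := Spec.map_surjective g
    obtain ⟨γu, rfl⟩ : ∃ γ : c.both.ring →+* K, γ' = CommRingCat.ofHom γ := ⟨γ'.hom, rfl⟩
    have e : γ = γu.comp (Chart.ringMap (c.both_le i)) := by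
      rw [Chart.map, ← Spec.map_comp] at hg
      have := Spec.map_injective hg
      ext x
      exact congr($this x).symm
    let γ₂ : (c.single !i).ring →+* K := γu.comp (Chart.ringMap (c.both_le !i))
    have hγ₂ : Spec.map (CommRingCat.ofHom γ₂) =
        Spec.map (CommRingCat.ofHom γu) ≫ Chart.map (c.both_le !i) := by
      rw [Chart.map, ← Spec.map_comp]
      rfl
    obtain ⟨l, h₁, h₂⟩ := exists_lift_of_ratio_mem (R := R) c (!i) hc γ₂ (by
      rw [hγ₂, Category.assoc, Chart.map_toX, ← hsq, ← hg, Category.assoc, Chart.map_toX]) (by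
      have h1 := congrArg γu (ringMap_τs_mul c i)
      rw [map_mul, map_one] at h1
      have h2 : γ (c.τs i) * γ₂ (c.τs !i) = 1 := by rw [e]; exact h1
      rw [eq_inv_of_mul_eq_one_right h2]
      rcases ValuationRing.isInteger_or_isInteger R (γ (c.τs i)) with h | h
      · exact (hτ h).elim
      · exact h)
    refine ⟨l, ?_, h₂⟩
    rw [h₁, hγ₂, ← hg, Category.assoc, Category.assoc, Chart.map_ι, Chart.map_ι]

/-- If a point of the overlap of the two charts above `c.V` specializes into each of them, in both
cases along the spectrum of `R`, then the specializations lie in the overlap as well. -/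
theorem closedPoint_mem_range_both [IsLocalRing R] (c : Chart j D) (i : Bool)
    {l₁ l₂ : Spec (.of R) ⟶ total j D}
    (h₁ : l₁ (closedPt R) ∈ Set.range (c.single i).ι)
    (h₂ : l₂ (closedPt R) ∈ Set.range (c.single !i).ι)
    (h : genericPt R K ≫ l₁ = genericPt R K ≫ l₂) :
    l₁ (closedPt R) ∈ Set.range c.both.ι := by
  obtain ⟨g₁, rfl⟩ := exists_lift_of_closedPoint l₁ _ h₁
  obtain ⟨g₂, rfl⟩ := exists_lift_of_closedPoint l₂ _ h₂
  obtain ⟨γ₁, rfl⟩ := Spec.map_surjective g₁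
  obtain ⟨γ₂, rfl⟩ := Spec.map_surjective g₂
  let x₀ : Spec (.of K) := closedPt K
  have hx : (genericPt R K ≫ Spec.map γ₁ ≫ (c.single i).ι) x₀ ∈ Set.range c.both.ι := by
    have hx₂ : (c.single i).ι ((genericPt R K ≫ Spec.map γ₁) x₀) ∈ Set.range (c.single !i).ι := by
      rw [← Scheme.Hom.comp_apply, Category.assoc, h]
      exact ⟨(genericPt R K ≫ Spec.map γ₂) x₀, by rw [← Scheme.Hom.comp_apply, Category.assoc]⟩
    obtain ⟨l, hl, hl', hm⟩ := (ι_mem_range_iff _).mp hx₂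
    rw [← Category.assoc, Scheme.Hom.comp_apply, ι_mem_range_iff]
    refine ⟨l, hl, ⟨hl.1, fun m _ => ?_⟩, hm⟩
    rcases Bool.eq_or_eq_not m i with rfl | rfl
    · exact hl.2 (Finset.mem_singleton_self _)
    · exact hl'.2 (Finset.mem_singleton_self _)
  obtain ⟨g, hg⟩ := exists_lift_of_mem _ _ hx
  obtain ⟨γ, rfl⟩ := Spec.map_surjective g
  have key : ∀ (m : Bool) (γm : CommRingCat.of (c.single m).ring ⟶ .of R),
      Spec.map γ ≫ c.both.ι = genericPt R K ≫ Spec.map γm ≫ (c.single m).ι →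
      ∀ x, algebraMap R K (γm x) = γ (Chart.ringMap (c.both_le m) x) := by
    intro m γm hm x
    rw [← Chart.map_ι (c.both_le m), ← Category.assoc, ← Category.assoc, cancel_mono, Chart.map,
      ← Spec.map_comp, ← Spec.map_comp] at hm
    exact congr($(Spec.map_injective hm) x).symm
  have hu : IsUnit (γ₁ (c.τs i)) := by
    refine .of_mul_eq_one (γ₂ (c.τs !i)) (IsFractionRing.injective R K ?_)
    rw [map_mul, key i γ₁ hg, key (!i) γ₂ (hg.trans h), ← map_mul, ringMap_τs_mul, map_one, map_one]
  have hm : Spec.map γ₁ (closedPt R) ∈ Set.range (Chart.map (c.both_le i)) := by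
    rw [mem_range_map_both]
    intro h
    exact (mem_closedPt_asIdeal _).mp (show γ₁ (c.τs i) ∈ (closedPt R).asIdeal from h) hu
  obtain ⟨y, hy⟩ := hm
  exact ⟨y, by rw [Scheme.Hom.comp_apply, ← hy, ← Scheme.Hom.comp_apply, Chart.map_ι]⟩

theorem uniqueness_toBase (hD : ∀ x : X, ∃ c : Chart j D, x ∈ c.V) :
    ValuativeCriterion.Uniqueness (toBase j D) := by
  rintro ⟨R, K, i₁, i₂, hsq⟩
  constructor
  rintro ⟨l₁, h₁, h₁'⟩ ⟨l₂, h₂, h₂'⟩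
  ext1
  have h : genericPt R K ≫ l₁ = genericPt R K ≫ l₂ := h₁.trans h₂.symm
  dsimp only at l₁ l₂ h₁' h₂' ⊢
  obtain ⟨c, hc⟩ := hD (i₂ (closedPt R))
  obtain ⟨i, hi⟩ := exists_mem_range_ι c (l₁ (closedPt R)) (by
    rwa [← Scheme.Hom.comp_apply, h₁'])
  obtain ⟨i', hi'⟩ := exists_mem_range_ι c (l₂ (closedPt R)) (by
    rwa [← Scheme.Hom.comp_apply, h₂'])
  rcases Bool.eq_or_eq_not i' i with rfl | rfl
  · exact eq_of_closedPoint_mem (K := K) _ hi hi' h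
  · exact eq_of_closedPoint_mem (K := K) (c.single !i)
      (range_ι_mono (c.both_le !i) (closedPoint_mem_range_both (K := K) c i hi hi' h)) hi' h

theorem isProper_toBase [IsLocallyNoetherian X] (hD : ∀ x : X, ∃ c : Chart j D, x ∈ c.V) :
    IsProper (toBase j D) := by
  have := quasiCompact_toBase hD
  have : LocallyOfFiniteType (toBase j D) := locallyOfFiniteType_toBase
  have : IsLocallyNoetherian (total j D) := LocallyOfFiniteType.isLocallyNoetherian (toBase j D)
  refine IsProper.of_valuativeCriterion _ ?_
  rw [ValuativeCriterion.eq]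
  exact ⟨existence_toBase hD, uniqueness_toBase hD⟩

end
end BlowUp
end MPair

/-! ### The blow-up above the complement of the two ideals -/

namespace MPair

theorem isIso_morphismRestrict_of_cover {B X : Scheme.{u}} (β : B ⟶ X) (W : X.Opens)
    (h : ∀ x ∈ W, ∃ V ≤ W, x ∈ V ∧ IsIso (β ∣_ V)) : IsIso (β ∣_ W) := by
  have h' : ∀ x : W, ∃ V ≤ W, x.1 ∈ V ∧ IsIso (β ∣_ V) := fun x => h x.1 x.2
  choose V hV hxV hiso using h'
  refine IsZariskiLocalAtTarget.of_iSup_eq_top (P := MorphismProperty.isomorphisms Scheme)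
    (fun x : W => W.ι ⁻¹ᵁ V x) ?_ fun x => ?_
  · rw [eq_top_iff]
    exact fun x _ => TopologicalSpace.Opens.mem_iSup.mpr ⟨x, hxV x⟩
  · refine ((MorphismProperty.isomorphisms Scheme).arrow_mk_iso_iff
      (morphismRestrictRestrict β W _)).mpr ?_
    have : W.ι ''ᵁ W.ι ⁻¹ᵁ V x = V x := by
      rw [Scheme.Hom.image_preimage_eq_opensRange_inf, Scheme.Opens.opensRange_ι]
      exact inf_eq_right.mpr (hV x)
    have key : ∀ V' : X.Opens, V' = V x → IsIso (β ∣_ V') := by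
      rintro _ rfl
      exact hiso x
    exact key _ this

namespace BlowUp
variable {U X : Scheme.{u}} {j : U ⟶ X} {D : Bool → X.IdealSheafData} [IsOpenImmersion j]

theorem bijective_app {V : X.Opens} (hV : V ≤ j.opensRange) : Function.Bijective (j.app V).hom := by
  have : IsIso (j.app V) := j.isIso_app V hV
  exact ConcreteCategory.bijective_of_isIso (j.app V)

theorem isUnit_toRing_gen (c : Chart j D) (hc : c.V ≤ j.opensRange) (i : Bool) :
    IsUnit (c.toRing (c.gen i)) := by
  obtain ⟨b, hb⟩ := (c.isUnit_gen i).exists_right_inv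
  obtain ⟨a, rfl⟩ := (bijective_app hc).2 b
  exact .of_mul_eq_one (c.toRing a) (Subtype.ext hb)

theorem bijective_toRing (c : Chart j D) (hc : c.V ≤ j.opensRange) :
    Function.Bijective c.toRing := by
  refine ⟨fun a b h => (bijective_app hc).1 (congrArg Subtype.val h), fun y => ?_⟩
  obtain ⟨a, ha⟩ := (bijective_app hc).2 y.1
  exact ⟨a, Subtype.ext ha⟩

variable [IsNoetherian U]

/-- Above `U` both ratios are invertible, so that the two charts coincide. -/
theorem mem_range_ι_single (c : Chart j D) (hc : c.V ≤ j.opensRange) {x : total j D}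
    (hx : toBase j D x ∈ c.V) (i : Bool) : x ∈ Set.range (c.single i).ι := by
  obtain ⟨m, hm⟩ := exists_mem_range_ι c x hx
  obtain ⟨y, rfl⟩ := hm
  refine range_ι_mono (c.both_le i) ?_
  obtain ⟨z, rfl⟩ := (mem_range_map_both c m y).mpr (fun h => y.2.ne_top
    (Ideal.eq_top_of_isUnit_mem _ h (isUnit_of_mul_isUnit_left (y := (c.single m).toRing (c.gen m))
      (by
        have := toRing_ratio (c.single m) (Finset.mem_singleton_self m) (!m)
        exact this ▸ isUnit_toRing_gen (c.single m) hc (!m)))))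
  rw [← Scheme.Hom.comp_apply, Chart.map_ι]
  exact ⟨z, rfl⟩

theorem isIso_toBase_restrict_chart (c : Chart j D) (hc : c.V ≤ j.opensRange) :
    IsIso (toBase j D ∣_ c.V) := by
  let d := c.single true
  have hrange : Set.range d.ι ⊆ Set.range (toBase j D ⁻¹ᵁ c.V).ι := by
    rw [Scheme.Opens.range_ι]
    rintro _ ⟨y, rfl⟩
    change toBase j D (d.ι y) ∈ c.V
    rw [← Scheme.Hom.comp_apply, ι_toBase]
    exact d.toX_mem y
  let e := IsOpenImmersion.lift (toBase j D ⁻¹ᵁ c.V).ι d.ι hrange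
  have he : e ≫ (toBase j D ⁻¹ᵁ c.V).ι = d.ι := IsOpenImmersion.lift_fac _ _ _
  have : IsOpenImmersion e := by
    have : IsOpenImmersion (e ≫ (toBase j D ⁻¹ᵁ c.V).ι) := by rw [he]; infer_instance
    exact .of_comp e (toBase j D ⁻¹ᵁ c.V).ι
  have : Surjective e := ⟨fun x => by
    obtain ⟨y, hy⟩ := mem_range_ι_single c hc x.2 true
    refine ⟨y, (toBase j D ⁻¹ᵁ c.V).ι.isOpenEmbedding.injective ?_⟩
    rw [← Scheme.Hom.comp_apply, he]
    exact hy⟩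
  have : IsIso e := (isIso_iff_isOpenImmersion_and_surjective e).mpr ⟨inferInstance, inferInstance⟩
  have h1 : IsIso (CommRingCat.ofHom d.toRing) :=
    (ConcreteCategory.isIso_iff_bijective _).mpr (bijective_toRing d hc)
  have h2 : e ≫ toBase j D ∣_ c.V =
      Spec.map (CommRingCat.ofHom d.toRing) ≫ c.isAffineOpen.isoSpec.inv := by
    rw [← cancel_mono c.V.ι, Category.assoc, morphismRestrict_ι, reassoc_of% he, ι_toBase,
      Category.assoc, IsAffineOpen.isoSpec_inv_ι]
    rfl
  have : IsIso (e ≫ toBase j D ∣_ c.V) := by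
    rw [h2]
    infer_instance
  exact IsIso.of_isIso_comp_left e _

theorem isIso_toBase_restrict (hD : ∀ x : X, ∃ c : Chart j D, x ∈ c.V) :
    IsIso (toBase j D ∣_ j.opensRange) := by
  refine isIso_morphismRestrict_of_cover _ _ fun x hx => ?_
  obtain ⟨c, hc⟩ := hD x
  obtain ⟨f, hf, hxf⟩ := c.isAffineOpen.exists_basicOpen_le (V := j.opensRange) ⟨x, hx⟩ hc
  exact ⟨_, hf, hxf, isIso_toBase_restrict_chart (c.restrict _ (c.isAffineOpen.basicOpen f)
    (X.basicOpen_le f) c.s c.nonempty) hf⟩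

end BlowUp

/-- The blow-up of a Noetherian scheme `X` in the ideal generated by two locally principal ideals
`D i`, which is an isomorphism over an open subscheme `U` disjoint from the supports, and on which
the intersection of the pull-backs of the two ideals is a Cartier divisor, locally equal to one of
the two. -/
theorem exists_blowUp {U X : Scheme.{u}} [IsNoetherian X] (j : U ⟶ X) [IsOpenImmersion j]
    (D : Bool → X.IdealSheafData) (hD : ∀ x : X, ∃ V : X.affineOpens, x ∈ V.1 ∧ ∀ i, ∃ a,
      (D i).ideal V = Ideal.span {a}) (hj : ∀ i x, j x ∉ (D i).support) :
    ∃ (B : Scheme.{u}) (π : B ⟶ X) (jB : U ⟶ B) (_ : IsOpenImmersion jB), IsProper π ∧ jB ≫ π = j ∧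
      jB.opensRange = π ⁻¹ᵁ j.opensRange ∧
      IsEffectiveCartier ((D true).comap π ⊓ (D false).comap π) ∧
      ∀ (T : Type u) [CommRing T] [IsLocalRing T] (g : Spec (.of T) ⟶ B),
        ∃ i, (D i).comap (g ≫ π) ≤ ((D true).comap π ⊓ (D false).comap π).comap g := by
  have : CompactSpace U := by
    have := TopologicalSpace.NoetherianSpace.isCompact (Set.range j)
    rw [← Set.image_univ] at this
    exact ⟨j.isOpenEmbedding.isInducing.isCompact_iff.mpr this⟩
  have : IsLocallyNoetherian U := isLocallyNoetherian_of_isOpenImmersion j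
  have : IsNoetherian U := {}
  have hc : ∀ x : X, ∃ c : BlowUp.Chart j D, x ∈ c.V := BlowUp.exists_chart hD hj
  have := BlowUp.isIso_toBase_restrict hc
  let π := BlowUp.toBase j D
  let jB : U ⟶ BlowUp.total j D :=
    (j.isoOpensRange.hom ≫ inv (π ∣_ j.opensRange)) ≫ (π ⁻¹ᵁ j.opensRange).ι
  have : IsOpenImmersion jB := by
    have : IsIso (π ∣_ j.opensRange) := this
    exact inferInstanceAs (IsOpenImmersion (_ ≫ _))
  refine ⟨_, π, jB, this, BlowUp.isProper_toBase hc, ?_, ?_,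
    BlowUp.isEffectiveCartier_infIdeal hD hj,
    fun T _ _ g => BlowUp.exists_comap_le_infIdeal_comap hD hj g⟩
  · simp only [jB, Category.assoc]
    rw [← morphismRestrict_ι, IsIso.inv_hom_id_assoc, Scheme.Hom.isoOpensRange_hom_ι]
  · exact (Scheme.Hom.opensRange_comp_of_isIso _ _).trans (Scheme.Opens.opensRange_ι _)

end MPair

/-! ### Fibre products of proper modulus pairs -/

namespace MPair

theorem complOpens_comap {X Y : Scheme.{u}} (f : X ⟶ Y) (I : Y.IdealSheafData) :
    complOpens (I.comap f) = f ⁻¹ᵁ complOpens I := by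
  ext x
  change x ∉ ((I.comap f).support : Set X) ↔ f x ∉ (I.support : Set Y)
  rw [Scheme.IdealSheafData.support_comap]
  rfl

theorem complOpens_inf {X : Scheme.{u}} (I J : X.IdealSheafData) :
    complOpens (I ⊓ J) = complOpens I ⊓ complOpens J := by
  have h : (I ⊓ J).support = I.support ⊔ J.support := by
    apply le_antisymm
    · rw [← Scheme.IdealSheafData.support_mul]
      exact Scheme.IdealSheafData.support_antitone (le_inf
        (fun U => Ideal.mul_le_left) (fun U => Ideal.mul_le_right))
    · exact sup_le (Scheme.IdealSheafData.support_antitone inf_le_left)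
        (Scheme.IdealSheafData.support_antitone inf_le_right)
  ext x
  change x ∉ ((I ⊓ J).support : Set X) ↔ x ∉ (I.support : Set X) ∧ x ∉ (J.support : Set X)
  rw [h, TopologicalSpace.Closeds.coe_sup, Set.mem_union, not_or]

/-- If `f` is a closed immersion into an open subscheme, then the scheme-theoretic image of `f`
meets the open subscheme in the source of `f`. -/
theorem opensRange_toImage {Y W Z : Scheme.{u}} (c : Y ⟶ W) (o : W ⟶ Z) [IsClosedImmersion c]
    [IsOpenImmersion o] [QuasiCompact (c ≫ o)] :
    (c ≫ o).toImage.opensRange = (c ≫ o).imageι ⁻¹ᵁ o.opensRange := by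
  ext x
  constructor
  · rintro ⟨y, rfl⟩
    change (c ≫ o).imageι ((c ≫ o).toImage y) ∈ Set.range o
    rw [← Scheme.Hom.comp_apply, Scheme.Hom.toImage_imageι]
    exact ⟨c y, rfl⟩
  · rintro ⟨w, hw⟩
    have h1 : (c ≫ o).imageι x ∈ closure (Set.range (c ≫ o)) := by
      have := Set.mem_range_self (f := (c ≫ o).imageι) x
      rwa [Scheme.IdealSheafData.range_subschemeι, Scheme.Hom.support_ker] at this
    rw [← hw, ← Set.mem_preimage,
      o.isOpenEmbedding.isOpenMap.preimage_closure_eq_closure_preimage o.continuous] at h1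
    have h2 : o ⁻¹' Set.range (c ≫ o) = Set.range c := by
      ext w
      constructor
      · rintro ⟨y, hy⟩
        exact ⟨y, o.isOpenEmbedding.injective hy⟩
      · rintro ⟨y, rfl⟩
        exact ⟨y, rfl⟩
    rw [h2, c.isClosedEmbedding.isClosed_range.closure_eq] at h1
    obtain ⟨y, hy⟩ := h1
    refine ⟨y, (c ≫ o).imageι.isEmbedding.injective ?_⟩
    rw [← Scheme.Hom.comp_apply, Scheme.Hom.toImage_imageι, ← hw, ← hy]
    rfl

namespace ModulusPair
variable {k : Type u} [Field k]

theorem smooth_of_opensRange {Z U : Over (Spec (CommRingCat.of k))} (j : U ⟶ Z)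
    [IsOpenImmersion j.left] [Smooth U.hom] {I : Z.left.IdealSheafData}
    (hI : complOpens I = j.left.opensRange) : Smooth ((complOpens I).ι ≫ Z.hom) := by
  rw [hI]
  have : j.left.opensRange.ι ≫ Z.hom = j.left.isoOpensRange.inv ≫ U.hom := by
    rw [Iso.eq_inv_comp, Scheme.Hom.isoOpensRange_hom_ι_assoc, Over.w]
  rw [this]
  infer_instance

/-- The modulus pair with ambient space `Z` and interior an open subscheme `U`. -/
def ofOpen {Z U : Over (Spec (CommRingCat.of k))} (h₁ : IsSeparated Z.hom)
    (h₂ : LocallyOfFiniteType Z.hom) (h₃ : QuasiCompact Z.hom) (j : U ⟶ Z) [IsOpenImmersion j.left]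
    [Smooth U.hom] (I : Z.left.IdealSheafData) (hI : IsEffectiveCartier I)
    (hI' : complOpens I = j.left.opensRange) : ModulusPair k where
  ambient := Z
  isSeparated := h₁
  locallyOfFiniteType := h₂
  quasiCompact := h₃
  divisor := I
  cartier := hI
  smooth := smooth_of_opensRange j hI'

theorem exists_iso_interior (M : ModulusPair k) {U : Over (Spec (CommRingCat.of k))}
    (j : U ⟶ M.ambient) [IsOpenImmersion j.left]
    (hI : complOpens M.divisor = j.left.opensRange) :
    ∃ e : U ≅ M.interior, e.hom ≫ M.incl = j := by
  have hr : Set.range j.left = Set.range M.incl.left := by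
    change _ = Set.range (complOpens M.divisor).ι
    rw [Scheme.Opens.range_ι, hI]
    rfl
  let e := IsOpenImmersion.isoOfRangeEq j.left M.incl.left hr
  have he : e.hom ≫ M.incl.left = j.left := IsOpenImmersion.isoOfRangeEq_hom_fac _ _ _
  refine ⟨Over.isoMk e (by rw [← Over.w M.incl, reassoc_of% he, Over.w]), ?_⟩
  ext1
  exact he

/-- For the modulus of `P`, along any morphism from the spectrum of a valuation ring which maps the
generic point to the interior, to be at most the maximum of the pull-backs of the moduli of `M`
and `N`. -/
def IsMaxModulus {P M N : ModulusPair k} (p : P.interior ⟶ M.interior)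
    (q : P.interior ⟶ N.interior) : Prop :=
  ∀ (R K : Type u) [CommRing R] [IsDomain R] [ValuationRing R] [Field K] [Algebra R K]
    [IsFractionRing R K] (x : Spec (.of K) ⟶ P.interior.left) (y : Spec (.of R) ⟶ P.ambient.left)
    (a : Spec (.of R) ⟶ M.ambient.left) (b : Spec (.of R) ⟶ N.ambient.left),
    genericPt R K ≫ y = x ≫ P.incl.left →
    genericPt R K ≫ a = x ≫ p.left ≫ M.incl.left →
    genericPt R K ≫ b = x ≫ q.left ≫ N.incl.left →
    M.divisor.comap a ≤ P.divisor.comap y ∨ N.divisor.comap b ≤ P.divisor.comap y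

theorem isPullback_of_isMaxModulus {P M N L : ModulusPair k} (hP : IsProper P.ambient.hom)
    (hM : IsProper M.ambient.hom) (hN : IsProper N.ambient.hom) {p : P ⟶ M} {q : P ⟶ N}
    {f : M ⟶ L} {g : N ⟶ L}
    (h : IsPullback (Hom.interior p) (Hom.interior q) (Hom.interior f) (Hom.interior g))
    (hmax : IsMaxModulus (Hom.interior p) (Hom.interior q)) : IsPullback p q f g := by
  have hv : ∀ {T : ModulusPair k} (s : T ⟶ M) (t : T ⟶ N) (u : T.interior ⟶ P.interior),
      u ≫ Hom.interior p = Hom.interior s → u ≫ Hom.interior q = Hom.interior t →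
      ValuativeLE u := by
    intro T s t u hs ht R K _ _ _ _ _ _ x y z hy hz
    obtain ⟨a, ha⟩ := exists_map hM (Hom.interior s) hy
    obtain ⟨b, hb⟩ := exists_map hN (Hom.interior t) hy
    rcases hmax R K (x ≫ u.left) z a b (by rw [hz, Category.assoc])
      (by rw [ha, ← hs, Over.comp_left, Category.assoc, Category.assoc])
      (by rw [hb, ← ht, Over.comp_left, Category.assoc, Category.assoc]) with h | h
    · exact (valuativeLE_of_hom s R K x y a hy ha).trans h
    · exact (valuativeLE_of_hom t R K x y b hy hb).trans h
  refine ⟨⟨by ext1; exact h.w⟩, ⟨PullbackCone.IsLimit.mk _ (fun s => homOfProper hP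
    (h.lift (Hom.interior s.fst) (Hom.interior s.snd) congr(Hom.interior $s.condition))
    (hv s.fst s.snd _ (h.lift_fst _ _ _) (h.lift_snd _ _ _))) ?_ ?_ ?_⟩⟩
  · intro s
    ext1
    exact h.lift_fst _ _ _
  · intro s
    ext1
    exact h.lift_snd _ _ _
  · intro s m h1 h2
    ext1
    apply h.hom_ext
    · rw [← interior_comp, h1]
      exact (h.lift_fst _ _ _).symm
    · rw [← interior_comp, h2]
      exact (h.lift_snd _ _ _).symm

theorem isPullback_over_of_left {S : Scheme.{u}} {A B C D : Over S} {a : A ⟶ B} {b : A ⟶ C}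
    {c : B ⟶ D} {d : C ⟶ D} (h : IsPullback a.left b.left c.left d.left) : IsPullback a b c d :=
  IsPullback.of_map (Over.forget S) (by ext1; exact h.w) h

theorem exists_local_generator (M : ModulusPair k) (x : M.ambient.left) :
    ∃ V : M.ambient.left.affineOpens, x ∈ V.1 ∧ ∃ a, M.divisor.ideal V = Ideal.span {a} := by
  obtain ⟨V, hx, a, -, ha⟩ := M.cartier x
  exact ⟨V, hx, a, ha⟩

end ModulusPair

theorem exists_principal_comap {X Y Z : Scheme.{u}} (f : X ⟶ Y) (g : X ⟶ Z) {I : Y.IdealSheafData}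
    {J : Z.IdealSheafData} {x : X}
    (hI : ∃ V : Y.affineOpens, f x ∈ V.1 ∧ ∃ a, I.ideal V = Ideal.span {a})
    (hJ : ∃ V : Z.affineOpens, g x ∈ V.1 ∧ ∃ a, J.ideal V = Ideal.span {a}) :
    ∃ V : X.affineOpens, x ∈ V.1 ∧ (∃ a, (I.comap f).ideal V = Ideal.span {a}) ∧
      ∃ b, (J.comap g).ideal V = Ideal.span {b} := by
  obtain ⟨V, hV, a, ha⟩ := hI
  obtain ⟨W, hW, b, hb⟩ := hJ
  obtain ⟨_, ⟨O, hO, rfl⟩, hxO, hle⟩ := X.isBasis_affineOpens.exists_subset_of_mem_open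
    (show x ∈ f ⁻¹ᵁ V.1 ⊓ g ⁻¹ᵁ W.1 from ⟨hV, hW⟩) (f ⁻¹ᵁ V.1 ⊓ g ⁻¹ᵁ W.1).2
  refine ⟨⟨O, hO⟩, hxO, ⟨f.appLE V.1 O (hle.trans inf_le_left) a, ?_⟩,
    ⟨g.appLE W.1 O (hle.trans inf_le_right) b, ?_⟩⟩
  · rw [ideal_comap_eq_map f I V ⟨O, hO⟩ (hle.trans inf_le_left), ha, Ideal.map_span,
      Set.image_singleton]
  · rw [ideal_comap_eq_map g J W ⟨O, hO⟩ (hle.trans inf_le_right), hb, Ideal.map_span,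
      Set.image_singleton]

end MPair

namespace MPair

/-- The fibre product over `L` is closed in the fibre product over `S` if `L` is separated over `S`. -/
theorem isClosedImmersion_of_isPullback {U X Y L S : Scheme.{u}} {a : U ⟶ X} {b : U ⟶ Y}
    {f : X ⟶ L} {g : Y ⟶ L} (h : IsPullback a b f g) (i : L ⟶ S) [IsSeparated i] {m : X ⟶ S}
    {n : Y ⟶ S} (hm : f ≫ i = m) (hn : g ≫ i = n) (c : U ⟶ pullback m n)
    (ha : c ≫ pullback.fst _ _ = a) (hb : c ≫ pullback.snd _ _ = b) : IsClosedImmersion c := by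
  subst hm hn
  have : c = h.isoPullback.hom ≫ pullback.mapDesc f g i := by
    apply pullback.hom_ext
    · rw [ha, Category.assoc, pullback.mapDesc, pullback.lift_fst]
      simp
    · rw [hb, Category.assoc, pullback.mapDesc, pullback.lift_snd]
      simp
  rw [this]
  infer_instance

namespace ModulusPair
variable {k : Type u} [Field k]

/-- The modulus pair `ofOpen`, with its ambient space and its interior up to isomorphism. -/
theorem exists_ofOpen {Z U : Over (Spec (CommRingCat.of k))} (h₁ : IsSeparated Z.hom)
    (h₂ : LocallyOfFiniteType Z.hom) (h₃ : QuasiCompact Z.hom) (j : U ⟶ Z) [IsOpenImmersion j.left]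
    [Smooth U.hom] (I : Z.left.IdealSheafData) (hI : IsEffectiveCartier I)
    (hI' : complOpens I = j.left.opensRange) :
    ∃ (P : ModulusPair k) (e : U ≅ P.interior) (φ : P.ambient ≅ Z),
      P.incl ≫ φ.hom = e.inv ≫ j ∧ P.divisor = I.comap φ.hom.left := by
  obtain ⟨e, he⟩ := @exists_iso_interior k _ (ofOpen h₁ h₂ h₃ j I hI hI') U j ‹_› hI'
  refine ⟨ofOpen h₁ h₂ h₃ j I hI hI', e, Iso.refl _, ?_, (Scheme.IdealSheafData.comap_id I).symm⟩
  rw [Iso.eq_inv_comp]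
  exact (Category.comp_id (e.hom ≫ incl _)).trans he

/-- The fibre product of the interiors is dense and open in a scheme proper over the ambient
spaces, in which its complement is the union of the two boundaries. -/
theorem exists_compactification_pullback {M N L : ModulusPair k} (hM : IsProper M.ambient.hom)
    (hN : IsProper N.ambient.hom) (f : M ⟶ L) (g : N ⟶ L) (hf : Etale (Hom.interior f).left) :
    ∃ (U X : Over (Spec (CommRingCat.of k))) (a : U ⟶ M.interior) (b : U ⟶ N.interior)
      (x₁ : X ⟶ M.ambient) (x₂ : X ⟶ N.ambient) (j : U ⟶ X) (_ : IsOpenImmersion j.left),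
      IsPullback a b (Hom.interior f) (Hom.interior g) ∧ Smooth U.hom ∧ IsProper X.hom ∧
      IsNoetherian X.left ∧ j ≫ x₁ = a ≫ M.incl ∧ j ≫ x₂ = b ≫ N.incl ∧
      j.left.opensRange = complOpens (M.divisor.comap x₁.left ⊓ N.divisor.comap x₂.left) := by
  obtain ⟨U, a, b, hU⟩ : ∃ (U : Over (Spec (CommRingCat.of k))) (a : U ⟶ M.interior)
      (b : U ⟶ N.interior), IsPullback a.left b.left (Hom.interior f).left
        (Hom.interior g).left := by
    let U : Over (Spec (CommRingCat.of k)) := Over.mk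
      (pullback.snd (Hom.interior f).left (Hom.interior g).left ≫ N.interior.hom)
    refine ⟨U, Over.homMk (pullback.fst _ _) ?_, Over.homMk (pullback.snd _ _) rfl,
      IsPullback.of_hasPullback _ _⟩
    change _ = pullback.snd (Hom.interior f).left (Hom.interior g).left ≫ N.interior.hom
    rw [← Over.w (Hom.interior g), ← pullback.condition_assoc, Over.w]
  have hUN : Smooth U.hom := by
    have : Etale b.left := MorphismProperty.of_isPullback hU hf
    have : Smooth N.interior.hom := N.smooth
    rw [← Over.w b]
    infer_instance
  obtain ⟨c, hc1, hc2⟩ : ∃ c : U.left ⟶ pullback M.interior.hom N.interior.hom,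
      c ≫ pullback.fst _ _ = a.left ∧ c ≫ pullback.snd _ _ = b.left :=
    ⟨pullback.lift a.left b.left (by rw [Over.w, Over.w]), pullback.lift_fst _ _ _,
      pullback.lift_snd _ _ _⟩
  have hc : IsClosedImmersion c := isClosedImmersion_of_isPullback hU L.interior.hom
    (Over.w _) (Over.w _) c hc1 hc2
  let o : pullback M.interior.hom N.interior.hom ⟶ pullback M.ambient.hom N.ambient.hom :=
    pullback.map _ _ _ _ M.incl.left N.incl.left (𝟙 _) (by simp) (by simp)
  have ho1 : o ≫ pullback.fst _ _ = pullback.fst _ _ ≫ M.incl.left := pullback.lift_fst _ _ _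
  have ho2 : o ≫ pullback.snd _ _ = pullback.snd _ _ ≫ N.incl.left := pullback.lift_snd _ _ _
  have hor : o.opensRange = pullback.fst M.ambient.hom N.ambient.hom ⁻¹ᵁ complOpens M.divisor ⊓
      pullback.snd M.ambient.hom N.ambient.hom ⁻¹ᵁ complOpens N.divisor := by
    apply TopologicalSpace.Opens.ext
    change Set.range o = _
    rw [Scheme.Pullback.range_map]
    have h1 : Set.range M.incl.left = complOpens M.divisor := Scheme.Opens.range_ι _
    have h2 : Set.range N.incl.left = complOpens N.divisor := Scheme.Opens.range_ι _
    rw [h1, h2]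
    rfl
  have hN' : IsNoetherian (pullback M.ambient.hom N.ambient.hom) :=
    have := LocallyOfFiniteType.isLocallyNoetherian (pullback.snd M.ambient.hom N.ambient.hom)
    have := QuasiCompact.compactSpace_of_compactSpace (pullback.snd M.ambient.hom N.ambient.hom)
    { }
  have hqc : QuasiCompact (c ≫ o) := inferInstance
  have hXN : IsNoetherian (c ≫ o).image :=
    have := LocallyOfFiniteType.isLocallyNoetherian (c ≫ o).imageι
    have := QuasiCompact.compactSpace_of_compactSpace (c ≫ o).imageι
    { }
  have hjo : IsOpenImmersion (c ≫ o).toImage := inferInstance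
  let x₁ : (c ≫ o).image ⟶ M.ambient.left := (c ≫ o).imageι ≫ pullback.fst _ _
  let x₂ : (c ≫ o).image ⟶ N.ambient.left := (c ≫ o).imageι ≫ pullback.snd _ _
  have hx₁ : (c ≫ o).toImage ≫ x₁ = a.left ≫ M.incl.left := by
    rw [Scheme.Hom.toImage_imageι_assoc, Category.assoc, ho1, reassoc_of% hc1]
  have hx₂ : (c ≫ o).toImage ≫ x₂ = b.left ≫ N.incl.left := by
    rw [Scheme.Hom.toImage_imageι_assoc, Category.assoc, ho2, reassoc_of% hc2]
  have hrange : (c ≫ o).toImage.opensRange =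
      complOpens (M.divisor.comap x₁ ⊓ N.divisor.comap x₂) := by
    rw [opensRange_toImage, hor, complOpens_inf, complOpens_comap, complOpens_comap]
    rfl
  have hxs : x₂ ≫ N.ambient.hom = x₁ ≫ M.ambient.hom := by
    simp only [x₁, x₂, Category.assoc, pullback.condition]
  have hX : IsProper (x₁ ≫ M.ambient.hom) := inferInstance
  exact ⟨U, Over.mk (x₁ ≫ M.ambient.hom), a, b, Over.homMk x₁, Over.homMk x₂ hxs,
    Over.homMk (c ≫ o).toImage (by
      change _ ≫ x₁ ≫ M.ambient.hom = _
      rw [reassoc_of% hx₁, Over.w, Over.w]),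
    hjo, isPullback_over_of_left hU, hUN, hX, hXN, by ext1; exact hx₁, by ext1; exact hx₂, hrange⟩

/-- The blow-up of `exists_blowUp`, for proper modulus pairs. -/
theorem exists_maxModulus {M N : ModulusPair k} {U X : Over (Spec (CommRingCat.of k))}
    (x₁ : X ⟶ M.ambient) (x₂ : X ⟶ N.ambient) (j : U ⟶ X) [IsOpenImmersion j.left] [Smooth U.hom]
    [IsProper X.hom] [IsNoetherian X.left] (hj : j.left.opensRange =
      complOpens (M.divisor.comap x₁.left ⊓ N.divisor.comap x₂.left)) :
    ∃ (P : ModulusPair k) (e : U ≅ P.interior) (y : P.ambient ⟶ X), IsProper P.ambient.hom ∧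
      P.incl ≫ y = e.inv ≫ j ∧
      P.divisor ≤ M.divisor.comap (y ≫ x₁).left ∧ P.divisor ≤ N.divisor.comap (y ≫ x₂).left ∧
      ∀ (T) [CommRing T] [IsLocalRing T] (g : Spec (.of T) ⟶ P.ambient.left),
        M.divisor.comap (g ≫ (y ≫ x₁).left) ≤ P.divisor.comap g ∨
        N.divisor.comap (g ≫ (y ≫ x₂).left) ≤ P.divisor.comap g := by
  obtain ⟨B, π, jB, hjB, hπ, hjπ, hBr, hcart, hloc⟩ := exists_blowUp j.left
    (fun i => if i then M.divisor.comap x₁.left else N.divisor.comap x₂.left) (by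
      intro x
      obtain ⟨V, hxV, h1, h2⟩ := exists_principal_comap x₁.left x₂.left
        (M.exists_local_generator (x₁.left x)) (N.exists_local_generator (x₂.left x))
      exact ⟨V, hxV, by rintro (_ | _) <;> assumption⟩) (by
      have hr : ∀ x, j.left x ∈
          complOpens (M.divisor.comap x₁.left ⊓ N.divisor.comap x₂.left) := by
        intro x
        rw [← hj]
        exact ⟨x, rfl⟩
      rw [complOpens_inf] at hr
      rintro (_ | _) x
      · exact (hr x).2
      · exact (hr x).1)
  simp only [if_true, Bool.false_eq_true, if_false] at hcart hloc
  let Z : Over (Spec (CommRingCat.of k)) := Over.mk (π ≫ X.hom)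
  have hZ : IsProper Z.hom := inferInstanceAs (IsProper (π ≫ X.hom))
  let j' : U ⟶ Z := Over.homMk jB (by
    change jB ≫ π ≫ X.hom = U.hom
    rw [reassoc_of% hjπ, Over.w])
  have hj' : IsOpenImmersion j'.left := hjB
  let p : Z ⟶ X := Over.homMk π
  have hpj : j' ≫ p = j := by
    ext1
    exact hjπ
  obtain ⟨P, e, φ, hφ, hP⟩ := exists_ofOpen (Z := Z) inferInstance inferInstance inferInstance j'
    ((M.divisor.comap x₁.left).comap π ⊓ (N.divisor.comap x₂.left).comap π) hcart (by
      change _ = jB.opensRange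
      rw [hBr, hj, complOpens_inf, complOpens_inf, complOpens_comap π, complOpens_comap π]
      rfl)
  refine ⟨P, e, φ.hom ≫ p, ?_, ?_, ?_, ?_, ?_⟩
  · rw [← Over.w φ.hom]
    have : IsIso φ.hom.left := inferInstanceAs (IsIso ((Over.forget _).map φ.hom))
    exact MorphismProperty.comp_mem @IsProper _ _ inferInstance hZ
  · rw [reassoc_of% hφ, hpj]
  · rw [hP, Category.assoc, Over.comp_left, Scheme.IdealSheafData.comap_comp]
    refine Scheme.IdealSheafData.comap_mono φ.hom.left (inf_le_left.trans ?_)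
    rw [Over.comp_left, Scheme.IdealSheafData.comap_comp]
    exact le_rfl
  · rw [hP, Category.assoc, Over.comp_left, Scheme.IdealSheafData.comap_comp]
    refine Scheme.IdealSheafData.comap_mono φ.hom.left (inf_le_right.trans ?_)
    rw [Over.comp_left, Scheme.IdealSheafData.comap_comp]
    exact le_rfl
  · intro T _ _ g
    have h1 := Scheme.IdealSheafData.comap_comp ((M.divisor.comap x₁.left).comap π ⊓
      (N.divisor.comap x₂.left).comap π) g φ.hom.left
    rw [hP, ← h1]
    obtain ⟨_ | _, h⟩ := hloc T (g ≫ φ.hom.left)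
    · right
      refine le_trans (le_of_eq ?_) h
      simp only [Bool.false_eq_true, if_false, ← Scheme.IdealSheafData.comap_comp]
      congr 1
    · left
      refine le_trans (le_of_eq ?_) h
      simp only [if_true, ← Scheme.IdealSheafData.comap_comp]
      congr 1

/-- The fibre product of proper modulus pairs along a morphism that is étale on the interiors: its
interior is the fibre product of the interiors, and its modulus is the maximum of the two pulled
back moduli, which is a Cartier divisor on a blow-up. -/
theorem exists_pullback {M N L : ModulusPair k} (hM : IsProper M.ambient.hom)
    (hN : IsProper N.ambient.hom) (f : M ⟶ L) (g : N ⟶ L) (hf : Etale (Hom.interior f).left) :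
    ∃ (P : ModulusPair k) (p : P ⟶ M) (q : P ⟶ N), IsProper P.ambient.hom ∧
      IsPullback (Hom.interior p) (Hom.interior q) (Hom.interior f) (Hom.interior g) ∧
      IsMaxModulus (Hom.interior p) (Hom.interior q) := by
  obtain ⟨U, X, a, b, x₁, x₂, j, hjo, hU, hUs, hX, hXN, hx₁, hx₂, hrange⟩ :=
    exists_compactification_pullback hM hN f g hf
  obtain ⟨P, e, y, hPp, hy, hv₁, hv₂, hloc⟩ := exists_maxModulus x₁ x₂ j hrange
  have hy₁ : P.incl.left ≫ (y ≫ x₁).left = (e.inv ≫ a).left ≫ M.incl.left := by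
    rw [← Over.comp_left, ← Over.comp_left, reassoc_of% hy, hx₁, Category.assoc]
  have hy₂ : P.incl.left ≫ (y ≫ x₂).left = (e.inv ≫ b).left ≫ N.incl.left := by
    rw [← Over.comp_left, ← Over.comp_left, reassoc_of% hy, hx₂, Category.assoc]
  have hp : ValuativeLE (e.inv ≫ a) := by
    intro R K _ _ _ _ _ _ x y' z hy' hz
    obtain rfl : y' ≫ (y ≫ x₁).left = z := extension_unique (R := R) (K := K) (N := M) (by
      rw [hz, reassoc_of% hy', hy₁])
    rw [Scheme.IdealSheafData.comap_comp]
    exact Scheme.IdealSheafData.comap_mono y' hv₁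
  have hq : ValuativeLE (e.inv ≫ b) := by
    intro R K _ _ _ _ _ _ x y' z hy' hz
    obtain rfl : y' ≫ (y ≫ x₂).left = z := extension_unique (R := R) (K := K) (N := N) (by
      rw [hz, reassoc_of% hy', hy₂])
    rw [Scheme.IdealSheafData.comap_comp]
    exact Scheme.IdealSheafData.comap_mono y' hv₂
  refine ⟨P, homOfProper hM _ hp, homOfProper hN _ hq, hPp, ?_, ?_⟩
  · exact hU.of_iso e (Iso.refl _) (Iso.refl _) (Iso.refl _)
      (by simp) (by simp) (by simp) (by simp)
  · intro R K _ _ _ _ _ _ x y' s t hy' hs ht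
    obtain rfl : y' ≫ (y ≫ x₁).left = s := extension_unique (R := R) (K := K) (N := M) (by
      rw [hs, reassoc_of% hy', hy₁]; rfl)
    obtain rfl : y' ≫ (y ≫ x₂).left = t := extension_unique (R := R) (K := K) (N := N) (by
      rw [ht, reassoc_of% hy', hy₂]; rfl)
    exact hloc R y'

end ModulusPair
end MPair

/-! ### Disjoint unions of modulus pairs -/

namespace MPair

theorem isEffectiveCartier_of_openCover {X : Scheme.{u}} {I : X.IdealSheafData}
    (h : ∀ x : X, ∃ (Y : Scheme.{u}) (f : Y ⟶ X) (_ : IsOpenImmersion f),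
      x ∈ Set.range f ∧ IsEffectiveCartier (I.comap f)) : IsEffectiveCartier I := by
  intro x
  obtain ⟨Y, f, _, ⟨y, rfl⟩, hY⟩ := h x
  obtain ⟨V, hyV, t, ht, hI⟩ := hY y
  rw [Scheme.IdealSheafData.ideal_comap_of_isOpenImmersion] at hI
  let e := (f.appIso V.1).commRingCatIsoToRingEquiv
  refine ⟨⟨f ''ᵁ V.1, V.2.image_of_isOpenImmersion f⟩, ⟨y, hyV, rfl⟩, e.symm t, ?_, ?_⟩
  · exact (MulEquivClass.map_nonZeroDivisors e.symm).le ⟨t, ht, rfl⟩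
  · have h2 := congrArg (Ideal.map (f.appIso V.1).inv.hom) hI
    rw [Ideal.map_comap_of_surjective _
      (ConcreteCategory.bijective_of_isIso (f.appIso V.1).inv).2, Ideal.map_span,
      Set.image_singleton] at h2
    exact h2

theorem ker_comap_of_isPullback {Z Z' X Y : Scheme.{u}} {i' : Z' ⟶ X} {g : Z' ⟶ Z} {f : X ⟶ Y}
    {i : Z ⟶ Y} [IsClosedImmersion i] (h : IsPullback i' g f i) : i.ker.comap f = i'.ker := by
  rw [← Scheme.IdealSheafData.ker_fst_of_isClosedImmersion, ← h.isoPullback_hom_fst,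
    Scheme.Hom.ker_comp_of_isIso]

namespace ModulusPair
variable {k : Type u} [Field k]

/-- For the modulus of `N` to be at least the modulus of `M`, along any morphism from the spectrum
of a valuation ring which maps the generic point to the interior of `M`. -/
def ValuativeGE {M N : ModulusPair k} (f : M.interior ⟶ N.interior) : Prop :=
  ∀ (R K : Type u) [CommRing R] [IsDomain R] [ValuationRing R] [Field K] [Algebra R K]
    [IsFractionRing R K] (x : Spec (.of K) ⟶ M.interior.left) (y : Spec (.of R) ⟶ M.ambient.left)
    (z : Spec (.of R) ⟶ N.ambient.left), genericPt R K ≫ y = x ≫ M.incl.left →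
    genericPt R K ≫ z = x ≫ f.left ≫ N.incl.left → N.divisor.comap z ≤ M.divisor.comap y

/-- A modulus pair which is the disjoint union of two others: this is so for the interiors, and
the moduli agree along all valuations. Only one inequality between the moduli is required, as the
other one holds for all morphisms. -/
structure IsDisjointUnion {A X P : ModulusPair k} (i : A ⟶ P) (j : X ⟶ P) : Prop where
  openImmersion_left : IsOpenImmersion (Hom.interior i).left
  openImmersion_right : IsOpenImmersion (Hom.interior j).left
  isCompl : IsCompl (Set.range (Hom.interior i).left) (Set.range (Hom.interior j).left)
  valuativeGE_left : ValuativeGE (Hom.interior i)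
  valuativeGE_right : ValuativeGE (Hom.interior j)

theorem valuativeLE_of_extends {M N : ModulusPair k} {f : M.interior ⟶ N.interior}
    (F : M.ambient ⟶ N.ambient) (hF : M.incl ≫ F = f ≫ N.incl)
    (h : M.divisor ≤ N.divisor.comap F.left) : ValuativeLE f := by
  intro R K _ _ _ _ _ _ x y z hy hz
  obtain rfl : y ≫ F.left = z := extension_unique (R := R) (K := K) (N := N) (by
    rw [hz, reassoc_of% hy, ← Over.comp_left, ← Over.comp_left, hF])
  rw [Scheme.IdealSheafData.comap_comp]
  exact Scheme.IdealSheafData.comap_mono y h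

theorem valuativeGE_of_extends {M N : ModulusPair k} {f : M.interior ⟶ N.interior}
    (F : M.ambient ⟶ N.ambient) (hF : M.incl ≫ F = f ≫ N.incl)
    (h : N.divisor.comap F.left ≤ M.divisor) : ValuativeGE f := by
  intro R K _ _ _ _ _ _ x y z hy hz
  obtain rfl : y ≫ F.left = z := extension_unique (R := R) (K := K) (N := N) (by
    rw [hz, reassoc_of% hy, ← Over.comp_left, ← Over.comp_left, hF])
  rw [Scheme.IdealSheafData.comap_comp]
  exact Scheme.IdealSheafData.comap_mono y h

theorem smooth_coprodDesc {X Y S : Scheme.{u}} (f : X ⟶ S) (g : Y ⟶ S) [hf : Smooth f]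
    [hg : Smooth g] : Smooth (coprod.desc f g) := by
  have := HasRingHomProperty.instIsZariskiLocalAtSource (P := @Smooth.{u}) (Q := RingHom.Smooth)
  refine IsZariskiLocalAtSource.of_openCover (P := @Smooth) (coprodOpenCover.{u, 0} X Y) ?_
  rintro (_ | _)
  · exact (congrArg Smooth (coprod.inl_desc f g)).mpr hf
  · exact (congrArg Smooth (coprod.inr_desc f g)).mpr hg

theorem isProper_coprodDesc {X Y S : Scheme.{u}} (f : X ⟶ S) (g : Y ⟶ S) [hf : IsProper f]
    [hg : IsProper g] : IsProper (coprod.desc f g) := by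
  have h : coprod.desc f g = coprod.map f g ≫ coprod.desc (𝟙 S) (𝟙 S) := by simp
  have : IsProper (coprod.map f g) := IsZariskiLocalAtTarget.coprodMap f g hf hg
  rw [h]
  infer_instance

/-- The disjoint union of the ambient spaces and of the divisors. -/
theorem exists_isDisjointUnion {A X : ModulusPair k} (hA : IsProper A.ambient.hom)
    (hX : IsProper X.ambient.hom) : ∃ (D : ModulusPair k) (i : A ⟶ D) (j : X ⟶ D),
      IsProper D.ambient.hom ∧ IsDisjointUnion i j := by
  let Z : Over (Spec (CommRingCat.of k)) := Over.mk (coprod.desc A.ambient.hom X.ambient.hom)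
  let U : Over (Spec (CommRingCat.of k)) := Over.mk (coprod.desc A.interior.hom X.interior.hom)
  have hZ : IsProper Z.hom := isProper_coprodDesc A.ambient.hom X.ambient.hom
  have hU : Smooth U.hom := by
    have : Smooth A.interior.hom := A.smooth
    have : Smooth X.interior.hom := X.smooth
    exact smooth_coprodDesc A.interior.hom X.interior.hom
  let j : U ⟶ Z := Over.homMk (coprod.map A.incl.left X.incl.left) (by
    apply coprod.hom_ext <;> simp [Z, U])
  have hj : IsOpenImmersion j.left :=
    inferInstanceAs (IsOpenImmersion (coprod.map A.incl.left X.incl.left))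
  have hcl : IsClosedImmersion (coprod.map A.divisor.subschemeι X.divisor.subschemeι) :=
    IsZariskiLocalAtTarget.coprodMap _ _ inferInstance inferInstance
  let I : Z.left.IdealSheafData := (coprod.map A.divisor.subschemeι X.divisor.subschemeι).ker
  let inl : A.ambient.left ⟶ Z.left := coprod.inl
  let inr : X.ambient.left ⟶ Z.left := coprod.inr
  have hil : IsOpenImmersion inl := inferInstanceAs (IsOpenImmersion coprod.inl)
  have hir : IsOpenImmersion inr := inferInstanceAs (IsOpenImmersion coprod.inr)
  have h₁ : I.comap inl = A.divisor :=
    (ker_comap_of_isPullback (isPullback_inl_inl_coprodMap _ _)).trans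
      (Scheme.IdealSheafData.ker_subschemeι _)
  have h₂ : I.comap inr = X.divisor :=
    (ker_comap_of_isPullback (isPullback_inr_inr_coprodMap _ _)).trans
      (Scheme.IdealSheafData.ker_subschemeι _)
  have hcov : ∀ z : Z.left, z ∈ Set.range inl ∨ z ∈ Set.range inr := by
    intro z
    have := (isCompl_range_inl_inr A.ambient.left X.ambient.left).sup_eq_top
    exact (Set.mem_union _ _ _).mp (this.ge (Set.mem_univ z))
  have hwl : A.incl.left ≫ inl = coprod.inl ≫ j.left := (coprod.inl_map _ _).symm
  have hwr : X.incl.left ≫ inr = coprod.inr ≫ j.left := (coprod.inr_map _ _).symm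
  have hcart : IsEffectiveCartier I := by
    refine isEffectiveCartier_of_openCover fun z => ?_
    rcases hcov z with hz | hz
    · exact ⟨_, inl, hil, hz, h₁ ▸ A.cartier⟩
    · exact ⟨_, inr, hir, hz, h₂ ▸ X.cartier⟩
  have hsupp : complOpens I = j.left.opensRange := by
    have hA' : Set.range A.incl.left = complOpens A.divisor := Scheme.Opens.range_ι _
    have hX' : Set.range X.incl.left = complOpens X.divisor := Scheme.Opens.range_ι _
    apply TopologicalSpace.Opens.ext
    ext z
    rcases hcov z with ⟨a, rfl⟩ | ⟨a, rfl⟩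
    · have e1 : inl a ∈ complOpens I ↔ a ∈ Set.range A.incl.left := by
        rw [hA', ← h₁, complOpens_comap]
        rfl
      refine e1.trans ⟨?_, ?_⟩
      · rintro ⟨a', rfl⟩
        exact ⟨(coprod.inl : _ ⟶ A.interior.left ⨿ X.interior.left) a', by
          rw [← Scheme.Hom.comp_apply, ← Scheme.Hom.comp_apply, hwl]⟩
      · rintro ⟨w, hw⟩
        have := (isCompl_range_inl_inr A.interior.left X.interior.left).sup_eq_top
        rcases this.ge (Set.mem_univ w) with ⟨w, rfl⟩ | ⟨w, rfl⟩
        · refine ⟨w, inl.isOpenEmbedding.injective ?_⟩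
          rw [← hw, ← Scheme.Hom.comp_apply, ← Scheme.Hom.comp_apply, hwl]
        · rw [← Scheme.Hom.comp_apply, ← hwr] at hw
          exact (inr_ne_inl _ _ _ _ hw).elim
    · have e1 : inr a ∈ complOpens I ↔ a ∈ Set.range X.incl.left := by
        rw [hX', ← h₂, complOpens_comap]
        rfl
      refine e1.trans ⟨?_, ?_⟩
      · rintro ⟨a', rfl⟩
        exact ⟨(coprod.inr : _ ⟶ A.interior.left ⨿ X.interior.left) a', by
          rw [← Scheme.Hom.comp_apply, ← Scheme.Hom.comp_apply, hwr]⟩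
      · rintro ⟨w, hw⟩
        have := (isCompl_range_inl_inr A.interior.left X.interior.left).sup_eq_top
        rcases this.ge (Set.mem_univ w) with ⟨w, rfl⟩ | ⟨w, rfl⟩
        · rw [← Scheme.Hom.comp_apply, ← hwl] at hw
          exact (inl_ne_inr _ _ _ _ hw).elim
        · refine ⟨w, inr.isOpenEmbedding.injective ?_⟩
          rw [← hw, ← Scheme.Hom.comp_apply, ← Scheme.Hom.comp_apply, hwr]
  obtain ⟨D, e, φ, hφ, hD⟩ := exists_ofOpen (Z := Z) inferInstance inferInstance inferInstance j
    I hcart hsupp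
  have hφ' : j ≫ φ.inv = e.hom ≫ D.incl := by
    rw [Iso.comp_inv_eq, Category.assoc, hφ, Iso.hom_inv_id_assoc]
  let il : A.interior ⟶ U := Over.homMk coprod.inl (coprod.inl_desc _ _)
  let ir : X.interior ⟶ U := Over.homMk coprod.inr (coprod.inr_desc _ _)
  let Il : A.ambient ⟶ Z := Over.homMk inl (coprod.inl_desc _ _)
  let Ir : X.ambient ⟶ Z := Over.homMk inr (coprod.inr_desc _ _)
  have hFl : A.incl ≫ Il ≫ φ.inv = (il ≫ e.hom) ≫ D.incl := by
    have : A.incl ≫ Il = il ≫ j := by ext1; exact hwl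
    rw [reassoc_of% this, hφ', Category.assoc]
  have hFr : X.incl ≫ Ir ≫ φ.inv = (ir ≫ e.hom) ≫ D.incl := by
    have : X.incl ≫ Ir = ir ≫ j := by ext1; exact hwr
    rw [reassoc_of% this, hφ', Category.assoc]
  have hdl : D.divisor.comap (Il ≫ φ.inv).left = A.divisor := by
    rw [hD, ← Scheme.IdealSheafData.comap_comp, ← Over.comp_left, Category.assoc, Iso.inv_hom_id,
      Category.comp_id, ← h₁]
    rfl
  have hdr : D.divisor.comap (Ir ≫ φ.inv).left = X.divisor := by
    rw [hD, ← Scheme.IdealSheafData.comap_comp, ← Over.comp_left, Category.assoc, Iso.inv_hom_id,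
      Category.comp_id, ← h₂]
    rfl
  have hDp : IsProper D.ambient.hom := by
    rw [← Over.w φ.hom]
    have : IsIso φ.hom.left := inferInstanceAs (IsIso ((Over.forget _).map φ.hom))
    exact MorphismProperty.comp_mem @IsProper _ _ inferInstance hZ
  have he : IsIso e.hom.left := inferInstanceAs (IsIso ((Over.forget _).map e.hom))
  have hilo : IsOpenImmersion il.left := inferInstanceAs (IsOpenImmersion coprod.inl)
  have hiro : IsOpenImmersion ir.left := inferInstanceAs (IsOpenImmersion coprod.inr)
  refine ⟨D, homOfExtends _ _ hFl (valuativeLE_of_extends _ hFl hdl.ge),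
    homOfExtends _ _ hFr (valuativeLE_of_extends _ hFr hdr.ge), hDp, ?_, ?_, ?_,
    valuativeGE_of_extends _ hFl hdl.le, valuativeGE_of_extends _ hFr hdr.le⟩
  · exact MorphismProperty.comp_mem @IsOpenImmersion _ _ hilo inferInstance
  · exact MorphismProperty.comp_mem @IsOpenImmersion _ _ hiro inferInstance
  · have h : IsCompl (Set.range il.left) (Set.range ir.left) := isCompl_range_inl_inr _ _
    have h' : ∀ {V : Scheme.{u}} (f : V ⟶ U.left),
        Set.range (f ≫ e.hom.left) = e.hom.left '' Set.range f := by
      intro V f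
      rw [← Set.range_comp]
      rfl
    change IsCompl (Set.range (il.left ≫ e.hom.left)) (Set.range (ir.left ≫ e.hom.left))
    rw [h', h', h.compl_eq.symm]
    have hb : Function.Bijective e.hom.left := e.hom.left.homeomorph.bijective
    rw [Set.image_compl_eq hb]
    exact isCompl_compl

theorem IsDisjointUnion.exists_lift {A X P : ModulusPair k} {i : A ⟶ P} {j : X ⟶ P}
    (h : IsDisjointUnion i j) {K : Type u} [Field K] (x : Spec (.of K) ⟶ P.interior.left) :
    (∃ x', x' ≫ (Hom.interior i).left = x) ∨ (∃ x', x' ≫ (Hom.interior j).left = x) := by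
  have := h.openImmersion_left
  have := h.openImmersion_right
  have hx : ∀ y, y = closedPt K := fun y => Subsingleton.elim (α := PrimeSpectrum K) _ _
  have hmem : x (closedPt K) ∈ Set.range (Hom.interior i).left ∪
      Set.range (Hom.interior j).left := h.isCompl.sup_eq_top.ge (Set.mem_univ _)
  rcases hmem with hm | hm
  · exact .inl (exists_lift_of_closedPoint x _ hm)
  · exact .inr (exists_lift_of_closedPoint x _ hm)

/-- A disjoint union is a coproduct in the category of proper modulus pairs. -/
theorem IsDisjointUnion.existsUnique_desc {A X P : ModulusPair k} {i : A ⟶ P} {j : X ⟶ P}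
    (hA : IsProper A.ambient.hom) (hX : IsProper X.ambient.hom)
    (h : IsDisjointUnion i j) :
    ∀ {Z : ModulusPair k} (_ : IsProper Z.ambient.hom) (s : A ⟶ Z) (t : X ⟶ Z),
      ∃! d : P ⟶ Z, i ≫ d = s ∧ j ≫ d = t := by
  intro Z hZ s t
  have := h.openImmersion_left
  have := h.openImmersion_right
  obtain ⟨hc⟩ := nonempty_isColimit_binaryCofanMk_of_isCompl (Hom.interior i).left
    (Hom.interior j).left (by
      have h' := h.isCompl
      simp only [isCompl_iff, disjoint_iff, codisjoint_iff, ← TopologicalSpace.Opens.coe_inj]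
        at h' ⊢
      exact h')
  obtain ⟨d, hd₁, hd₂⟩ : ∃ d : P.interior.left ⟶ Z.interior.left,
      (Hom.interior i).left ≫ d = (Hom.interior s).left ∧
      (Hom.interior j).left ≫ d = (Hom.interior t).left := by
    obtain ⟨d, hd⟩ := BinaryCofan.IsColimit.desc' hc (Hom.interior s).left (Hom.interior t).left
    exact ⟨d, hd⟩
  have hdk : d ≫ Z.interior.hom = P.interior.hom := by
    apply BinaryCofan.IsColimit.hom_ext hc
    · change (Hom.interior i).left ≫ d ≫ Z.interior.hom = (Hom.interior i).left ≫ P.interior.hom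
      rw [reassoc_of% hd₁, Over.w, Over.w]
    · change (Hom.interior j).left ≫ d ≫ Z.interior.hom = (Hom.interior j).left ≫ P.interior.hom
      rw [reassoc_of% hd₂, Over.w, Over.w]
  have hv : ValuativeLE (Over.homMk d hdk : P.interior ⟶ Z.interior) := by
    intro R K _ _ _ _ _ _ x y z hy hz
    replace hz : genericPt R K ≫ z = x ≫ d ≫ Z.incl.left := hz
    rcases h.exists_lift x with ⟨x, rfl⟩ | ⟨x, rfl⟩
    · rw [Category.assoc] at hy hz
      obtain ⟨y', hy'⟩ := exists_extension R K hA x (y ≫ P.ambient.hom) (by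
        rw [reassoc_of% hy, Over.w, Over.w])
      refine (h.valuativeGE_left R K x y' y hy' hy).trans
        (valuativeLE_of_hom s R K x y' z hy' ?_)
      rw [hz, reassoc_of% hd₁]
    · rw [Category.assoc] at hy hz
      obtain ⟨y', hy'⟩ := exists_extension R K hX x (y ≫ P.ambient.hom) (by
        rw [reassoc_of% hy, Over.w, Over.w])
      refine (h.valuativeGE_right R K x y' y hy' hy).trans
        (valuativeLE_of_hom t R K x y' z hy' ?_)
      rw [hz, reassoc_of% hd₂]
  refine ⟨homOfProper hZ _ hv, ⟨?_, ?_⟩, ?_⟩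
  · ext1
    ext1
    exact hd₁
  · ext1
    ext1
    exact hd₂
  · rintro d' ⟨h₁, h₂⟩
    ext1
    ext1
    apply BinaryCofan.IsColimit.hom_ext hc
    · exact congr((Hom.interior $h₁).left).trans hd₁.symm
    · exact congr((Hom.interior $h₂).left).trans hd₂.symm

end ModulusPair
end MPair

/-! ### Fibre products and coproducts in the category of proper modulus pairs -/

namespace MPair
namespace ModulusPair
variable {k : Type u} [Field k]

theorem IsDisjointUnion.comp_iso {A X D P : ModulusPair k} {i : A ⟶ D} {j : X ⟶ D}
    (h : IsDisjointUnion i j) (hD : IsProper D.ambient.hom) (a : D ⟶ P) [IsIso a] :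
    IsDisjointUnion (i ≫ a) (j ≫ a) := by
  have hl := h.openImmersion_left
  have hr := h.openImmersion_right
  have ha : IsIso (Hom.interior a).left :=
    inferInstanceAs (IsIso ((Over.forget _).map (Hom.interior a)))
  have hrange : ∀ {V : Scheme.{u}} (f : V ⟶ D.interior.left),
      Set.range (f ≫ (Hom.interior a).left) = (Hom.interior a).left '' Set.range f := by
    intro V f
    rw [← Set.range_comp]
    rfl
  have hge : ∀ {B : ModulusPair k} (b : B ⟶ D), ValuativeGE (Hom.interior b) →
      ValuativeGE (Hom.interior (b ≫ a)) := by
    intro B b hb R K _ _ _ _ _ _ x y z hy hz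
    obtain ⟨z', hz'⟩ := exists_map hD (Hom.interior (inv a))
      (x := x ≫ (Hom.interior b).left ≫ (Hom.interior a).left) (y := z) (by
        rw [hz, interior_comp, Over.comp_left, Category.assoc, Category.assoc, Category.assoc])
    refine (valuativeLE_of_hom (inv a) R K _ z z' ?_ hz').trans (hb R K x y z' hy ?_)
    · rw [hz, interior_comp, Over.comp_left, Category.assoc, Category.assoc, Category.assoc]
    · have e : (Hom.interior a).left ≫ (Hom.interior (inv a)).left = 𝟙 _ :=
        congr((Hom.interior $(IsIso.hom_inv_id a)).left)
      rw [hz', Category.assoc, Category.assoc, reassoc_of% e]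
  refine ⟨?_, ?_, ?_, hge i h.valuativeGE_left, hge j h.valuativeGE_right⟩
  · exact MorphismProperty.comp_mem @IsOpenImmersion _ _ hl inferInstance
  · exact MorphismProperty.comp_mem @IsOpenImmersion _ _ hr inferInstance
  · have hb : Function.Bijective (Hom.interior a).left :=
      (Hom.interior a).left.homeomorph.bijective
    change IsCompl (Set.range ((Hom.interior i).left ≫ (Hom.interior a).left))
      (Set.range ((Hom.interior j).left ≫ (Hom.interior a).left))
    rw [hrange, hrange, h.isCompl.compl_eq.symm, Set.image_compl_eq hb]
    exact isCompl_compl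

/-- The condition on the modulus of a fibre product is invariant under isomorphisms. -/
theorem IsMaxModulus.of_isIso {P Q M N : ModulusPair k} (hQ : IsProper Q.ambient.hom)
    {p : Q ⟶ M} {q : Q ⟶ N} (h : IsMaxModulus (Hom.interior p) (Hom.interior q)) (e : P ⟶ Q)
    [IsIso e] : IsMaxModulus (Hom.interior (e ≫ p)) (Hom.interior (e ≫ q)) := by
  intro R K _ _ _ _ _ _ x y a b hy ha hb
  obtain ⟨z, hz⟩ := exists_map hQ (Hom.interior e) hy
  have hle := valuativeLE_of_hom (inv e) R K (x ≫ (Hom.interior e).left) z y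
    (by rw [hz, Category.assoc]) (by
      rw [hy, Category.assoc, ← Over.comp_left_assoc, ← interior_comp, IsIso.hom_inv_id,
        interior_id, Over.id_left, Category.id_comp])
  rw [interior_comp, Over.comp_left, Category.assoc] at ha hb
  rw [← Category.assoc] at hz ha hb
  exact (h R K _ z a b hz ha hb).imp (·.trans hle) (·.trans hle)

end ModulusPair

open ModulusPair
variable {k : Type u} [Field k]

/-- The morphisms of proper modulus pairs which are étale on the interiors. -/
def IsInteriorEtale {M N : MSm k} (f : M ⟶ N) : Prop :=
  Etale (Hom.interior f.hom).left

theorem IsInteriorEtale.comp {M N L : MSm k} {f : M ⟶ N} {g : N ⟶ L} (hf : IsInteriorEtale f)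
    (hg : IsInteriorEtale g) : IsInteriorEtale (f ≫ g) :=
  have : Etale (Hom.interior f.hom).left := hf
  have : Etale (Hom.interior g.hom).left := hg
  inferInstanceAs (Etale ((Hom.interior f.hom).left ≫ (Hom.interior g.hom).left))

theorem IsInteriorEtale.of_openImmersion {M N : MSm k} {f : M ⟶ N}
    (h : IsOpenImmersion (Hom.interior f.hom).left) : IsInteriorEtale f :=
  inferInstanceAs (Etale (Hom.interior f.hom).left)

theorem exists_isPullback {M N L : MSm k} (f : M ⟶ L) (g : N ⟶ L) (hf : IsInteriorEtale f) :
    ∃ (P : MSm k) (p : P ⟶ M) (q : P ⟶ N), IsPullback p q f g := by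
  obtain ⟨P, p, q, hP, h, hmax⟩ := exists_pullback M.property N.property f.hom g.hom hf
  have := isPullback_of_isMaxModulus hP M.property N.property h hmax
  exact ⟨⟨P, hP⟩, ObjectProperty.homMk p, ObjectProperty.homMk q,
    IsPullback.of_map (isProperPair k).ι (by ext1; exact this.w) this⟩

/-- Every pull-back square of proper modulus pairs along a morphism that is étale on the interiors has
the interior and the modulus of the fibre product constructed above, as it is isomorphic to it. -/
theorem isPullback_interior_and_isMaxModulus {P M N L : MSm k} {p : P ⟶ M} {q : P ⟶ N}
    {f : M ⟶ L} {g : N ⟶ L} (h : IsPullback p q f g) (hf : IsInteriorEtale f) :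
    IsPullback (Hom.interior p.hom) (Hom.interior q.hom) (Hom.interior f.hom)
      (Hom.interior g.hom) ∧ IsMaxModulus (Hom.interior p.hom) (Hom.interior q.hom) := by
  obtain ⟨Q, p', q', hQ, h', hmax⟩ := exists_pullback M.property N.property f.hom g.hom hf
  have hpb : IsPullback (ObjectProperty.homMk p' : (⟨Q, hQ⟩ : MSm k) ⟶ M)
      (ObjectProperty.homMk q') f g := by
    have := isPullback_of_isMaxModulus hQ M.property N.property h' hmax
    exact IsPullback.of_map (isProperPair k).ι (by ext1; exact this.w) this
  let e := h.isoIsPullback M N hpb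
  have he₁ : e.hom.hom ≫ p' = p.hom := congr(($(h.isoIsPullback_hom_fst M N hpb)).hom)
  have he₂ : e.hom.hom ≫ q' = q.hom := congr(($(h.isoIsPullback_hom_snd M N hpb)).hom)
  rw [← he₁, ← he₂]
  refine ⟨?_, hmax.of_isIso hQ e.hom.hom⟩
  exact h'.of_iso (asIso (Hom.interior e.hom.hom)).symm (Iso.refl _) (Iso.refl _) (Iso.refl _)
    (by simp) (by simp) (by simp) (by simp)

theorem isPullback_interior {P M N L : MSm k} {p : P ⟶ M} {q : P ⟶ N}
    {f : M ⟶ L} {g : N ⟶ L} (h : IsPullback p q f g) (hf : IsInteriorEtale f) :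
    IsPullback (Hom.interior p.hom).left (Hom.interior q.hom).left (Hom.interior f.hom).left
      (Hom.interior g.hom).left :=
  (isPullback_interior_and_isMaxModulus h hf).1.map (Over.forget _)

theorem isPullback_hom {P M N L : MSm k} {p : P ⟶ M} {q : P ⟶ N}
    {f : M ⟶ L} {g : N ⟶ L} (h : IsPullback p q f g) (hf : IsInteriorEtale f) :
    IsPullback p.hom q.hom f.hom g.hom :=
  isPullback_of_isMaxModulus P.property M.property N.property
    (isPullback_interior_and_isMaxModulus h hf).1 (isPullback_interior_and_isMaxModulus h hf).2

theorem IsInteriorEtale.of_isPullback {P M N L : MSm k} {p : P ⟶ M} {q : P ⟶ N}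
    {f : M ⟶ L} {g : N ⟶ L} (h : IsPullback p q f g) (hf : IsInteriorEtale f) :
    IsInteriorEtale q :=
  MorphismProperty.of_isPullback (P := @Etale) (isPullback_interior h hf) hf

theorem isColimit_of_isDisjointUnion {A X P : MSm k} {i : A ⟶ P} {j : X ⟶ P}
    (h : IsDisjointUnion i.hom j.hom) : Nonempty (IsColimit (BinaryCofan.mk i j)) := by
  have H := fun {Z : MSm k} (s : A ⟶ Z) (t : X ⟶ Z) =>
    h.existsUnique_desc A.property X.property Z.property s.hom t.hom
  refine ⟨BinaryCofan.IsColimit.mk _ (fun s t => ObjectProperty.homMk (H s t).choose) ?_ ?_ ?_⟩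
  · intro Z s t
    ext1
    exact (H s t).choose_spec.1.1
  · intro Z s t
    ext1
    exact (H s t).choose_spec.1.2
  · intro Z s t m h₁ h₂
    ext1
    exact (H s t).choose_spec.2 _ ⟨congr(($h₁).hom), congr(($h₂).hom)⟩

/-- Coproducts of proper modulus pairs are disjoint unions, as they are isomorphic to one. -/
theorem isDisjointUnion_of_isColimit {A X P : MSm k} {i : A ⟶ P} {j : X ⟶ P}
    (h : IsColimit (BinaryCofan.mk i j)) : IsDisjointUnion i.hom j.hom := by
  obtain ⟨D, i', j', hD, hD'⟩ := exists_isDisjointUnion A.property X.property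
  obtain ⟨h'⟩ := isColimit_of_isDisjointUnion (P := ⟨D, hD⟩) (i := ObjectProperty.homMk i')
    (j := ObjectProperty.homMk j') hD'
  let e : (⟨D, hD⟩ : MSm k) ≅ P := h'.coconePointUniqueUpToIso h
  have h₁ : i' ≫ e.hom.hom = i.hom :=
    congr(($(h'.comp_coconePointUniqueUpToIso_hom h ⟨WalkingPair.left⟩)).hom)
  have h₂ : j' ≫ e.hom.hom = j.hom :=
    congr(($(h'.comp_coconePointUniqueUpToIso_hom h ⟨WalkingPair.right⟩)).hom)
  rw [← h₁, ← h₂]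
  exact hD'.comp_iso hD e.hom.hom

theorem range_eq_preimage_of_isPullback {X Y Z W : Scheme.{u}} {a : X ⟶ Y} {b : X ⟶ Z} {c : Y ⟶ W}
    {d : Z ⟶ W} (h : IsPullback a b c d) : Set.range a = c ⁻¹' Set.range d := by
  have : Set.range a = Set.range (pullback.fst c d) := by
    rw [← h.isoPullback_hom_fst]
    exact (h.isoPullback.hom.homeomorph.surjective).range_comp _
  rw [this, Scheme.Pullback.range_fst]

/-- Disjoint unions of modulus pairs are stable under base change. -/
theorem isDisjointUnion_of_isPullback {A X P L Y A' X' P' : MSm k} {i : A ⟶ P} {j : X ⟶ P}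
    (h : IsDisjointUnion i.hom j.hom) {g : P ⟶ L} (hg : IsInteriorEtale g) {f : Y ⟶ L}
    {p : P' ⟶ P} {p' : P' ⟶ Y} (hP : IsPullback p p' g f)
    {a : A' ⟶ A} {a' : A' ⟶ Y} (hA : IsPullback a a' (i ≫ g) f)
    {x : X' ⟶ X} {x' : X' ⟶ Y} (hX : IsPullback x x' (j ≫ g) f)
    {i' : A' ⟶ P'} (hi : i' ≫ p = a ≫ i) (hi' : i' ≫ p' = a')
    {j' : X' ⟶ P'} (hj : j' ≫ p = x ≫ j) (hj' : j' ≫ p' = x') :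
    IsDisjointUnion i'.hom j'.hom := by
  have key : ∀ {B B' : MSm k} {b : B' ⟶ B} {b' : B' ⟶ Y} {l : B ⟶ P} {l' : B' ⟶ P'},
      IsOpenImmersion (Hom.interior l.hom).left → ValuativeGE (Hom.interior l.hom) →
      IsPullback b b' (l ≫ g) f → l' ≫ p = b ≫ l → l' ≫ p' = b' →
      IsOpenImmersion (Hom.interior l'.hom).left ∧
      (Set.range (Hom.interior l'.hom).left = (Hom.interior p.hom).left ⁻¹'
        Set.range (Hom.interior l.hom).left) ∧ ValuativeGE (Hom.interior l'.hom) := by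
    intro B B' b b' l l' hl hl' hB h₁ h₂
    subst h₂
    have hlg : IsInteriorEtale (l ≫ g) := (IsInteriorEtale.of_openImmersion hl).comp hg
    have hpb : IsPullback (Hom.interior b.hom).left (Hom.interior l'.hom).left
        (Hom.interior l.hom).left (Hom.interior p.hom).left :=
      IsPullback.of_bot (isPullback_interior hB hlg)
        congr((Hom.interior ($h₁.symm).hom).left) (isPullback_interior hP hg)
    refine ⟨MorphismProperty.of_isPullback (P := @IsOpenImmersion) hpb hl,
      range_eq_preimage_of_isPullback hpb.flip, ?_⟩
    intro R K _ _ _ _ _ _ s y z hy hz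
    -- along the valuation, the modulus of `B'` is that of `B` or that of `Y`
    obtain ⟨yB, hyB⟩ := exists_map B.property (Hom.interior b.hom) hy
    obtain ⟨yY, hyY⟩ := exists_map Y.property (Hom.interior (l' ≫ p').hom) hy
    rcases (isPullback_interior_and_isMaxModulus hB hlg).2 R K s y yB yY hy hyB hyY with hle | hle
    · obtain ⟨zP, hzP⟩ := exists_map P.property (Hom.interior p.hom)
        (x := s ≫ (Hom.interior l'.hom).left) (y := z) (by rw [hz, Category.assoc])
      refine (valuativeLE_of_hom p.hom R K _ z zP (by rw [hz, Category.assoc]) hzP).trans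
        ((hl' R K (s ≫ (Hom.interior b.hom).left) yB zP (by rw [hyB, Category.assoc]) ?_).trans hle)
      have e₁ : (Hom.interior l'.hom).left ≫ (Hom.interior p.hom).left =
          (Hom.interior b.hom).left ≫ (Hom.interior l.hom).left :=
        congr((Hom.interior ($h₁).hom).left)
      rw [hzP, Category.assoc, Category.assoc, reassoc_of% e₁]
    · refine (valuativeLE_of_hom p'.hom R K (s ≫ (Hom.interior l'.hom).left) z yY
        (by rw [hz, Category.assoc]) ?_).trans hle
      rw [hyY, Category.assoc]
      exact congr(s ≫ $(Category.assoc (Hom.interior l'.hom).left _ _))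
  obtain ⟨h₁, h₂, h₃⟩ := key h.openImmersion_left h.valuativeGE_left hA hi hi'
  obtain ⟨h₄, h₅, h₆⟩ := key h.openImmersion_right h.valuativeGE_right hX hj hj'
  refine ⟨h₁, h₄, ?_, h₃, h₆⟩
  rw [h₂, h₅, h.isCompl.compl_eq.symm, Set.preimage_compl]
  exact isCompl_compl

end MPair

/-! ### Base change of off-diagonals -/

namespace MPair

/-- The base change of a pull-back square is a pull-back square. -/
theorem isPullback_baseChange {C : Type v} [Category.{w} C] {P A B D L Y P' A' B' D' : C}
    {p₁ : P ⟶ A} {p₂ : P ⟶ B} {f : A ⟶ D} {g : B ⟶ D} (h : IsPullback p₁ p₂ f g)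
    {d : D ⟶ L} {y : Y ⟶ L} {a : A' ⟶ A} {a' : A' ⟶ Y} (hA : IsPullback a a' (f ≫ d) y)
    {b : B' ⟶ B} {b' : B' ⟶ Y} (hB : IsPullback b b' (g ≫ d) y)
    {e : D' ⟶ D} {e' : D' ⟶ Y} (hD : IsPullback e e' d y)
    {c : P' ⟶ P} {c' : P' ⟶ Y} (hP : IsPullback c c' (p₁ ≫ f ≫ d) y)
    {p₁' : P' ⟶ A'} {p₂' : P' ⟶ B'} {f' : A' ⟶ D'} {g' : B' ⟶ D'}
    (hp₁ : p₁' ≫ a = c ≫ p₁) (hp₁' : p₁' ≫ a' = c')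
    (hp₂ : p₂' ≫ b = c ≫ p₂) (hp₂' : p₂' ≫ b' = c')
    (hf : f' ≫ e = a ≫ f) (hf' : f' ≫ e' = a') (hg : g' ≫ e = b ≫ g) (hg' : g' ≫ e' = b') :
    IsPullback p₁' p₂' f' g' := by
  have hBD : IsPullback b g' g e := IsPullback.of_bot (hg' ▸ hB) hg.symm hD
  have hPA : IsPullback c p₁' p₁ a := IsPullback.of_bot (hp₁' ▸ hP) hp₁.symm hA
  refine IsPullback.of_bot ?_ ?_ hBD.flip
  · rw [hp₂, hf]
    exact hPA.flip.paste_vert h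
  · apply hD.hom_ext
    · rw [Category.assoc, Category.assoc, hf, hg, reassoc_of% hp₁, reassoc_of% hp₂, h.w]
    · rw [Category.assoc, Category.assoc, hf', hg', hp₁', hp₂']

open ModulusPair
variable {k : Type u} [Field k]

/-- The off-diagonal is compatible with base change: disjoint unions are stable under base change, and
so are fibre products. -/
theorem IsOffDiagonal.baseChange {M N L P X Y M' N' P' X' : MSm k} {f : M ⟶ N} {p₁ p₂ : P ⟶ M}
    {i : X ⟶ P} (h : IsOffDiagonal f p₁ p₂ i) {d : N ⟶ L} {y : Y ⟶ L} (hf : IsInteriorEtale f)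
    (hd : IsInteriorEtale d) {m : M' ⟶ M} {m' : M' ⟶ Y} (hM : IsPullback m m' (f ≫ d) y)
    {n : N' ⟶ N} {n' : N' ⟶ Y} (hN : IsPullback n n' d y)
    {c : P' ⟶ P} {c' : P' ⟶ Y} (hP : IsPullback c c' (p₁ ≫ f ≫ d) y)
    {x : X' ⟶ X} {x' : X' ⟶ Y} (hX : IsPullback x x' (i ≫ p₁ ≫ f ≫ d) y)
    {f' : M' ⟶ N'} (hf₁ : f' ≫ n = m ≫ f) (hf₂ : f' ≫ n' = m')
    {p₁' p₂' : P' ⟶ M'} (hp₁ : p₁' ≫ m = c ≫ p₁) (hp₁' : p₁' ≫ m' = c')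
    (hp₂ : p₂' ≫ m = c ≫ p₂) (hp₂' : p₂' ≫ m' = c')
    {i' : X' ⟶ P'} (hi : i' ≫ c = x ≫ i) (hi' : i' ≫ c' = x') :
    IsOffDiagonal f' p₁' p₂' i' := by
  have hpb : IsPullback p₁' p₂' f' f' := isPullback_baseChange h.isPullback hM hM hN hP hp₁ hp₁'
    hp₂ hp₂' hf₁ hf₂ hf₁ hf₂
  refine ⟨hpb, isColimit_of_isDisjointUnion ?_⟩
  obtain ⟨hc⟩ := h.isCoproduct
  have hg : IsInteriorEtale (p₁ ≫ f ≫ d) := (hf.of_isPullback h.isPullback.flip).comp (hf.comp hd)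
  refine isDisjointUnion_of_isPullback (isDisjointUnion_of_isColimit hc) hg hP (a := m) (a' := m')
    ?_ hX ?_ ?_ hi hi'
  · rw [h.isPullback.lift_fst_assoc, Category.id_comp]
    exact hM
  · apply h.isPullback.hom_ext
    · rw [Category.assoc, Category.assoc, h.isPullback.lift_fst, ← hp₁, hpb.lift_fst_assoc,
        Category.id_comp, Category.comp_id]
    · rw [Category.assoc, Category.assoc, h.isPullback.lift_snd, ← hp₂, hpb.lift_snd_assoc,
        Category.id_comp, Category.comp_id]
  · rw [← hp₁', hpb.lift_fst_assoc, Category.id_comp]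

/-- The third condition on an MV-square is stable under base change. -/
theorem OffDiagonalIso.baseChange {T T' : Square (MSm k)} (h : OffDiagonalIso T)
    (hq : IsInteriorEtale T.f₁₃) (hu : IsInteriorEtale T.f₃₄) (hp : IsInteriorEtale T.f₂₄)
    (τ : T' ⟶ T) (h₁ : IsPullback τ.τ₁ (T'.f₁₃ ≫ T'.f₃₄) (T.f₁₃ ≫ T.f₃₄) τ.τ₄)
    (h₂ : IsPullback τ.τ₂ T'.f₂₄ T.f₂₄ τ.τ₄) (h₃ : IsPullback τ.τ₃ T'.f₃₄ T.f₃₄ τ.τ₄) :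
    OffDiagonalIso T' := by
  obtain ⟨P, X, P', X', p₁, p₂, i, p₁', p₂', i', φ, hP, hP', hφ₁, hφ₂⟩ := h
  have hiE : ∀ {M N P X : MSm k} {f : M ⟶ N} {p₁ p₂ : P ⟶ M} {i : X ⟶ P},
      IsOffDiagonal f p₁ p₂ i → IsInteriorEtale i := fun h =>
    .of_openImmersion (isDisjointUnion_of_isColimit h.isCoproduct.some).openImmersion_right
  have e₁ : IsInteriorEtale (p₁ ≫ T.f₁₃ ≫ T.f₃₄) :=
    (hq.of_isPullback hP.isPullback.flip).comp (hq.comp hu)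
  have e₂ : IsInteriorEtale (p₁' ≫ T.f₂₄ ≫ 𝟙 _) := by
    rw [Category.comp_id]
    exact (hp.of_isPullback hP'.isPullback.flip).comp hp
  obtain ⟨Q, c, c', hQ⟩ := exists_isPullback (p₁ ≫ T.f₁₃ ≫ T.f₃₄) τ.τ₄ e₁
  obtain ⟨Q', b, b', hQ'⟩ := exists_isPullback (p₁' ≫ T.f₂₄ ≫ 𝟙 _) τ.τ₄ e₂
  obtain ⟨Z, x, x', hZ⟩ := exists_isPullback (i ≫ p₁ ≫ T.f₁₃ ≫ T.f₃₄) τ.τ₄ ((hiE hP).comp e₁)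
  have hZ' : IsPullback (x ≫ φ.hom) x' (i' ≫ p₁' ≫ T.f₂₄ ≫ 𝟙 _) τ.τ₄ := by
    refine hZ.of_iso (Iso.refl _) φ (Iso.refl _) (Iso.refl _) (by simp) (by simp) ?_ (by simp)
    rw [Iso.refl_hom, Category.comp_id, Category.comp_id, reassoc_of% hφ₁, T.fac]
  have h₂' : IsPullback τ.τ₂ T'.f₂₄ (T.f₂₄ ≫ 𝟙 _) τ.τ₄ := by
    rwa [Category.comp_id]
  have hid : IsPullback τ.τ₄ (𝟙 _) (𝟙 _) τ.τ₄ := IsPullback.of_vert_isIso ⟨by simp⟩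
  have w₁ := hP.isPullback.w
  have w₁' := hP'.isPullback.w
  obtain ⟨s₁, hs₁, hs₁'⟩ := h₁.exists_lift (c ≫ p₁) c' (by rw [← hQ.w, Category.assoc])
  obtain ⟨s₂, hs₂, hs₂'⟩ := h₁.exists_lift (c ≫ p₂) c' (by
    rw [← hQ.w, Category.assoc, reassoc_of% w₁])
  obtain ⟨t₁, ht₁, ht₁'⟩ := h₂.exists_lift (b ≫ p₁') b' (by
    rw [← hQ'.w, Category.assoc, Category.comp_id])
  obtain ⟨t₂, ht₂, ht₂'⟩ := h₂.exists_lift (b ≫ p₂') b' (by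
    rw [← hQ'.w, Category.assoc, Category.comp_id, w₁'])
  obtain ⟨l, hl, hl'⟩ := hQ.exists_lift (x ≫ i) x' (by rw [← hZ.w, Category.assoc])
  obtain ⟨r, hr, hr'⟩ := hQ'.exists_lift ((x ≫ φ.hom) ≫ i') x' (by
    rw [← hZ'.w, Category.assoc])
  have c₁₂ : T'.f₁₂ ≫ τ.τ₂ = τ.τ₁ ≫ T.f₁₂ := τ.comm₁₂
  refine ⟨Q, Z, Q', Z, s₁, s₂, l, t₁, t₂, r, Iso.refl _,
    hP.baseChange hq hu h₁ h₃ hQ hZ τ.comm₁₃ rfl hs₁ hs₁' hs₂ hs₂' hl hl',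
    hP'.baseChange hp (inferInstanceAs (Etale (𝟙 _))) h₂' hid hQ' hZ' τ.comm₂₄
      (Category.comp_id _) ht₁ ht₁' ht₂ ht₂' hr hr', ?_, ?_⟩
  · apply h₂.hom_ext
    · simp only [Iso.refl_hom, Category.id_comp, Category.assoc, c₁₂]
      rw [ht₁, reassoc_of% hs₁, reassoc_of% hl, reassoc_of% hr, hφ₁]
    · simp only [Iso.refl_hom, Category.id_comp, Category.assoc, T'.fac]
      rw [ht₁', hs₁', hl', hr']
  · apply h₂.hom_ext
    · simp only [Iso.refl_hom, Category.id_comp, Category.assoc, c₁₂]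
      rw [ht₂, reassoc_of% hs₂, reassoc_of% hl, reassoc_of% hr, hφ₂]
    · simp only [Iso.refl_hom, Category.id_comp, Category.assoc, T'.fac]
      rw [ht₂', hs₂', hl', hr']

end MPair

/-! ### Base change of elementary Nisnevich squares -/

namespace MPair

theorem IsEffectiveCartier.comap_of_flat {X Y : Scheme.{u}} (f : X ⟶ Y) [Flat f]
    {I : Y.IdealSheafData} (h : IsEffectiveCartier I) : IsEffectiveCartier (I.comap f) := by
  intro x
  obtain ⟨U, hxU, t, ht, hI⟩ := h (f x)
  obtain ⟨_, ⟨V, hV, rfl⟩, hxV, hle⟩ :=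
    X.isBasis_affineOpens.exists_subset_of_mem_open (show x ∈ f ⁻¹ᵁ U.1 from hxU) (f ⁻¹ᵁ U.1).2
  replace hle : V ≤ f ⁻¹ᵁ U.1 := hle
  refine ⟨⟨V, hV⟩, hxV, f.appLE U.1 V hle t, ?_, ?_⟩
  · have hf : (f.appLE U.1 V hle).hom.Flat := Flat.flat_appLE f U.2 hV hle
    algebraize [(f.appLE U.1 V hle).hom]
    have hreg := Module.Flat.isSMulRegular_of_nonZeroDivisors (M := Γ(X, V)) ht
    rw [mem_nonZeroDivisors_iff_right]
    intro z hz
    refine hreg.right_eq_zero_of_smul ?_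
    rw [Algebra.smul_def, mul_comm]
    exact hz
  · rw [ideal_comap_eq_map f I U ⟨V, hV⟩ hle, hI, Ideal.map_span, Set.image_singleton]

/-- The reduced closed subscheme on the range of a closed immersion `c` is the reduction of the
source of `c`. -/
theorem exists_isIso_vanishingIdeal {A V : Scheme.{u}} (c : A ⟶ V) [IsClosedImmersion c]
    (Z : TopologicalSpace.Closeds V) (hZ : Set.range c = Z) :
    ∃ a : (Scheme.IdealSheafData.vanishingIdeal (⊤ : TopologicalSpace.Closeds A)).subscheme ⟶
        (Scheme.IdealSheafData.vanishingIdeal Z).subscheme,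
      IsIso a ∧ a ≫ Scheme.IdealSheafData.subschemeι _ =
        Scheme.IdealSheafData.subschemeι _ ≫ c := by
  let ι := (Scheme.IdealSheafData.vanishingIdeal (⊤ : TopologicalSpace.Closeds A)).subschemeι
  have hker : (ι ≫ c).ker = (Scheme.IdealSheafData.vanishingIdeal Z).subschemeι.ker := by
    rw [Scheme.IdealSheafData.ker_subschemeι]
    refine (Scheme.IdealSheafData.map_vanishingIdeal c ⊤).trans ?_
    congr 1
    apply TopologicalSpace.Closeds.ext
    simp [hZ, Z.isClosed.closure_eq]
  exact ⟨IsClosedImmersion.lift (Scheme.IdealSheafData.vanishingIdeal Z).subschemeι (ι ≫ c)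
    hker.ge, IsClosedImmersion.isIso_lift _ _ hker.symm, IsClosedImmersion.lift_fac _ _ _⟩

/-- Elementary Nisnevich squares are stable under base change: the reduced complements are the
reductions of the base changes of the given ones. -/
theorem IsElementaryNisnevich.baseChange {W V U X W' V' U' X' : Scheme.{u}} {v : W ⟶ V}
    {q : W ⟶ U} {p : V ⟶ X} {u : U ⟶ X} (h : IsElementaryNisnevich v q p u)
    {v' : W' ⟶ V'} {q' : W' ⟶ U'} {p' : V' ⟶ X'} {u' : U' ⟶ X'} {g : X' ⟶ X}
    {gV : V' ⟶ V} (hV : IsPullback gV p' p g) {gU : U' ⟶ U} (hU : IsPullback gU u' u g)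
    {gW : W' ⟶ W} (hW : IsPullback gW (q' ≫ u') (q ≫ u) g)
    (hv : v' ≫ gV = gW ≫ v) (hq : q' ≫ gU = gW ≫ q) (w : v' ≫ p' = q' ≫ u') :
    IsElementaryNisnevich v' q' p' u' := by
  have hou := h.openImmersion_u
  have hov := h.openImmersion_v
  have hep := h.etale_p
  have hid : IsPullback g (𝟙 _) (𝟙 _) g := IsPullback.of_vert_isIso ⟨by simp⟩
  have hpb : IsPullback v' q' p' u' := by
    refine isPullback_baseChange (d := 𝟙 X) (e := g) (e' := 𝟙 X') h.isPullback (a := gV) (a' := p')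
      (b := gU) (b' := u') (c := gW) (c' := q' ≫ u') ?_ ?_ hid ?_ hv w hq rfl
      hV.w.symm (Category.comp_id _) hU.w.symm (Category.comp_id _)
    · rwa [Category.comp_id]
    · rwa [Category.comp_id]
    · rwa [Category.comp_id, h.isPullback.w]
  have hou' : IsOpenImmersion u' := MorphismProperty.of_isPullback hU hou
  have hep' : Etale p' := MorphismProperty.of_isPullback hV hep
  have hov' : IsOpenImmersion v' := MorphismProperty.of_isPullback hpb.flip hou'
  have heq' : Etale q' := MorphismProperty.of_isPullback hpb hep'
  refine ⟨hpb, hou', hov', hep', heq', ?_⟩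
  obtain ⟨φ, hφ, hφi⟩ := h.complement_iso
  have hvV : IsPullback gW v' v gV := by
    refine IsPullback.of_bot (v₂₁ := p') (v₂₂ := p) (h₃₁ := g) ?_ hv.symm hV
    rwa [w, h.isPullback.w]
  -- the base change of the reduced complement of `W`, which is also that of the one of `U`
  obtain ⟨A, t, c, hA⟩ : ∃ (A : Scheme.{u}) (t : A ⟶ (complement v).subscheme) (c : A ⟶ V'),
      IsPullback t c (complement v).subschemeι gV := ⟨_, _, _, IsPullback.of_hasPullback _ _⟩
  have hA' : IsPullback (t ≫ φ) (c ≫ p') (complement u).subschemeι g :=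
    (hA.paste_vert hV).of_iso (Iso.refl _) (asIso φ) (Iso.refl _) (Iso.refl _) (by simp) (by simp)
      (by simp [hφ]) (by simp)
  have hc : IsClosedImmersion c := MorphismProperty.of_isPullback hA inferInstance
  have hc' : IsClosedImmersion (c ≫ p') := MorphismProperty.of_isPullback hA' inferInstance
  have hrange : ∀ {O Z O' Z' E : Scheme.{u}} {o : O ⟶ Z} [IsOpenImmersion o] {o' : O' ⟶ Z'}
      [IsOpenImmersion o'] {a : O' ⟶ O} {b : Z' ⟶ Z} {e : E ⟶ (complement o).subscheme}
      {d : E ⟶ Z'}, IsPullback a o' o b → IsPullback e d (complement o).subschemeι b →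
      Set.range d = o'.opensRange.compl := by
    intro O Z O' Z' E o _ o' _ a b e d h₁ h₂
    have h₃ : Set.range o' = b ⁻¹' Set.range o := range_eq_preimage_of_isPullback h₁.flip
    rw [range_eq_preimage_of_isPullback h₂.flip, Scheme.IdealSheafData.range_subschemeι]
    change b ⁻¹' ((complement o).support : Set Z) = (Set.range o')ᶜ
    rw [h₃, complement, Scheme.IdealSheafData.coe_support_vanishingIdeal]
    rfl
  obtain ⟨a, ha, ha'⟩ : ∃ a : (Scheme.IdealSheafData.vanishingIdeal
      (⊤ : TopologicalSpace.Closeds A)).subscheme ⟶ (complement v').subscheme,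
      IsIso a ∧ a ≫ (complement v').subschemeι = Scheme.IdealSheafData.subschemeι _ ≫ c :=
    exists_isIso_vanishingIdeal c _ (hrange hvV hA)
  obtain ⟨b, hb, hb'⟩ : ∃ b : (Scheme.IdealSheafData.vanishingIdeal
      (⊤ : TopologicalSpace.Closeds A)).subscheme ⟶ (complement u').subscheme,
      IsIso b ∧ b ≫ (complement u').subschemeι = Scheme.IdealSheafData.subschemeι _ ≫ c ≫ p' :=
    exists_isIso_vanishingIdeal (c ≫ p') _ (hrange hU hA')
  refine ⟨inv a ≫ b, ?_, inferInstance⟩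
  rw [Category.assoc, hb', IsIso.inv_comp_eq, reassoc_of% ha']

end MPair

/-! ### Minimal ambient morphisms and closures of graphs -/

namespace MPair

theorem comap_map_of_isClosedImmersion {X Y : Scheme.{u}} (f : X ⟶ Y) [IsClosedImmersion f]
    (I : X.IdealSheafData) : (I.map f).comap f = I := by
  have h : IsPullback (I.subschemeι ≫ 𝟙 _) (𝟙 _) f (I.subschemeι ≫ f) :=
    IsPullback.paste_horiz (IsPullback.of_vert_isIso ⟨by simp⟩) (IsKernelPair.id_of_mono f)
  rw [Category.comp_id] at h
  exact (ker_comap_of_isPullback h).trans (Scheme.IdealSheafData.ker_subschemeι I)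

theorem ker_toImage {X Y : Scheme.{u}} (f : X ⟶ Y) : f.toImage.ker = ⊥ := by
  rw [← comap_map_of_isClosedImmersion f.imageι f.toImage.ker, Scheme.IdealSheafData.map_ker,
    Scheme.Hom.toImage_imageι, ← comap_map_of_isClosedImmersion f.imageι ⊥,
    Scheme.IdealSheafData.map_bot, Scheme.IdealSheafData.ker_subschemeι]

theorem toImage_of_eq_comp {Y W Z : Scheme.{u}} {t : Y ⟶ Z} [QuasiCompact t] {c : Y ⟶ W} {o : W ⟶ Z}
    [IsClosedImmersion c] [IsOpenImmersion o] (h : t = c ≫ o) :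
    IsOpenImmersion t.toImage ∧ Set.range t.toImage = t.imageι ⁻¹' Set.range o := by
  subst h
  have : IsOpenImmersion (c ≫ o).toImage := inferInstance
  have h := opensRange_toImage c o
  exact ⟨this, congrArg (fun O : Scheme.Opens (c ≫ o).image => (O : Set (c ≫ o).image)) h⟩

namespace ModulusPair
variable {k : Type u} [Field k]

theorem range_incl (M : ModulusPair k) : Set.range M.incl.left = complOpens M.divisor :=
  Scheme.Opens.range_ι _

/-- The pull-back of the divisor along a morphism over which the interior stays scheme-theoretically
dense is a Cartier divisor. -/
theorem isEffectiveCartier_comap (M : ModulusPair k) {Γ : Scheme.{u}} (c : Γ ⟶ M.ambient.left)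
    {U : Scheme.{u}} (j : U ⟶ Γ) (hj : ∀ O, Function.Injective (j.app O)) (s : U ⟶ M.interior.left)
    (h : j ≫ c = s ≫ M.incl.left) : IsEffectiveCartier (M.divisor.comap c) := by
  intro x
  obtain ⟨V, hxV, a, -, ha⟩ := M.cartier (c x)
  obtain ⟨_, ⟨O, hO, rfl⟩, hxO, hle⟩ :=
    Γ.isBasis_affineOpens.exists_subset_of_mem_open (show x ∈ c ⁻¹ᵁ V.1 from hxV) (c ⁻¹ᵁ V.1).2
  replace hle : O ≤ c ⁻¹ᵁ V.1 := hle
  refine ⟨⟨O, hO⟩, hxO, c.appLE V.1 O hle a, ?_, ?_⟩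
  · have key : ∀ (d : U ⟶ M.ambient.left), d = s ≫ M.incl.left → ∀ (E : U.Opens)
        (hE : E ≤ d ⁻¹ᵁ V.1), IsUnit (d.appLE V.1 E hE a) := by
      rintro _ rfl E hE
      have e : (s ≫ M.incl.left).appLE V.1 E hE =
          M.incl.left.app V.1 ≫ s.appLE (M.incl.left ⁻¹ᵁ V.1) E hE := by
        rw [Scheme.Hom.comp_appLE]
      rw [e, CommRingCat.comp_apply]
      exact (isUnit_incl_app M V a ha).map (s.appLE (M.incl.left ⁻¹ᵁ V.1) E hE).hom
    have hu := key _ h (j ⁻¹ᵁ O) (j.preimage_mono hle)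
    rw [← Scheme.Hom.appLE_comp_appLE _ _ _ O _ hle le_rfl, CommRingCat.comp_apply,
      ← Scheme.Hom.app_eq_appLE] at hu
    rw [mem_nonZeroDivisors_iff_right]
    intro z hz
    apply hj O
    have := congrArg (j.app O) hz
    rw [map_mul, map_zero] at this
    rw [map_zero]
    exact hu.mul_left_eq_zero.mp this
  · rw [ideal_comap_eq_map c M.divisor V ⟨O, hO⟩ hle, ha, Ideal.map_span, Set.image_singleton]

/-- An ambient morphism which is compatible with the divisors defines a morphism of modulus
pairs. -/
theorem exists_hom_of_ambient {M N : ModulusPair k} (F : M.ambient ⟶ N.ambient)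
    (h : M.divisor ≤ N.divisor.comap F.left) :
    ∃ f : M ⟶ N, M.incl ≫ F = Hom.interior f ≫ N.incl := by
  have hr : Set.range (M.incl.left ≫ F.left) ⊆ Set.range N.incl.left := by
    rintro _ ⟨x, rfl⟩
    rw [range_incl]
    have hx : M.incl.left x ∈ complOpens M.divisor := x.2
    have : complOpens M.divisor ≤ complOpens (N.divisor.comap F.left) := by
      intro y hy hy'
      exact hy (Scheme.IdealSheafData.support_antitone h hy')
    have := this hx
    rwa [complOpens_comap] at this
  let f : M.interior ⟶ N.interior :=
    Over.homMk (IsOpenImmersion.lift N.incl.left (M.incl.left ≫ F.left) hr) (by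
      rw [← Over.w N.incl, IsOpenImmersion.lift_fac_assoc, Category.assoc, Over.w, Over.w])
  have hf : M.incl ≫ F = f ≫ N.incl := by
    ext1
    exact (IsOpenImmersion.lift_fac _ _ _).symm
  exact ⟨homOfExtends F f hf (valuativeLE_of_extends F hf h), hf⟩

/-- The interior of the source of a minimal ambient morphism is the preimage of that of the target. -/
theorem IsMinimalExtension.isPullback_left {M N : ModulusPair k}
    {f : M ⟶ N} {F : M.ambient ⟶ N.ambient} (h : IsMinimalExtension f F) :
    IsPullback (Hom.interior f).left M.incl.left N.incl.left F.left := by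
  refine IsOpenImmersion.isPullback _ _ _ _ congr(($h.extends_interior).left) ?_
  apply TopologicalSpace.Opens.ext
  change F.left ⁻¹' Set.range N.incl.left = Set.range M.incl.left
  rw [range_incl, range_incl, h.minimal, complOpens_comap]
  rfl

theorem IsMinimalExtension.comp {M N L : ModulusPair k} {f : M ⟶ N} {g : N ⟶ L}
    {F : M.ambient ⟶ N.ambient} {G : N.ambient ⟶ L.ambient} (hf : IsMinimalExtension f F)
    (hg : IsMinimalExtension g G) : IsMinimalExtension (f ≫ g) (F ≫ G) where
  extends_interior := by
    rw [← Category.assoc, hf.extends_interior, Category.assoc, hg.extends_interior, interior_comp,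
      Category.assoc]
  minimal := by
    rw [hf.minimal, hg.minimal, Over.comp_left, Scheme.IdealSheafData.comap_comp]

theorem IsMinimalExtension.isIso {M N : ModulusPair k} {f : M ⟶ N} {F : M.ambient ⟶ N.ambient}
    (h : IsMinimalExtension f F) (hM : IsProper M.ambient.hom) [IsIso (Hom.interior f)] :
    IsIso f := by
  refine isIso_of_interior hM f ?_
  intro R K _ _ _ _ _ _ x y z hy hz
  refine valuativeGE_of_extends F h.extends_interior h.minimal.ge R K
    (x ≫ (inv (Hom.interior f)).left) z y (by rw [hz, Category.assoc]) ?_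
  rw [hy, Category.assoc, ← Over.comp_left_assoc, IsIso.inv_hom_id, Over.id_left, Category.id_comp]

/-- After replacing the source by the closure of its graph, a morphism becomes ambient. -/
theorem exists_isIso_extends {Y N : ModulusPair k} (hY : IsProper Y.ambient.hom) (g : Y ⟶ N) :
    ∃ (Y' : ModulusPair k) (e : Y' ⟶ Y) (_ : IsIso e) (G : Y'.ambient ⟶ N.ambient),
      IsProper Y'.ambient.hom ∧ Y'.incl ≫ G = Hom.interior (e ≫ g) ≫ N.incl := by
  let f := Hom.interior g
  let Z : Over (Spec (CommRingCat.of k)) := Over.mk (graphFst f ≫ Y.ambient.hom)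
  have hf : IsProper (graphFst f) := (Hom.admissible g).proper
  have hZ : IsProper Z.hom :=
    MorphismProperty.comp_mem @IsProper (graphFst f) Y.ambient.hom hf hY
  have h₁ : toGraph f ≫ graphFst f = Y.incl.left := by
    rw [graphFst, Scheme.Hom.toImage_imageι_assoc, graphMap_fst]
  have h₂ : toGraph f ≫ graphSnd f = f.left ≫ N.incl.left := by
    rw [graphSnd, Scheme.Hom.toImage_imageι_assoc, graphMap_snd]
  let c : Y.interior.left ⟶ pullback Y.interior.hom N.ambient.hom :=
    pullback.lift (𝟙 _) (f.left ≫ N.incl.left) (by simp)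
  have hc : IsClosedImmersion c := by
    have : IsClosedImmersion (c ≫ pullback.fst _ _) := by
      rw [pullback.lift_fst]
      infer_instance
    exact .of_comp c (pullback.fst _ _)
  let o : pullback Y.interior.hom N.ambient.hom ⟶ pullback Y.ambient.hom N.ambient.hom :=
    pullback.map _ _ _ _ Y.incl.left (𝟙 _) (𝟙 _) (by simp) (by simp)
  have hco : graphMap f = c ≫ o := by
    apply pullback.hom_ext
    · rw [graphMap_fst, Category.assoc, pullback.lift_fst, pullback.lift_fst_assoc,
        Category.id_comp]
    · rw [graphMap_snd, Category.assoc, pullback.lift_snd, Category.comp_id, pullback.lift_snd]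
  obtain ⟨hopen, hrange⟩ := toImage_of_eq_comp hco
  let j : Y.interior ⟶ Z := Over.homMk (toGraph f) (by
    change toGraph f ≫ graphFst f ≫ Y.ambient.hom = _
    rw [← Category.assoc, h₁, Over.w])
  have hj : IsOpenImmersion j.left := hopen
  have hsm : Smooth Y.interior.hom := Y.smooth
  obtain ⟨Y', e, φ, hφ, hD⟩ := exists_ofOpen (Z := Z) inferInstance inferInstance inferInstance j
    (Y.divisor.comap (graphFst f)) (isEffectiveCartier_comap Y _ (toGraph f)
      (app_injective_of_ker_eq_bot _ (ker_toImage _)) (𝟙 _)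
      (h₁.trans (Category.id_comp _).symm)) (by
      apply TopologicalSpace.Opens.ext
      change _ = Set.range (toGraph f)
      rw [hrange, complOpens_comap, Scheme.Pullback.range_map]
      have : Set.range (𝟙 N.ambient.left : N.ambient.left ⟶ N.ambient.left) = Set.univ :=
        Set.range_id
      rw [this, Set.preimage_univ, Set.inter_univ, range_incl]
      rfl)
  let F : Z ⟶ Y.ambient := Over.homMk (graphFst f)
  let G : Z ⟶ N.ambient := Over.homMk (graphSnd f) (by
    simp only [Z, Over.mk_hom, graphFst, graphSnd, Category.assoc, pullback.condition])
  have hF : Y'.incl ≫ φ.hom ≫ F = e.inv ≫ Y.incl := by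
    rw [reassoc_of% hφ]
    congr 1
    ext1
    exact h₁
  have hD' : Y'.divisor = Y.divisor.comap (φ.hom ≫ F).left := by
    rw [hD]
    exact (Scheme.IdealSheafData.comap_comp Y.divisor φ.hom.left (graphFst f)).symm
  have hY' : IsProper Y'.ambient.hom := by
    rw [← Over.w φ.hom]
    have : IsIso φ.hom.left := inferInstanceAs (IsIso ((Over.forget _).map φ.hom))
    exact MorphismProperty.comp_mem @IsProper _ _ inferInstance hZ
  let e' : Y' ⟶ Y := homOfExtends _ _ hF (valuativeLE_of_extends _ hF hD'.le)
  have hmin : IsMinimalExtension e' (φ.hom ≫ F) := ⟨hF, hD'⟩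
  have hiso : IsIso (Hom.interior e') := inferInstanceAs (IsIso e.inv)
  refine ⟨Y', e', hmin.isIso hY', φ.hom ≫ G, hY', ?_⟩
  rw [reassoc_of% hφ, interior_comp, Category.assoc]
  change _ = e.inv ≫ f ≫ N.incl
  congr 1
  ext1
  exact h₂

/-- The modulus pair with the induced divisor on a scheme étale over the ambient space of a
modulus pair. -/
theorem exists_isMinimalExtension_of_etale {M : ModulusPair k}
    {Z : Over (Spec (CommRingCat.of k))} (F : Z ⟶ M.ambient) (hF : Etale F.left)
    [IsSeparated F.left] [QuasiCompact F.left] :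
    ∃ (B : ModulusPair k) (φ : B.ambient ≅ Z) (b : B ⟶ M), IsMinimalExtension b (φ.hom ≫ F) := by
  have h₁ : IsSeparated Z.hom := by rw [← Over.w F]; infer_instance
  have h₂ : LocallyOfFiniteType Z.hom := by rw [← Over.w F]; infer_instance
  have h₃ : QuasiCompact Z.hom := by rw [← Over.w F]; infer_instance
  let B : ModulusPair k :=
    { ambient := Z
      isSeparated := h₁
      locallyOfFiniteType := h₂
      quasiCompact := h₃
      divisor := M.divisor.comap F.left
      cartier := M.cartier.comap_of_flat F.left
      smooth := by
        have hsm : Smooth ((complOpens M.divisor).ι ≫ M.ambient.hom) := M.smooth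
        have : Etale (F.left ∣_ complOpens M.divisor) :=
          MorphismProperty.of_isPullback (isPullback_morphismRestrict F.left _).flip hF
        rw [complOpens_comap, ← Over.w F, ← morphismRestrict_ι_assoc]
        infer_instance }
  obtain ⟨b, hb⟩ := exists_hom_of_ambient (M := B) (N := M) F le_rfl
  exact ⟨B, Iso.refl _, b, ⟨by
    rw [← hb]
    congr 1, congr(M.divisor.comap ($(Category.id_comp F)).left).symm⟩⟩

end ModulusPair
end MPair

/-! ### Base change on the ambient spaces -/

namespace MPair
namespace ModulusPair
variable {k : Type u} [Field k]

/-- The base change, on the ambient spaces, of a minimal ambient morphism `f : B ⟶ N` along an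
ambient morphism `y : Y ⟶ N`, with the divisor pulled back from `Y`. -/
structure IsAmbientBaseChange {B N Y B' : ModulusPair k} (f : B ⟶ N) (F : B.ambient ⟶ N.ambient)
    (y : Y ⟶ N) (G : Y.ambient ⟶ N.ambient) (b : B' ⟶ B) (H : B'.ambient ⟶ B.ambient)
    (b' : B' ⟶ Y) (F' : B'.ambient ⟶ Y.ambient) : Prop where
  isMinimalExtension : IsMinimalExtension b' F'
  extends_interior : B'.incl ≫ H = Hom.interior b ≫ B.incl
  isPullback_ambient : IsPullback H F' F G
  isPullback_interior : IsPullback (Hom.interior b) (Hom.interior b') (Hom.interior f)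
    (Hom.interior y)

/-- The pulled back divisor is Cartier, and the complement of its support is smooth, because the base
change is étale over `Y`. -/
theorem exists_isAmbientBaseChange {B N Y : ModulusPair k} {f : B ⟶ N}
    {F : B.ambient ⟶ N.ambient} (hf : IsMinimalExtension f F) (hF : Etale F.left) {y : Y ⟶ N}
    {G : Y.ambient ⟶ N.ambient} (hG : Y.incl ≫ G = Hom.interior y ≫ N.incl) :
    ∃ (B' : ModulusPair k) (b : B' ⟶ B) (H : B'.ambient ⟶ B.ambient) (b' : B' ⟶ Y)
      (F' : B'.ambient ⟶ Y.ambient), IsAmbientBaseChange f F y G b H b' F' := by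
  obtain ⟨Z, H₀, F₀, hZ⟩ : ∃ (Z : Over (Spec (CommRingCat.of k))) (H₀ : Z ⟶ B.ambient)
      (F₀ : Z ⟶ Y.ambient), IsPullback H₀.left F₀.left F.left G.left :=
    ⟨Over.mk (pullback.snd F.left G.left ≫ Y.ambient.hom),
      Over.homMk (pullback.fst F.left G.left) (by
        change _ = pullback.snd F.left G.left ≫ Y.ambient.hom
        rw [← Over.w F, pullback.condition_assoc, Over.w G]),
      Over.homMk (pullback.snd F.left G.left), IsPullback.of_hasPullback _ _⟩
  have hsep : IsSeparated F.left := by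
    have : IsSeparated (F.left ≫ N.ambient.hom) := by
      rw [Over.w]
      infer_instance
    exact .of_comp _ N.ambient.hom
  have hF₀ : Etale F₀.left := MorphismProperty.of_isPullback hZ hF
  have hsep₀ : IsSeparated F₀.left := MorphismProperty.of_isPullback hZ hsep
  have hqc : QuasiCompact F.left := inferInstance
  have hqc₀ : QuasiCompact F₀.left := MorphismProperty.of_isPullback hZ hqc
  obtain ⟨B', φ, b', hb'⟩ := exists_isMinimalExtension_of_etale F₀ hF₀
  have hpb : IsPullback (φ.hom ≫ H₀) (φ.hom ≫ F₀) F G :=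
    (isPullback_over_of_left hZ).of_iso φ.symm (Iso.refl _) (Iso.refl _) (Iso.refl _)
      (by simp) (by simp) (by simp) (by simp)
  have hw : (φ.hom ≫ H₀).left ≫ F.left = (φ.hom ≫ F₀).left ≫ G.left := congr(($hpb.w).left)
  obtain ⟨s, hs₁, hs₂⟩ := hf.isPullback_left.exists_lift
    ((Hom.interior b').left ≫ (Hom.interior y).left) (B'.incl.left ≫ (φ.hom ≫ H₀).left) (by
      have e₁ : Y.incl.left ≫ G.left = (Hom.interior y).left ≫ N.incl.left := congr(($hG).left)
      have e₂ : B'.incl.left ≫ (φ.hom ≫ F₀).left = (Hom.interior b').left ≫ Y.incl.left :=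
        congr(($hb'.extends_interior).left)
      rw [Category.assoc, Category.assoc, hw, reassoc_of% e₂, e₁])
  let b₀ : B'.interior ⟶ B.interior := Over.homMk s (by
    rw [← Over.w B.incl, reassoc_of% hs₂, Over.w, Over.w])
  have hb₀ : B'.incl ≫ φ.hom ≫ H₀ = b₀ ≫ B.incl := by
    ext1
    exact hs₂.symm
  have hv : ValuativeLE b₀ := by
    intro R K _ _ _ _ _ _ x z t hz ht
    obtain rfl : z ≫ (φ.hom ≫ H₀).left = t := extension_unique (R := R) (K := K) (N := B) (by
      rw [ht, reassoc_of% hz, ← Over.comp_left, hb₀, Over.comp_left])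
    have h₁ := valuativeLE_of_extends (φ.hom ≫ F₀) hb'.extends_interior hb'.minimal.le R K x z
      (z ≫ (φ.hom ≫ F₀).left) hz (by
        rw [reassoc_of% hz, ← Over.comp_left, hb'.extends_interior, Over.comp_left])
    have h₂ := valuativeLE_of_hom y R K (x ≫ (Hom.interior b').left) (z ≫ (φ.hom ≫ F₀).left)
      (z ≫ (φ.hom ≫ F₀).left ≫ G.left) (by
        rw [reassoc_of% hz, ← Over.comp_left, hb'.extends_interior, Over.comp_left,
          Category.assoc]) (by
        rw [reassoc_of% hz, ← Over.comp_left_assoc, hb'.extends_interior, Over.comp_left,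
          Category.assoc, ← Over.comp_left, hG, Over.comp_left, Category.assoc])
    refine h₁.trans (h₂.trans (le_of_eq ?_))
    rw [hf.minimal, ← hw, ← Category.assoc, Scheme.IdealSheafData.comap_comp]
  refine ⟨B', homOfExtends _ _ hb₀ hv, φ.hom ≫ H₀, b', φ.hom ≫ F₀, hb', hb₀, hpb, ?_⟩
  apply isPullback_over_of_left
  refine IsPullback.of_right ?_ ?_ hf.isPullback_left.flip
  · have h := hb'.isPullback_left.flip.paste_horiz (hpb.map (Over.forget _))
    have e₁ : B'.incl.left ≫ (φ.hom ≫ H₀).left = s ≫ B.incl.left := hs₂.symm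
    have e₂ : Y.incl.left ≫ G.left = (Hom.interior y).left ≫ N.incl.left := congr(($hG).left)
    rw [← e₂]
    exact e₁ ▸ h
  · exact hs₁

/-- The base change of a minimal ambient morphism `r` between two pairs over `N`. -/
theorem IsAmbientBaseChange.exists_hom {A B N Y A' B' : ModulusPair k} {r : A ⟶ B}
    {R : A.ambient ⟶ B.ambient} (hr : IsMinimalExtension r R) {f : B ⟶ N}
    {F : B.ambient ⟶ N.ambient} {g : A ⟶ N} {E : A.ambient ⟶ N.ambient} (hg : r ≫ f = g)
    (hE : R ≫ F = E) {y : Y ⟶ N}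
    {G : Y.ambient ⟶ N.ambient} {a : A' ⟶ A} {D : A'.ambient ⟶ A.ambient} {a' : A' ⟶ Y}
    {E' : A'.ambient ⟶ Y.ambient} (hA : IsAmbientBaseChange g E y G a D a' E')
    {b : B' ⟶ B} {H : B'.ambient ⟶ B.ambient} {b' : B' ⟶ Y} {F' : B'.ambient ⟶ Y.ambient}
    (hB : IsAmbientBaseChange f F y G b H b' F') :
    ∃ (r' : A' ⟶ B') (R' : A'.ambient ⟶ B'.ambient), IsMinimalExtension r' R' ∧
      r' ≫ b = a ≫ r ∧ r' ≫ b' = a' ∧ R' ≫ H = D ≫ R ∧ R' ≫ F' = E' := by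
  subst hg hE
  obtain ⟨R', hR₁, hR₂⟩ := hB.isPullback_ambient.exists_lift (D ≫ R) E' (by
    rw [Category.assoc, hA.isPullback_ambient.w])
  obtain ⟨r', hr₁, hr₂⟩ := hB.isPullback_interior.exists_lift (Hom.interior a ≫ Hom.interior r)
    (Hom.interior a') (by
      rw [Category.assoc, ← interior_comp r f, hA.isPullback_interior.w])
  have hext : A'.incl ≫ R' = r' ≫ B'.incl := by
    apply hB.isPullback_ambient.hom_ext
    · rw [Category.assoc, Category.assoc, hR₁, hB.extends_interior, reassoc_of% hr₁,
        ← hr.extends_interior, reassoc_of% hA.extends_interior]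
    · rw [Category.assoc, Category.assoc, hR₂, hB.isMinimalExtension.extends_interior,
        reassoc_of% hr₂, hA.isMinimalExtension.extends_interior]
  have hdiv : A'.divisor = B'.divisor.comap R'.left := by
    rw [hA.isMinimalExtension.minimal, hB.isMinimalExtension.minimal,
      ← Scheme.IdealSheafData.comap_comp, ← Over.comp_left, hR₂]
  refine ⟨homOfExtends R' r' hext (valuativeLE_of_extends _ hext hdiv.le), R', ⟨hext, hdiv⟩, ?_, ?_,
    hR₁, hR₂⟩
  · ext1
    exact hr₁
  · ext1
    exact hr₂

/-- A base change of ambient spaces maps to the fibre product of isomorphic data, and this is an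
isomorphism on the interiors. -/
theorem IsAmbientBaseChange.exists_hom_isPullback {B N Y B' : ModulusPair k} {f : B ⟶ N}
    {F : B.ambient ⟶ N.ambient} {y : Y ⟶ N} {G : Y.ambient ⟶ N.ambient} {b : B' ⟶ B}
    {H : B'.ambient ⟶ B.ambient} {b' : B' ⟶ Y} {F' : B'.ambient ⟶ Y.ambient}
    (hB : IsAmbientBaseChange f F y G b H b' F') {P Q L X : ModulusPair k} {s : P ⟶ Q} {t : P ⟶ X}
    {g : Q ⟶ L} {x : X ⟶ L} (h : IsPullback s t g x) (h' : IsPullback (Hom.interior s)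
      (Hom.interior t) (Hom.interior g) (Hom.interior x)) (β : B ⟶ Q) [IsIso (Hom.interior β)]
    (e : Y ⟶ X) [IsIso (Hom.interior e)] (γ : N ⟶ L) [IsIso (Hom.interior γ)]
    (w₁ : f ≫ γ = β ≫ g) (w₂ : y ≫ γ = e ≫ x) :
    ∃ m : B' ⟶ P, m ≫ s = b ≫ β ∧ m ≫ t = b' ≫ e ∧ IsIso (Hom.interior m) := by
  have hpb : IsPullback (Hom.interior (b ≫ β)) (Hom.interior (b' ≫ e)) (Hom.interior g)
      (Hom.interior x) :=
    hB.isPullback_interior.of_iso (Iso.refl _) (asIso (Hom.interior β)) (asIso (Hom.interior e))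
      (asIso (Hom.interior γ)) (by simp) (by simp) congr(Hom.interior $w₁) congr(Hom.interior $w₂)
  obtain ⟨m, hm₁, hm₂⟩ := h.exists_lift (b ≫ β) (b' ≫ e) (by
    ext1
    exact hpb.w)
  refine ⟨m, hm₁, hm₂, ?_⟩
  have : Hom.interior m = (hpb.isoIsPullback _ _ h').hom := by
    apply h'.hom_ext
    · rw [IsPullback.isoIsPullback_hom_fst, ← hm₁]
      rfl
    · rw [IsPullback.isoIsPullback_hom_snd, ← hm₂]
      rfl
  rw [this]
  infer_instance

end ModulusPair
end MPair

/-! ### Base change of MV-squares -/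

namespace MPair
open ModulusPair
variable {k : Type u} [Field k]

theorem ModulusPair.IsMinimalExtension.etale_interior {M N : ModulusPair k} {f : M ⟶ N}
    {F : M.ambient ⟶ N.ambient} (h : IsMinimalExtension f F) (hF : Etale F.left) :
    Etale (Hom.interior f).left :=
  MorphismProperty.of_isPullback h.isPullback_left.flip hF

/-- The second condition on an MV-square, in components and with a dominating square all of whose
morphisms are ambient and minimal. -/
theorem IsMVSquare.exists_isMVFinSquare {T : Square (MSm k)} (h : IsMVSquare T) :
    ∃ (S : Square (ModulusPair k)) (β₁ : S.X₁ ⟶ T.X₁.obj) (β₂ : S.X₂ ⟶ T.X₂.obj)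
      (β₃ : S.X₃ ⟶ T.X₃.obj) (β₄ : S.X₄ ⟶ T.X₄.obj), IsMVFinSquare S ∧
      IsIso (Hom.interior β₁) ∧ IsIso (Hom.interior β₂) ∧ IsIso (Hom.interior β₃) ∧ IsIso β₄ ∧
      S.f₁₃ ≫ β₃ = β₁ ≫ T.f₁₃.hom ∧ S.f₁₂ ≫ β₂ = β₁ ≫ T.f₁₂.hom ∧
      S.f₂₄ ≫ β₄ = β₂ ≫ T.f₂₄.hom ∧ S.f₃₄ ≫ β₄ = β₃ ≫ T.f₃₄.hom := by
  obtain ⟨S, α, ⟨S', hS', ⟨e⟩⟩, -, h₁, h₂⟩ := h.dominated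
  have h₃ : IsIso ((interiorFunctor k).mapSquare.map (e.hom ≫ α)) := by
    rw [Functor.map_comp]
    infer_instance
  have he : IsIso e.hom.τ₄ := (Square.evaluation₄.mapIso e).isIso_hom
  let β := e.hom ≫ α
  let i := asIso ((interiorFunctor k).mapSquare.map β)
  exact ⟨S', β.τ₁, β.τ₂, β.τ₃, β.τ₄, hS', (Square.evaluation₁.mapIso i).isIso_hom,
    (Square.evaluation₂.mapIso i).isIso_hom, (Square.evaluation₃.mapIso i).isIso_hom,
    inferInstanceAs (IsIso (e.hom.τ₄ ≫ α.τ₄)), β.comm₁₃, β.comm₁₂, β.comm₂₄, β.comm₃₄⟩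

theorem isIso_mapSquare {S T : Square (ModulusPair k)} (β : S ⟶ T)
    (h₁ : IsIso (Hom.interior β.τ₁)) (h₂ : IsIso (Hom.interior β.τ₂))
    (h₃ : IsIso (Hom.interior β.τ₃)) (h₄ : IsIso (Hom.interior β.τ₄)) :
    IsIso ((interiorFunctor k).mapSquare.map β) := by
  have : (interiorFunctor k).mapSquare.map β =
      (Square.isoMk (sq₁ := (interiorFunctor k).mapSquare.obj S)
        (sq₂ := (interiorFunctor k).mapSquare.obj T) (@asIso _ _ _ _ _ h₁)
        (@asIso _ _ _ _ _ h₂) (@asIso _ _ _ _ _ h₃) (@asIso _ _ _ _ _ h₄)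
        congr(Hom.interior $β.comm₁₂) congr(Hom.interior $β.comm₁₃)
        congr(Hom.interior $β.comm₂₄) congr(Hom.interior $β.comm₃₄)).hom := rfl
  rw [this]
  infer_instance

theorem etale_interior_of_comm {A B A' B' : ModulusPair k} {f : A ⟶ B} {f' : A' ⟶ B'} (a : A ⟶ A')
    (b : B ⟶ B') [IsIso (Hom.interior a)] [IsIso (Hom.interior b)] (w : f ≫ b = a ≫ f')
    (h : Etale (Hom.interior f).left) : Etale (Hom.interior f').left := by
  have e : Hom.interior f' = inv (Hom.interior a) ≫ Hom.interior f ≫ Hom.interior b := by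
    rw [IsIso.eq_inv_comp]
    exact congr(Hom.interior $w).symm
  rw [e, Over.comp_left, Over.comp_left]
  have h₁ : IsIso (inv (Hom.interior a)).left :=
    inferInstanceAs (IsIso ((Over.forget _).map (inv (Hom.interior a))))
  have h₂ : IsIso (Hom.interior b).left :=
    inferInstanceAs (IsIso ((Over.forget _).map (Hom.interior b)))
  infer_instance

/-- The sides of an MV-square are étale on the interiors. -/
theorem IsMVSquare.isInteriorEtale {T : Square (MSm k)} (h : IsMVSquare T) :
    IsInteriorEtale T.f₁₃ ∧ IsInteriorEtale T.f₂₄ ∧ IsInteriorEtale T.f₃₄ := by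
  obtain ⟨S, β₁, β₂, β₃, β₄, ⟨v, q, p, u, hv, hq, hp, hu, hN⟩, h₁, h₂, h₃, h₄, c₁₃, -, c₂₄, c₃₄⟩ :=
    h.exists_isMVFinSquare
  have hou := hN.openImmersion_u
  have h₄' : IsIso (Hom.interior β₄) := inferInstanceAs (IsIso ((interiorFunctor k).map β₄))
  exact ⟨etale_interior_of_comm β₁ β₃ c₁₃ (hq.etale_interior hN.etale_q),
    etale_interior_of_comm β₂ β₄ c₂₄ (hp.etale_interior hN.etale_p),
    etale_interior_of_comm β₃ β₄ c₃₄ (hu.etale_interior inferInstance)⟩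

/-- The base change of an MV-square is dominated by the base change, on the ambient spaces, of the
dominating square, once the base has been modified so that the morphism is ambient. -/
theorem IsMVSquare.exists_dominated_baseChange {T T' : Square (MSm k)} (h : IsMVSquare T)
    (τ : T' ⟶ T) (h₁ : IsPullback τ.τ₁ (T'.f₁₃ ≫ T'.f₃₄) (T.f₁₃ ≫ T.f₃₄) τ.τ₄)
    (h₂ : IsPullback τ.τ₂ T'.f₂₄ T.f₂₄ τ.τ₄) (h₃ : IsPullback τ.τ₃ T'.f₃₄ T.f₃₄ τ.τ₄) :
    ∃ (S : Square (ModulusPair k)) (α : S ⟶ T'.map (isProperPair k).ι),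
      IsMVBarSquare S ∧ isProperPair k S.X₄ ∧
        IsIso ((interiorFunctor k).mapSquare.map α) ∧ IsIso α.τ₄ := by
  obtain ⟨he₁₃, he₂₄, he₃₄⟩ := h.isInteriorEtale
  have he₁₄ := he₁₃.comp he₃₄
  obtain ⟨S, β₁, β₂, β₃, β₄, ⟨v, q, p, u, hv, hq, hp, hu, hN⟩, hβ₁, hβ₂, hβ₃, hβ₄, c₁₃, c₁₂, c₂₄,
    c₃₄⟩ := h.exists_isMVFinSquare
  have hou := hN.openImmersion_u
  have hep := hN.etale_p
  have heq := hN.etale_q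
  have hβ₄' : IsIso (Hom.interior β₄) := inferInstanceAs (IsIso ((interiorFunctor k).map β₄))
  -- a modification of the new base which has an ambient morphism to the base of `S`
  obtain ⟨Y, e, he, G, hY, hG⟩ := exists_isIso_extends T'.X₄.property (τ.τ₄.hom ≫ inv β₄)
  have he' : IsIso (Hom.interior e) := inferInstanceAs (IsIso ((interiorFunctor k).map e))
  have hw : (e ≫ τ.τ₄.hom ≫ inv β₄) ≫ β₄ = e ≫ τ.τ₄.hom := by
    rw [Category.assoc, Category.assoc, IsIso.inv_hom_id, Category.comp_id]
  have hvp : v ≫ p = q ≫ u := by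
    ext1
    exact hN.isPullback.w
  -- the base change of the square `S` on the ambient spaces
  obtain ⟨B₂, b₂, H₂, b₂', F₂, hB₂⟩ := exists_isAmbientBaseChange hp hep hG
  obtain ⟨B₃, b₃, H₃, b₃', F₃, hB₃⟩ := exists_isAmbientBaseChange hu inferInstance hG
  obtain ⟨B₁, b₁, H₁, b₁', F₁, hB₁⟩ := exists_isAmbientBaseChange (hq.comp hu)
    (inferInstanceAs (Etale (q.left ≫ u.left))) hG
  obtain ⟨r₂, R₂, hr₂, hr₂a, hr₂b, hR₂a, hR₂b⟩ :=
    IsAmbientBaseChange.exists_hom hv S.fac hvp hB₁ hB₂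
  obtain ⟨r₃, R₃, hr₃, hr₃a, hr₃b, hR₃a, hR₃b⟩ :=
    IsAmbientBaseChange.exists_hom hq rfl rfl hB₁ hB₃
  have hp₂ := isPullback_hom h₂ he₂₄
  have hp₃ := isPullback_hom h₃ he₃₄
  -- its morphism to `T'`, by the universal properties of the corners of `T'`
  obtain ⟨m₂, hm₂a, hm₂b, hm₂⟩ := hB₂.exists_hom_isPullback hp₂
    (isPullback_interior_and_isMaxModulus h₂ he₂₄).1 β₂ e β₄ c₂₄ hw
  obtain ⟨m₃, hm₃a, hm₃b, hm₃⟩ := hB₃.exists_hom_isPullback hp₃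
    (isPullback_interior_and_isMaxModulus h₃ he₃₄).1 β₃ e β₄ c₃₄ hw
  obtain ⟨m₁, hm₁a, hm₁b, hm₁⟩ := hB₁.exists_hom_isPullback (isPullback_hom h₁ he₁₄)
    (isPullback_interior_and_isMaxModulus h₁ he₁₄).1 β₁ e β₄ (by
      rw [Category.assoc, c₃₄, ← Category.assoc, c₁₃, Category.assoc]
      rfl) hw
  let S' : Square (ModulusPair k) :=
    { f₁₂ := r₂
      f₁₃ := r₃
      f₂₄ := b₂'
      f₃₄ := b₃'
      fac := hr₂b.trans hr₃b.symm }
  let α : S' ⟶ T'.map (isProperPair k).ι :=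
    { τ₁ := m₁
      τ₂ := m₂
      τ₃ := m₃
      τ₄ := e
      comm₁₂ := by
        apply hp₂.hom_ext
        · change (r₂ ≫ m₂) ≫ τ.τ₂.hom = (m₁ ≫ T'.f₁₂.hom) ≫ τ.τ₂.hom
          have c : T'.f₁₂.hom ≫ τ.τ₂.hom = τ.τ₁.hom ≫ T.f₁₂.hom := congr(($τ.comm₁₂).hom)
          rw [Category.assoc, Category.assoc, hm₂a, c, reassoc_of% hr₂a, reassoc_of% hm₁a, c₁₂]
        · change (r₂ ≫ m₂) ≫ T'.f₂₄.hom = (m₁ ≫ T'.f₁₂.hom) ≫ T'.f₂₄.hom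
          have c : T'.f₁₂.hom ≫ T'.f₂₄.hom = (T'.f₁₃ ≫ T'.f₃₄).hom := congr(($T'.fac).hom)
          rw [Category.assoc, Category.assoc, hm₂b, c, hm₁b, reassoc_of% hr₂b]
      comm₁₃ := by
        apply hp₃.hom_ext
        · change (r₃ ≫ m₃) ≫ τ.τ₃.hom = (m₁ ≫ T'.f₁₃.hom) ≫ τ.τ₃.hom
          have c : T'.f₁₃.hom ≫ τ.τ₃.hom = τ.τ₁.hom ≫ T.f₁₃.hom := congr(($τ.comm₁₃).hom)
          rw [Category.assoc, Category.assoc, hm₃a, c, reassoc_of% hr₃a, reassoc_of% hm₁a, c₁₃]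
        · change (r₃ ≫ m₃) ≫ T'.f₃₄.hom = (m₁ ≫ T'.f₁₃.hom) ≫ T'.f₃₄.hom
          rw [Category.assoc, Category.assoc, hm₃b, reassoc_of% hr₃b]
          exact hm₁b.symm
      comm₂₄ := hm₂b.symm
      comm₃₄ := hm₃b.symm }
  have hN' : IsElementaryNisnevich R₂.left R₃.left F₂.left F₃.left := by
    refine hN.baseChange (g := G.left) (gV := H₂.left) (gU := H₃.left) (gW := H₁.left)
      (hB₂.isPullback_ambient.map (Over.forget _)) (hB₃.isPullback_ambient.map (Over.forget _)) ?_
      congr(($hR₂a).left) congr(($hR₃a).left) congr(($(hR₂b.trans hR₃b.symm)).left)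
    have := hB₁.isPullback_ambient.map (Over.forget _)
    rwa [← hR₃b] at this
  exact ⟨S', α, ⟨S', ⟨R₂, R₃, F₂, F₃, hr₂, hr₃, hB₂.isMinimalExtension, hB₃.isMinimalExtension,
    hN'⟩, ⟨Iso.refl _⟩⟩, hY, isIso_mapSquare α hm₁ hm₂ hm₃ he', he⟩

/-- The MV-squares are stable under base change. -/
theorem IsMVSquare.exists_baseChange {T : Square (MSm k)} (h : IsMVSquare T) {Y : MSm k}
    (f : Y ⟶ T.X₄) :
    ∃ (X₁ X₂ X₃ : MSm k) (f₁₂ : X₁ ⟶ X₂) (f₁₃ : X₁ ⟶ X₃) (f₂₄ : X₂ ⟶ Y) (f₃₄ : X₃ ⟶ Y)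
      (fac : f₁₂ ≫ f₂₄ = f₁₃ ≫ f₃₄) (t₂ : X₂ ⟶ T.X₂) (t₃ : X₃ ⟶ T.X₃),
      IsMVSquare (Square.mk f₁₂ f₁₃ f₂₄ f₃₄ fac) ∧ t₂ ≫ T.f₂₄ = f₂₄ ≫ f ∧
        t₃ ≫ T.f₃₄ = f₃₄ ≫ f := by
  obtain ⟨he₁₃, he₂₄, he₃₄⟩ := h.isInteriorEtale
  obtain ⟨X₂, t₂, f₂₄, h₂⟩ := exists_isPullback T.f₂₄ f he₂₄
  obtain ⟨X₃, t₃, f₃₄, h₃⟩ := exists_isPullback T.f₃₄ f he₃₄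
  obtain ⟨X₁, t₁, f₁₄, h₁⟩ := exists_isPullback (T.f₁₃ ≫ T.f₃₄) f (he₁₃.comp he₃₄)
  obtain ⟨f₁₂, ha, hb⟩ := h₂.exists_lift (t₁ ≫ T.f₁₂) f₁₄ (by
    rw [Category.assoc, T.fac, h₁.w])
  obtain ⟨f₁₃, hc, hd⟩ := h₃.exists_lift (t₁ ≫ T.f₁₃) f₁₄ (by
    rw [Category.assoc, h₁.w])
  subst hd
  let T' : Square (MSm k) := ⟨f₁₂, f₁₃, f₂₄, f₃₄, hb⟩
  let τ : T' ⟶ T :=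
    { τ₁ := t₁
      τ₂ := t₂
      τ₃ := t₃
      τ₄ := f
      comm₁₂ := ha
      comm₁₃ := hc
      comm₂₄ := h₂.w.symm
      comm₃₄ := h₃.w.symm }
  refine ⟨X₁, X₂, X₃, f₁₂, f₁₃, f₂₄, f₃₄, hb, t₂, t₃, ⟨?_,
    h.exists_dominated_baseChange τ h₁ h₂ h₃,
    h.offDiagonalIso.baseChange he₁₃ he₃₄ he₂₄ τ h₁ h₂ h₃⟩,
    h₂.w, h₃.w⟩
  have hid : IsPullback f (𝟙 _) (𝟙 _) f := IsPullback.of_vert_isIso ⟨by simp⟩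
  refine isPullback_baseChange (d := 𝟙 T.X₄) (e := f) (e' := 𝟙 _) h.isPullback (a := t₂)
    (a' := f₂₄) (b := t₃) (b' := f₃₄) (c := t₁) (c' := f₁₃ ≫ f₃₄) ?_ ?_ hid ?_ ha hb hc rfl
    h₂.w.symm (Category.comp_id _) h₃.w.symm (Category.comp_id _)
  · rwa [Category.comp_id]
  · rwa [Category.comp_id]
  · rw [Category.comp_id, T.fac]
    exact h₁

end MPair

/-! ### MV-squares with an initial corner -/

namespace MPair

/-- An étale surjection `p` whose composition with some surjection `i` is a closed immersion is an
isomorphism: its diagonal is a surjective open immersion, so that `p` is a flat monomorphism. -/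
theorem isIso_of_etale_of_isClosedImmersion {V X Z : Scheme.{u}} (p : V ⟶ X) [Etale p]
    [QuasiCompact p] (i : Z ⟶ V) [Surjective i] [IsClosedImmersion (i ≫ p)] [Surjective p] :
    IsIso p := by
  have hd : Surjective (pullback.diagonal p) := by
    have hs : Surjective (pullback.map (i ≫ p) (i ≫ p) p p i i (𝟙 X) (by simp) (by simp)) :=
      have : MorphismProperty.IsStableUnderComposition @Surjective :=
        ⟨fun _ _ _ _ => inferInstance⟩
      MorphismProperty.pullbackMap (P := @Surjective) ‹_› ‹_› rfl rfl
    have h₁ : IsIso (pullback.diagonal (i ≫ p)) := inferInstance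
    have e : pullback.diagonal (i ≫ p) ≫ pullback.map (i ≫ p) (i ≫ p) p p i i (𝟙 X) (by simp)
        (by simp) = i ≫ pullback.diagonal p := by
      apply pullback.hom_ext
      · rw [Category.assoc, pullback.lift_fst, pullback.diagonal_fst_assoc, Category.assoc,
          pullback.diagonal_fst, Category.comp_id]
      · rw [Category.assoc, pullback.lift_snd, pullback.diagonal_snd_assoc, Category.assoc,
          pullback.diagonal_snd, Category.comp_id]
    have : Surjective (i ≫ pullback.diagonal p) := by
      rw [← e]
      infer_instance
    exact .of_comp i _
  have ho : IsOpenImmersion (pullback.diagonal p) := inferInstance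
  have hi : IsIso (pullback.diagonal p) := by
    apply isIso_of_isOpenImmersion_of_opensRange_eq_top
    ext1
    exact (pullback.diagonal p).surjective.range_eq
  have hm : Mono p := (pullback.isIso_diagonal_iff p).mp hi
  exact Flat.isIso_of_surjective_of_mono p

namespace IsElementaryNisnevich

/-- In an elementary Nisnevich square with `V` empty, the open subscheme `U` is all of `X`. -/
theorem isIso_of_isEmpty_left {W V U X : Scheme.{u}} {v : W ⟶ V} {q : W ⟶ U} {p : V ⟶ X}
    {u : U ⟶ X} (h : IsElementaryNisnevich v q p u) [IsEmpty V] : IsIso u := by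
  have hou := h.openImmersion_u
  have hov := h.openImmersion_v
  obtain ⟨φ, -, hφi⟩ := h.complement_iso
  have h₁ : IsEmpty (complement v).subscheme := (complement v).subschemeι.base.hom.1.isEmpty
  have h₂ : IsEmpty (complement u).subscheme := (inv φ).base.hom.1.isEmpty
  apply isIso_of_isOpenImmersion_of_opensRange_eq_top
  by_contra hne
  obtain ⟨x, hx⟩ : ∃ x, x ∉ u.opensRange := by
    by_contra! hx
    exact hne (eq_top_iff.mpr fun x _ => hx x)
  obtain ⟨y, -⟩ : x ∈ Set.range (complement u).subschemeι := by
    rw [Scheme.IdealSheafData.range_subschemeι]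
    rw [complement, Scheme.IdealSheafData.coe_support_vanishingIdeal]
    exact hx
  exact isEmptyElim y

/-- In an elementary Nisnevich square with `U` empty, the étale morphism `p` induces an isomorphism
on the reductions. -/
theorem isIso_of_isEmpty_right {W V U X : Scheme.{u}} {v : W ⟶ V} {q : W ⟶ U} {p : V ⟶ X}
    {u : U ⟶ X} (h : IsElementaryNisnevich v q p u) [IsEmpty U] [QuasiCompact p] : IsIso p := by
  have hou := h.openImmersion_u
  have hov := h.openImmersion_v
  have hep := h.etale_p
  obtain ⟨φ, hφ, hφi⟩ := h.complement_iso
  have hW : IsEmpty W := q.base.hom.1.isEmpty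
  have hs : ∀ {O Z : Scheme.{u}} (o : O ⟶ Z) [IsOpenImmersion o] [IsEmpty O],
      Surjective (complement o).subschemeι := by
    intro O Z o _ _
    refine ⟨fun x => ?_⟩
    change x ∈ Set.range (complement o).subschemeι
    rw [Scheme.IdealSheafData.range_subschemeι]
    rw [complement, Scheme.IdealSheafData.coe_support_vanishingIdeal]
    rintro ⟨y, -⟩
    exact isEmptyElim y
  have h₁ := hs v
  have h₂ := hs u
  have : Surjective ((complement v).subschemeι ≫ p) := by
    rw [← hφ]
    infer_instance
  have : Surjective p := .of_comp (complement v).subschemeι p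
  have : IsClosedImmersion ((complement v).subschemeι ≫ p) := by
    rw [← hφ]
    infer_instance
  exact isIso_of_etale_of_isClosedImmersion p (complement v).subschemeι

end IsElementaryNisnevich

open ModulusPair
variable {k : Type u} [Field k]

namespace ModulusPair

/-- The interior of a modulus pair is dense, as its divisor is Cartier. -/
theorem isEmpty_ambient (M : ModulusPair k) (h : IsEmpty M.interior.left) :
    IsEmpty M.ambient.left := by
  refine ⟨fun x => ?_⟩
  obtain ⟨V, hxV, a, ha, hI⟩ := M.cartier x
  have hs : (M.divisor.support : Set M.ambient.left) = Set.univ := by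
    rw [Set.eq_univ_iff_forall]
    intro y
    by_contra hy
    exact h.false ⟨y, hy⟩
  -- the local generator of the divisor vanishes everywhere, hence it is nilpotent; as it is a
  -- nonzerodivisor, this means that `1 = 0`
  have hb : M.ambient.left.basicOpen a = ⊥ := by
    rw [eq_bot_iff]
    intro y hy
    have hyV : y ∈ V.1 := Scheme.basicOpen_le _ _ hy
    have hy' : y ∈ M.divisor.support := hs.ge (Set.mem_univ y)
    rw [Scheme.IdealSheafData.mem_support_iff_of_mem hyV, hI, Scheme.zeroLocus_span,
      Scheme.mem_zeroLocus_iff] at hy'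
    exact hy' a rfl hy
  obtain ⟨n, hn⟩ := (Scheme.isNilpotent_iff_basicOpen_eq_bot_of_isCompact V.2.isCompact a).mpr hb
  have h₀ : (0 : Γ(M.ambient.left, V.1)) ∈ nonZeroDivisors Γ(M.ambient.left, V.1) :=
    hn ▸ pow_mem ha n
  have h₁ : (1 : Γ(M.ambient.left, V.1)) = 0 :=
    (mem_nonZeroDivisors_iff_right.mp h₀) 1 (mul_zero 1)
  have h₂ : M.ambient.left.basicOpen (1 : Γ(M.ambient.left, V.1)) = V.1 :=
    Scheme.basicOpen_of_isUnit _ isUnit_one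
  rw [h₁, Scheme.basicOpen_zero] at h₂
  exact (h₂ ▸ hxV : x ∈ (⊥ : M.ambient.left.Opens))

theorem IsMinimalExtension.isIso_of_isIso {M N : ModulusPair k} {f : M ⟶ N}
    {F : M.ambient ⟶ N.ambient} (h : IsMinimalExtension f F) [IsIso F.left] : IsIso f := by
  have hF : IsIso F := by
    have : IsIso ((Over.forget _).map F) := inferInstanceAs (IsIso F.left)
    exact isIso_of_reflects_iso F (Over.forget _)
  obtain ⟨g, hg⟩ := exists_hom_of_ambient (M := N) (N := M) (inv F) (by
    rw [h.minimal, ← Scheme.IdealSheafData.comap_comp, ← Over.comp_left, IsIso.inv_hom_id]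
    simp)
  have hmono : ∀ L : ModulusPair k, Mono L.incl := fun L =>
    Functor.mono_of_mono_map (Over.forget _) (inferInstanceAs (Mono L.incl.left))
  have hM := hmono M
  have hN := hmono N
  refine ⟨g, ?_, ?_⟩
  · ext1
    rw [← cancel_mono M.incl, interior_comp, Category.assoc, ← hg, ← reassoc_of% h.extends_interior]
    simp
  · ext1
    rw [← cancel_mono N.incl, interior_comp, Category.assoc, ← h.extends_interior, ← reassoc_of% hg]
    simp

end ModulusPair

/-- The interior of an initial object of the category of proper modulus pairs is empty. -/
theorem isEmpty_interior_of_isInitial {X : MSm k} (h : IsInitial X) :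
    IsEmpty X.obj.interior.left := by
  let c : CommRingCat.of k ⟶ CommRingCat.of PUnit.{u + 1} := CommRingCat.ofHom
    { toFun := fun _ => .unit
      map_one' := rfl
      map_mul' := fun _ _ => rfl
      map_zero' := rfl
      map_add' := fun _ _ => rfl }
  have hc : IsClosedImmersion (Spec.map c) :=
    IsClosedImmersion.spec_of_surjective _ fun x => ⟨0, Subsingleton.elim _ _⟩
  let E : ModulusPair k :=
    { ambient := Over.mk (Spec.map c)
      isSeparated := inferInstanceAs (IsSeparated (Spec.map c))
      locallyOfFiniteType := inferInstanceAs (LocallyOfFiniteType (Spec.map c))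
      quasiCompact := inferInstanceAs (QuasiCompact (Spec.map c))
      divisor := ⊤
      cartier := fun x => isEmptyElim (α := Spec (.of PUnit.{u + 1})) x
      smooth := by
        have : IsEmpty (Over.mk (Spec.map c)).left :=
          inferInstanceAs (IsEmpty (Spec (.of PUnit.{u + 1})))
        infer_instance }
  let f := h.to (⟨E, inferInstanceAs (IsProper (Spec.map c))⟩ : MSm k)
  have hE : IsEmpty E.ambient.left := inferInstanceAs (IsEmpty (Spec (.of PUnit.{u + 1})))
  exact ((Hom.interior f.hom).left ≫ E.incl.left).base.hom.1.isEmpty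

theorem isIso_hom_of_exists_inv {A B : MSm k} (f : A ⟶ B) [IsIso (Hom.interior f.hom)]
    (g : B.obj ⟶ A.obj) (h : Hom.interior g ≫ Hom.interior f.hom = 𝟙 _) : IsIso f := by
  refine ⟨ObjectProperty.homMk g, ?_, ?_⟩
  · ext1
    ext1
    change Hom.interior f.hom ≫ Hom.interior g = 𝟙 _
    rw [← cancel_mono (Hom.interior f.hom), Category.assoc, h, Category.comp_id, Category.id_comp]
  · ext1
    ext1
    exact h

/-- A morphism `f'` of proper modulus pairs is an isomorphism if it is dominated by an isomorphism `f`,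
through an isomorphism of the targets and a morphism of the sources which is an isomorphism on the
interiors. -/
theorem isIso_of_dominated {A B : ModulusPair k} {A' B' : MSm k} (f : A ⟶ B) [IsIso f]
    (f' : A' ⟶ B') (a : A ⟶ A'.obj) [IsIso (Hom.interior a)] (b : B ⟶ B'.obj) [IsIso b]
    (w : f ≫ b = a ≫ f'.hom) : IsIso f' := by
  have h : Hom.interior f ≫ Hom.interior b = Hom.interior a ≫ Hom.interior f'.hom :=
    congr(Hom.interior $w)
  have e : Hom.interior f'.hom = inv (Hom.interior a) ≫ Hom.interior f ≫ Hom.interior b := by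
    rw [IsIso.eq_inv_comp, h]
  have : IsIso (Hom.interior f'.hom) := by
    rw [e]
    infer_instance
  refine isIso_hom_of_exists_inv f' (inv b ≫ inv f ≫ a) ?_
  rw [← interior_comp, Category.assoc, Category.assoc, ← w, IsIso.inv_hom_id_assoc,
    IsIso.inv_hom_id, interior_id]

namespace IsMVSquare

variable {T : Square (MSm k)}

theorem isIso_of_isInitial_left (h : IsMVSquare T) (hi : IsInitial T.X₂) : IsIso T.f₃₄ := by
  obtain ⟨S, β₁, β₂, β₃, β₄, ⟨v, q, p, u, hv, hq, hp, hu, hN⟩, hβ₁, hβ₂, hβ₃, hβ₄, c₁₃, c₁₂, c₂₄,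
    c₃₄⟩ := h.exists_isMVFinSquare
  have := isEmpty_interior_of_isInitial hi
  have := S.X₂.isEmpty_ambient (Hom.interior β₂).left.base.hom.1.isEmpty
  have := hN.isIso_of_isEmpty_left
  have := hu.isIso_of_isIso
  exact isIso_of_dominated S.f₃₄ T.f₃₄ β₃ β₄ c₃₄

theorem isIso_of_isInitial_right (h : IsMVSquare T) (hi : IsInitial T.X₃) : IsIso T.f₂₄ := by
  obtain ⟨S, β₁, β₂, β₃, β₄, ⟨v, q, p, u, hv, hq, hp, hu, hN⟩, hβ₁, hβ₂, hβ₃, hβ₄, c₁₃, c₁₂, c₂₄,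
    c₃₄⟩ := h.exists_isMVFinSquare
  have := isEmpty_interior_of_isInitial hi
  have := S.X₃.isEmpty_ambient (Hom.interior β₃).left.base.hom.1.isEmpty
  have := hN.isIso_of_isEmpty_right
  have := hp.isIso_of_isIso
  exact isIso_of_dominated S.f₂₄ T.f₂₄ β₂ β₄ c₂₄

end IsMVSquare

end MPair

/-! ### Completeness of cd-structures stable under base change -/

namespace CDStructure
variable {C : Type v} [Category.{w} C] {P : CDStructure C}

/-- Simple coverings can be transported along isomorphisms of the target. -/
theorem IsSimpleCovering.exists_of_isIso {X Y : C} {R : Presieve X} (hR : P.IsSimpleCovering R)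
    (f : X ⟶ Y) [IsIso f] (S : Sieve Y) (h : Sieve.generate R ≤ S.pullback f) :
    ∃ R' : Presieve Y, P.IsSimpleCovering R' ∧ Sieve.generate R' ≤ S := by
  rw [Sieve.generate_le_iff] at h
  cases hR with
  | iso g hg =>
    refine ⟨Presieve.singleton (g ≫ f), .iso _ inferInstance, ?_⟩
    rw [Sieve.generate_le_iff]
    rintro _ _ ⟨⟩
    exact h _ _ .mk
  | square T hT R₂ R₃ h₂ h₃ =>
    let T' : Square C := ⟨T.f₁₂, T.f₁₃, T.f₂₄ ≫ f, T.f₃₄ ≫ f, by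
      rw [← Category.assoc, ← Category.assoc, T.fac]⟩
    have e : T ≅ T' := Square.isoMk (Iso.refl _) (Iso.refl _) (Iso.refl _) (asIso f)
      (by simp [T']) (by simp [T']) (by simp [T']) (by simp [T'])
    have hT' : P.squares T' := P.isClosedUnderIsomorphisms.of_iso e hT
    refine ⟨composite T' R₂ R₃, .square T' hT' R₂ R₃ h₂ h₃, ?_⟩
    rw [Sieve.generate_le_iff]
    rintro Z _ (⟨g, hg, rfl⟩ | ⟨g, hg, rfl⟩)
    · have := h _ (g ≫ T.f₂₄) (Or.inl ⟨g, hg, rfl⟩)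
      rwa [Sieve.pullback_apply, Category.assoc] at this
    · have := h _ (g ≫ T.f₃₄) (Or.inr ⟨g, hg, rfl⟩)
      rwa [Sieve.pullback_apply, Category.assoc] at this

/-- Local character: a sieve contains a simple covering if its restrictions to the non-initial
members of a simple covering do. A distinguished square with an initial corner is not needed for
this, as its opposite side is an isomorphism. -/
theorem IsSimpleCovering.exists_of_forall
    (hleft : ∀ T : Square C, P.squares T → IsInitial T.X₂ → IsIso T.f₃₄)
    (hright : ∀ T : Square C, P.squares T → IsInitial T.X₃ → IsIso T.f₂₄)
    {Y : C} {R : Presieve Y} (hR : P.IsSimpleCovering R) (hY : IsEmpty (IsInitial Y)) (S : Sieve Y)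
    (h : ∀ (Z : C) (g : Z ⟶ Y), R g → IsEmpty (IsInitial Z) →
      ∃ R' : Presieve Z, P.IsSimpleCovering R' ∧ Sieve.generate R' ≤ S.pullback g) :
    ∃ R' : Presieve Y, P.IsSimpleCovering R' ∧ Sieve.generate R' ≤ S := by
  induction hR with
  | iso f hf =>
    obtain ⟨R', hR', hle⟩ := h _ f .mk ⟨fun hi => hY.false (hi.ofIso (asIso f))⟩
    exact hR'.exists_of_isIso f S hle
  | square T hT R₂ R₃ h₂ h₃ ih₂ ih₃ =>
    have H₂ : IsEmpty (IsInitial T.X₂) → ∃ R' : Presieve T.X₂, P.IsSimpleCovering R' ∧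
        Sieve.generate R' ≤ S.pullback T.f₂₄ := fun hi => ih₂ hi _ fun Z g hg hZ => by
      rw [← Sieve.pullback_comp]
      exact h Z (g ≫ T.f₂₄) (Or.inl ⟨g, hg, rfl⟩) hZ
    have H₃ : IsEmpty (IsInitial T.X₃) → ∃ R' : Presieve T.X₃, P.IsSimpleCovering R' ∧
        Sieve.generate R' ≤ S.pullback T.f₃₄ := fun hi => ih₃ hi _ fun Z g hg hZ => by
      rw [← Sieve.pullback_comp]
      exact h Z (g ≫ T.f₃₄) (Or.inr ⟨g, hg, rfl⟩) hZ
    rcases isEmpty_or_nonempty (IsInitial T.X₂) with hi₂ | ⟨⟨hi₂⟩⟩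
    · rcases isEmpty_or_nonempty (IsInitial T.X₃) with hi₃ | ⟨⟨hi₃⟩⟩
      · obtain ⟨R₂', hR₂', hle₂⟩ := H₂ hi₂
        obtain ⟨R₃', hR₃', hle₃⟩ := H₃ hi₃
        rw [Sieve.generate_le_iff] at hle₂ hle₃
        refine ⟨composite T R₂' R₃', .square T hT _ _ hR₂' hR₃', ?_⟩
        rw [Sieve.generate_le_iff]
        rintro Z _ (⟨g, hg, rfl⟩ | ⟨g, hg, rfl⟩)
        · exact hle₂ _ g hg
        · exact hle₃ _ g hg
      · have := hright T hT hi₃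
        obtain ⟨R', hR', hle⟩ := H₂ hi₂
        exact hR'.exists_of_isIso T.f₂₄ S hle
    · have := hleft T hT hi₂
      obtain ⟨R', hR', hle⟩ := H₃ ⟨fun hi => hY.false (hi.ofIso (asIso T.f₃₄))⟩
      exact hR'.exists_of_isIso T.f₃₄ S hle

variable (P) in
/-- A cd-structure which is stable under base change, and in which a distinguished square with an
initial corner has an isomorphism as the opposite side, is complete when the initial objects are
strict. -/
theorem isComplete_of_exists_baseChange
    (hstrict : ∀ {X Y : C}, (Y ⟶ X) → IsInitial X → Nonempty (IsInitial Y))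
    (hleft : ∀ T : Square C, P.squares T → IsInitial T.X₂ → IsIso T.f₃₄)
    (hright : ∀ T : Square C, P.squares T → IsInitial T.X₃ → IsIso T.f₂₄)
    (hpull : ∀ T : Square C, P.squares T → ∀ {Y : C} (f : Y ⟶ T.X₄),
      ∃ (X₁ X₂ X₃ : C) (f₁₂ : X₁ ⟶ X₂) (f₁₃ : X₁ ⟶ X₃) (f₂₄ : X₂ ⟶ Y) (f₃₄ : X₃ ⟶ Y)
        (fac : f₁₂ ≫ f₂₄ = f₁₃ ≫ f₃₄) (t₂ : X₂ ⟶ T.X₂) (t₃ : X₃ ⟶ T.X₃),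
        P.squares (Square.mk f₁₂ f₁₃ f₂₄ f₃₄ fac) ∧ t₂ ≫ T.f₂₄ = f₂₄ ≫ f ∧
          t₃ ≫ T.f₃₄ = f₃₄ ≫ f) : P.IsComplete := by
  -- the sieves whose restrictions to the non-initial objects contain simple coverings
  let J : GrothendieckTopology C :=
    { sieves := fun X => {S | ∀ (Y : C) (f : Y ⟶ X), IsEmpty (IsInitial Y) →
        ∃ R : Presieve Y, P.IsSimpleCovering R ∧ Sieve.generate R ≤ S.pullback f}
      top_mem' := fun X Y f _ =>
        ⟨_, .iso (𝟙 Y) inferInstance, by rw [Sieve.pullback_top]; exact le_top⟩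
      pullback_stable' := fun X Y S f hS Z g hZ => by
        rw [← Sieve.pullback_comp]
        exact hS Z (g ≫ f) hZ
      transitive' := fun X S hS S' hS' Y f hY => by
        obtain ⟨R, hR, hle⟩ := hS Y f hY
        rw [Sieve.generate_le_iff] at hle
        refine hR.exists_of_forall hleft hright hY _ fun Z g hg hZ => ?_
        have := hS' (hle _ g hg) Z (𝟙 Z) hZ
        rwa [Sieve.pullback_id, Sieve.pullback_comp] at this }
  have hJ : P.topology ≤ J := by
    refine sInf_le ⟨fun T hT Y f _ => ?_, fun X ⟨hX⟩ Y f hY => (hstrict f hX).elim hY.elim⟩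
    obtain ⟨X₁, X₂, X₃, f₁₂, f₁₃, f₂₄, f₃₄, fac, t₂, t₃, hT', h₂, h₃⟩ := hpull T hT f
    refine ⟨_, .square _ hT' (Presieve.singleton (𝟙 _)) (Presieve.singleton (𝟙 _))
      (.iso _ inferInstance) (.iso _ inferInstance), ?_⟩
    rw [Sieve.generate_le_iff]
    rintro Z _ (⟨_, ⟨⟩, rfl⟩ | ⟨_, ⟨⟩, rfl⟩)
    · exact ⟨_, t₂, T.f₂₄, Or.inl ⟨𝟙 _, .mk, Category.id_comp _⟩, by simpa using h₂⟩
    · exact ⟨_, t₃, T.f₃₄, Or.inr ⟨𝟙 _, .mk, Category.id_comp _⟩, by simpa using h₃⟩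
  intro X hX S hS
  obtain ⟨R, hR, hle⟩ := hJ X hS X (𝟙 X) hX
  exact ⟨R, hR, by rwa [Sieve.pullback_id] at hle⟩

end CDStructure

namespace MPair
open ModulusPair
variable {k : Type u} [Field k]

/-- A proper modulus pair with empty interior is initial, as the modulus condition on a morphism out of
it is void. -/
theorem nonempty_isInitial_of_isEmpty {X : MSm k} (h : IsEmpty X.obj.interior.left) :
    Nonempty (IsInitial X) := by
  have hext : ∀ {N : MSm k} (f g : X.obj.interior ⟶ N.obj.interior), f = g := fun f g => by
    ext1
    exact isInitialOfIsEmpty.hom_ext _ _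
  refine ⟨IsInitial.ofUniqueHom (fun N => ObjectProperty.homMk (homOfProper N.property
    (Over.homMk (isInitialOfIsEmpty.to _) (isInitialOfIsEmpty.hom_ext _ _)) ?_)) ?_⟩
  · intro R K _ _ _ _ _ _ x
    exact (h.false (x (IsLocalRing.closedPoint K))).elim
  · intro N f
    ext1
    ext1
    exact hext _ _

/-- The initial objects are strict. -/
theorem nonempty_isInitial_of_hom {X Y : MSm k} (f : Y ⟶ X) (h : IsInitial X) :
    Nonempty (IsInitial Y) :=
  have := isEmpty_interior_of_isInitial h
  nonempty_isInitial_of_isEmpty (Hom.interior f.hom).left.base.hom.1.isEmpty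

end MPair

theorem theorem4 (k : Type u) [Field k] : (MPair.cdStructureMV k).IsComplete :=
  CDStructure.isComplete_of_exists_baseChange _ MPair.nonempty_isInitial_of_hom
    (fun _ h => h.isIso_of_isInitial_left) (fun _ h => h.isIso_of_isInitial_right)
    fun _ h _ => h.exists_baseChange
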